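/- **Conventions.** A triangle has vertices $v_1,v_2,v_3$ with angles $\theta_1,\theta_2,\theta_3$ and is considered up to similarity; it is recorded by the point $(\theta_1,\theta_2)$ of the plane $\mathbb R^2$ with its Euclidean metric, where $\theta_1,\theta_2>0$ and $\theta_1+\theta_2<\pi$. $B_\delta(T)$ is the open ball of radius $\delta$ around $T$ in this plane, and the ray emanating from $T$ with direction $\varphi$ is $\{T+r(\cos\varphi,\sin\varphi): r\ge 0\}$. Triangles are placed in the plane with $v_1,v_2,v_3$ in counter-clockwise order. The unfolding of a triangle along a sequence of edges is the sequence of its copies in which each copy is the reflection of the preceding one in the next edge of the sequence. A periodic trajectory $f$ on a triangle $P$ is a periodic billiard path that meets no vertex; its period is one over which its unfolding closes up by a translation, and time is normalized so that this period is $1$. In the unfolding of $P$ along $f$ the trajectory becomes a directed straight line. The orbit tile $\mathcal O$ of $f$ is the set of triangles that admit a periodic trajectory striking the same sequence of edges, over the same period, as $f$. Given a triangle $T$, replace every copy of $P$ in the unfolding along $f$ by $T$. Then $f$ gives a *saddle connection* $g$ on $T$ if the copies of $T$ repeat after one period of $f$ by a translation by a vector $t\neq 0$, and $g(s)=g(0)+st$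 is a straight line through the successive closed copies of $T$ (no vertex lying to the left of $f$ in the unfolding of $P$ becomes a vertex strictly to the right of $g$, and none lying to the right of $f$ becomes a vertex strictly to the left of $g$) that contains at least one vertex. The period $p$ of $g$ is its least positive period as a curve in the unfolding surface $U(T)$, in which copies of $T$ are glued along common edges and copies that differ by a translation are identified. The deformation $\mathring g$ of $g$ avoids each vertex that $g$ strikes by a small semicircle, counter-clockwise if the corresponding vertex of $P$ lies to the left of $f$, and clockwise if it lies to the right. **Lemma.** Let $f$ be a periodic trajectory on a triangle $P$ with orbit tile $\mathcal O$, and let $T$ be a right triangle, with right angle at $v_3$ and angle $\alpha=\theta_1$ at $v_1$, where $\frac{\pi}{4k+2}\le\alpha\le\frac{\pi}{4k}$ for some integer $k\ge 1$. Suppose that $f$ gives a saddle connection $g$ on $T$ that runs through its period more than once over one period of $f$ (that is, $1/p>1$), such that * $g$ strikes the vertex $v_1$ exactly once in its period $p$, * the only other vertex that $g$ strikes, if any, is the right-angle vertex $v_3$, and * $\mathring g$ includes semicircles in both directions around the vertex $v_1$. Then there are $\epsilon_0,\delta_0>0$ such that for all $0<\epsilon<\epsilon_0$ and $0<\delta<\delta_0$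 the set $\mathcal O\cap B_\delta(T)$ is disjoint from the two rays emanating from $T$ with directions $\frac{7\pi}{4}+\epsilon$ and $\frac{7\pi}{4}-\epsilon$. -/

import Mathlib

noncomputable section

namespace Billiards

/-- The parameter plane of triangles up to similarity: a labelled triangle is recorded by its
angles `θ 0` and `θ 1` at the vertices `0` and `1`. -/
abbrev Params := EuclideanSpace ℝ (Fin 2)

/-- The pairs of angles that belong to a nondegenerate triangle. -/
def IsTriangle (θ : Params) : Prop :=
  0 < θ 0 ∧ 0 < θ 1 ∧ θ 0 + θ 1 < Real.pi

/-- The representative of the similarity class `θ`: the counter-clockwise labelled triangle of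
circumdiameter `1` with vertex `0` at the origin and vertex `1` on the positive real axis.
By the law of sines its side lengths are the sines of the opposite angles. -/
def vertex (θ : Params) : Fin 3 → ℂ :=
  ![0, (Real.sin (θ 0 + θ 1) : ℂ), (Real.sin (θ 1) : ℂ) * Complex.exp ((θ 0 : ℂ) * Complex.I)]

/-- The closed triangular billiard table. -/
def table (θ : Params) : Set ℂ :=
  convexHull ℝ (Set.range (vertex θ))

/-- The closed edge `i`, which lies opposite to the vertex `i` (indices modulo `3`). -/
def edgeSet (θ : Params) (i : Fin 3) : Set ℂ :=
  segment ℝ (vertex θ (i + 1)) (vertex θ (i + 2))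

/-- The edge `i` without its two endpoints. -/
def openEdge (θ : Params) (i : Fin 3) : Set ℂ :=
  openSegment ℝ (vertex θ (i + 1)) (vertex θ (i + 2))

/-- The reflection of the plane in the line through the edge `i`. -/
def edgeReflection (θ : Params) (i : Fin 3) : ℂ ≃ᵃⁱ[ℝ] ℂ :=
  EuclideanGeometry.reflection (affineSpan ℝ {vertex θ (i + 1), vertex θ (i + 2)})

/-- A periodic billiard trajectory on the triangle `θ`, recorded by its successive strikes:
`pt j` is the point at which the trajectory strikes the edge `edge j` for the `j`-th time, and
between two strikes it is a straight segment. One period consists of `len` strikes. A period over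
which position and velocity return after an odd number of strikes is traversed twice, so that
the unfolding closes up by a translation. -/
structure PeriodicTrajectory (θ : Params) where
  len : ℕ
  len_pos : 0 < len
  len_even : Even len
  edge : ℤ → Fin 3
  pt : ℤ → ℂ
  edge_periodic : ∀ j, edge (j + len) = edge j
  pt_periodic : ∀ j, pt (j + len) = pt j
  edge_ne : ∀ j, edge (j + 1) ≠ edge j
  pt_mem : ∀ j, pt j ∈ openEdge θ (edge j)
  reflect : ∀ j, SameRay ℝ (pt (j + 1) - pt j)
    ((edgeReflection θ (edge j)).linearIsometryEquiv (pt j - pt (j - 1)))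

/-- The set of triangles, up to similarity, that admit the periodic trajectory `f`: those with a
periodic trajectory whose unfolding runs through the same sequence of edges. -/
def PeriodicTrajectory.orbitTile {P : Params} (f : PeriodicTrajectory P) : Set Params :=
  {θ | IsTriangle θ ∧ ∃ f' : PeriodicTrajectory θ, f'.len = f.len ∧ f'.edge = f.edge}

/-- The `n`-th copy of the triangle when it is unfolded across the edges `w 0, w 1, w 2, …`. -/
def unfoldNat (θ : Params) (w : ℕ → Fin 3) : ℕ → (ℂ ≃ᵃⁱ[ℝ] ℂ)
  | 0 => 1
  | n + 1 => unfoldNat θ w n * edgeReflection θ (w n)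

/-- The unfolding along a two-sided sequence of edges: `copyMap θ w j` carries the triangle to its
`j`-th copy. The copy `0` is the triangle itself, and the copies `j` and `j + 1` are reflections
of each other in their common edge, with label `w j`. -/
def copyMap (θ : Params) (w : ℤ → Fin 3) : ℤ → (ℂ ≃ᵃⁱ[ℝ] ℂ)
  | Int.ofNat n => unfoldNat θ (fun m => w m) n
  | Int.negSucc n => unfoldNat θ (fun m => w (-(m : ℤ) - 1)) (n + 1)

/-- The planar cross product; it is positive if `b` points to the left of `a`. -/
def cross (a b : ℂ) : ℝ := a.re * b.im - a.im * b.re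

/-- The displacement over one period of the straight line to which `f` unfolds. -/
def PeriodicTrajectory.displacement {P : Params} (f : PeriodicTrajectory P) : ℂ :=
  copyMap P f.edge f.len (f.pt f.len) - copyMap P f.edge 0 (f.pt 0)

/-- The vertex `c` of the copy `j` lies to the left of `f` in the unfolding along `f`. -/
def PeriodicTrajectory.OnLeft {P : Params} (f : PeriodicTrajectory P) (j : ℤ) (c : Fin 3) : Prop :=
  0 < cross f.displacement (copyMap P f.edge j (vertex P c) - copyMap P f.edge 0 (f.pt 0))

/-- The vertex `c` of the copy `j` lies to the right of `f` in the unfolding along `f`. -/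
def PeriodicTrajectory.OnRight {P : Params} (f : PeriodicTrajectory P) (j : ℤ) (c : Fin 3) : Prop :=
  cross f.displacement (copyMap P f.edge j (vertex P c) - copyMap P f.edge 0 (f.pt 0)) < 0

/-- A saddle connection `g` on the triangle `T` that arises from the periodic trajectory `f` on
the triangle `P`. Every copy of `P` in the unfolding along `f` is replaced by `T`; the resulting
copies of `T` repeat after one period by the translation by `disp`; and `g` is a directed straight
line with this displacement that runs through the successive (closed) copies of `T`, that is, the
vertices to the left of `f` are nowhere to the right of `g`, and the vertices to the right of `f`
nowhere to the left of `g`. Finally, `g` contains at least one vertex. Time is normalized so that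
one period of `f` has length `1`. -/
structure SaddleConnection {P : Params} (f : PeriodicTrajectory P) (T : Params) where
  base : ℂ
  disp : ℂ
  disp_ne : disp ≠ 0
  closes : ∀ z, copyMap T f.edge f.len z = z + disp
  left : ∀ j c, f.OnLeft j c → 0 ≤ cross disp (copyMap T f.edge j (vertex T c) - base)
  right : ∀ j c, f.OnRight j c → cross disp (copyMap T f.edge j (vertex T c) - base) ≤ 0
  strikes : ∃ (j : ℤ) (c : Fin 3) (s : ℝ), copyMap T f.edge j (vertex T c) = base + s • disp

/-- The identifications of the unfolding surface: a point on the edge `i` of a copy of the triangle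
is the same as the point on the edge `i` of the copy reflected in that edge. Copies that differ by
a translation are not distinguished, so a copy is recorded by its linear part. -/
inductive Glue (θ : Params) :
    (ℂ ≃ₗᵢ[ℝ] ℂ) × table θ → (ℂ ≃ₗᵢ[ℝ] ℂ) × table θ → Prop
  | glue (A : ℂ ≃ₗᵢ[ℝ] ℂ) (i : Fin 3) (x : table θ) (hx : (x : ℂ) ∈ edgeSet θ i) :
      Glue θ (A, x) (A * (edgeReflection θ i).linearIsometryEquiv, x)

/-- The unfolding `U(θ)` of the triangle, with its vertices filled in: copies of the triangle are
glued along their edges, and copies that differ by a translation are identified. -/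
def UnfoldingSurface (θ : Params) : Type :=
  Quot (Glue θ)

namespace SaddleConnection

variable {P T : Params} {f : PeriodicTrajectory P}

/-- The position of `g` in the plane at time `s`. -/
def path (g : SaddleConnection f T) (s : ℝ) : ℂ := g.base + s • g.disp

/-- At time `s` the saddle connection passes through the point `u` of the unfolding surface. -/
def PassesAt (g : SaddleConnection f T) (s : ℝ) (u : UnfoldingSurface T) : Prop :=
  ∃ (j : ℤ) (x : table T), copyMap T f.edge j (x : ℂ) = g.path s ∧
    u = Quot.mk (Glue T) ((copyMap T f.edge j).linearIsometryEquiv, x)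

/-- `g` is `p`-periodic as a curve in the unfolding surface. -/
def HasPeriod (g : SaddleConnection f T) (p : ℝ) : Prop :=
  ∀ s : ℝ, ∃ u, g.PassesAt s u ∧ g.PassesAt (s + p) u

/-- `p` is the period of `g`: the least positive time after which `g` repeats. -/
def IsThePeriod (g : SaddleConnection f T) (p : ℝ) : Prop :=
  IsLeast {q : ℝ | 0 < q ∧ g.HasPeriod q} p

/-- `g` strikes the vertex `c` of the triangle at time `s`. -/
def StrikesAt (g : SaddleConnection f T) (c : Fin 3) (s : ℝ) : Prop :=
  ∃ j : ℤ, copyMap T f.edge j (vertex T c) = g.path s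

/-- The deformation of `g` contains a counter-clockwise semicircle around the vertex `c`: `g`
strikes a copy of this vertex, and the corresponding vertex of `P` lies to the left of `f`. -/
def HasCounterclockwiseSemicircle (g : SaddleConnection f T) (c : Fin 3) : Prop :=
  ∃ (j : ℤ) (s : ℝ), copyMap T f.edge j (vertex T c) = g.path s ∧ f.OnLeft j c

/-- The deformation of `g` contains a clockwise semicircle around the vertex `c`: `g`
strikes a copy of this vertex, and the corresponding vertex of `P` lies to the right of `f`. -/
def HasClockwiseSemicircle (g : SaddleConnection f T) (c : Fin 3) : Prop :=
  ∃ (j : ℤ) (s : ℝ), copyMap T f.edge j (vertex T c) = g.path s ∧ f.OnRight j c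

end SaddleConnection

/-- The ray in the parameter plane that emanates from `T` in the direction `φ`. -/
def ray (T : Params) (φ : ℝ) : Set Params :=
  {x | ∃ r : ℝ, 0 ≤ r ∧ x = T + r • !₂[Real.cos φ, Real.sin φ]}

end Billiards

end

/-! Four copies of a right triangle around the right angle form a rhombus, so the unfolding along
the saddle connection g becomes a chain of rhombi joined along hypotenuses. At each strike of v_1
the chain turns around the struck vertex, counter-clockwise if this vertex lies to the left of f and
clockwise if it lies to the right. `turnCount` counts turns in units of 2θ_1. Since g repeats after
p and strikes v_1 once in this time, the struck vertices V_i are evenly spaced on g. Between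
consecutive strikes the chain always takes the same route, with the same number q of turns
(`exists_turnCount_eq`).

Now vary the angle b of the right triangle around its value a on T. The combinatorics of the chain
do not change, so V_{i+1} - V_i arises from V_i - V_{i-1} by the rotation through 2(b - a)N_i, where
N_i is the sum of q and the turns at strike i (`second_difference`). The turns at a strike are at
least 1 at left vertices and at most -1 at right ones (`turn`). Measure heights by the cross product
with the displacement t of one period. The second difference of the heights of the V_i vanishes on
T, and its derivative in the direction (1, -1) of right triangles is 2 N_i p |t|²
(`exists_hasFDerivAt_cross`).

On a triangle of the orbit tile these heights are periodic in i, and every left vertex is strictly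
higher than every right one. Hence the highest vertex is a left one with second difference at most
0, and the lowest is a right one with second difference at least 0. If q ≥ 0, then N_i > 0 at all
left vertices, and the second differences there are positive in a sector around the direction 7π/4,
a contradiction. If q < 0, then N_i < 0 at all right vertices, and the lowest vertex gives the
contradiction. So the tile misses a whole sector (`exists_sector_disjoint`), which contains both
rays. The apex T is not in the tile because all V_i have the same height there. -/

noncomputable section

namespace Billiards

open Complex ComplexConjugate

/-! ### The planar cross product -/

theorem cross_eq_im (a b : ℂ) : cross a b = (conj a * b).im := by
  simp [cross]; ring

theorem cross_add_right (a b c : ℂ) : cross a (b + c) = cross a b + cross a c := by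
  simp [cross]; ring

theorem cross_sub_right (a b c : ℂ) : cross a (b - c) = cross a b - cross a c := by
  simp [cross]; ring

theorem cross_add_left (a b c : ℂ) : cross (a + b) c = cross a c + cross b c := by
  simp [cross]; ring

theorem cross_sub_left (a b c : ℂ) : cross (a - b) c = cross a c - cross b c := by
  simp [cross]; ring

theorem cross_smul_right (r : ℝ) (a b : ℂ) : cross a (r • b) = r * cross a b := by
  simp [cross]; ring

theorem cross_smul_left (r : ℝ) (a b : ℂ) : cross (r • a) b = r * cross a b := by
  simp [cross]; ring

theorem cross_ofReal_mul_right (r : ℝ) (a b : ℂ) : cross a (r * b) = r * cross a b := by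
  simp [cross]; ring

theorem cross_ofReal_mul_left (r : ℝ) (a b : ℂ) : cross (r * a) b = r * cross a b := by
  simp [cross]; ring

theorem cross_self (a : ℂ) : cross a a = 0 := by
  simp [cross]; ring

theorem cross_swap (a b : ℂ) : cross a b = -cross b a := by
  simp [cross]; ring

theorem cross_neg_left (a b : ℂ) : cross (-a) b = -cross a b := by
  simp [cross]; ring

theorem cross_neg_right (a b : ℂ) : cross a (-b) = -cross a b := by
  simp [cross]; ring

theorem cross_mul_left_cancel (u a b : ℂ) : cross (u * a) (u * b) = ‖u‖ ^ 2 * cross a b := by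
  rw [← Complex.normSq_eq_norm_sq]
  simp [cross, Complex.normSq_apply]; ring

theorem cross_conj (a b : ℂ) : cross (conj a) (conj b) = -cross a b := by
  simp [cross]; ring

/-- Vectors parallel to a nonzero vector `a` are its real multiples. -/
theorem exists_smul_of_cross_eq_zero {a b : ℂ} (ha : a ≠ 0) (h : cross a b = 0) :
    ∃ s : ℝ, b = s • a := by
  -- A vanishing cross product means that `conj a * b` is real. The factor is the quotient b / a,
  -- with numerator and denominator multiplied by `conj a`.
  refine ⟨(conj a * b).re / ‖a‖ ^ 2, ?_⟩
  have hn : (‖a‖ : ℂ) ^ 2 ≠ 0 := by simpa using ha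
  have h1 : conj a * b = ((conj a * b).re : ℂ) := by
    apply Complex.ext
    · rw [ofReal_re]
    · rw [ofReal_im, ← cross_eq_im, h]
  rw [real_smul]
  push_cast
  rw [← h1]
  rw [div_mul_eq_mul_div, eq_div_iff hn, ← Complex.conj_mul' a]
  ring

/-! ### Reflections in the edges -/

/-- The reflection in the line through two distinct points of the complex plane. -/
theorem reflection_affineSpan_pair {a b : ℂ} (hab : a ≠ b) (z : ℂ) :
    EuclideanGeometry.reflection (affineSpan ℝ {a, b}) z
      = a + (b - a) / conj (b - a) * conj (z - a) := by
  have hba : b - a ≠ 0 := sub_ne_zero.2 hab.symm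
  have hcba : conj (b - a) ≠ 0 := (map_ne_zero _).2 hba
  have hn : (‖b - a‖ : ℂ) ^ 2 ≠ 0 := by simpa using hba
  -- Here `t + s * I` is the quotient (z - a) / (b - a). The part with `t` lies on the line and the
  -- part with `s` is orthogonal to it, so the reflection only changes the sign of `s`.
  set t : ℝ := ((z - a) * conj (b - a)).re / ‖b - a‖ ^ 2 with ht
  set s : ℝ := ((z - a) * conj (b - a)).im / ‖b - a‖ ^ 2 with hs
  have hz : z - a = (t + s * I) * (b - a) := by
    have h1 := Complex.re_add_im ((z - a) * conj (b - a))
    rw [ht, hs]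
    push_cast
    have : ((((z - a) * conj (b - a)).re : ℂ) / ‖b - a‖ ^ 2
        + (((z - a) * conj (b - a)).im : ℂ) / ‖b - a‖ ^ 2 * I)
        = ((z - a) * conj (b - a)) / ‖b - a‖ ^ 2 := by
      rw [← h1]; simp; ring
    rw [this, div_mul_eq_mul_div, eq_div_iff hn, ← Complex.mul_conj' (b - a)]
    ring
  have hmem : AffineMap.lineMap a b t ∈ affineSpan ℝ ({a, b} : Set ℂ) :=
    AffineMap.lineMap_mem_affineSpan_pair t a b
  have horth : (s * I * (b - a) : ℂ) ∈ (affineSpan ℝ ({a, b} : Set ℂ)).directionᗮ := by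
    rw [direction_affineSpan, vectorSpan_pair_rev, Submodule.mem_orthogonal_singleton_iff_inner_right]
    simp [Complex.inner]
    ring
  have h := EuclideanGeometry.reflection_orthogonal_vadd hmem horth
  have hz' : (s * I * (b - a) : ℂ) +ᵥ (AffineMap.lineMap a b t : ℂ) = z := by
    rw [AffineMap.lineMap_apply]
    simp only [vsub_eq_sub, vadd_eq_add, real_smul]
    linear_combination -hz
  rw [hz'] at h
  rw [h, AffineMap.lineMap_apply, hz]
  simp only [vsub_eq_sub, vadd_eq_add, real_smul, map_mul, map_add, conj_ofReal, conj_I]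
  field_simp
  ring

theorem vertex_zero (θ : Params) : vertex θ 0 = 0 := rfl

theorem vertex_one (θ : Params) : vertex θ 1 = (Real.sin (θ 0 + θ 1) : ℂ) := rfl

theorem vertex_two (θ : Params) :
    vertex θ 2 = (Real.sin (θ 1) : ℂ) * exp ((θ 0 : ℂ) * I) := rfl

theorem IsTriangle.sin_add_pos {θ : Params} (h : IsTriangle θ) : 0 < Real.sin (θ 0 + θ 1) :=
  Real.sin_pos_of_pos_of_lt_pi (by linarith [h.1, h.2.1]) h.2.2

theorem IsTriangle.sin_zero_pos {θ : Params} (h : IsTriangle θ) : 0 < Real.sin (θ 0) :=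
  Real.sin_pos_of_pos_of_lt_pi h.1 (by linarith [h.2.2, h.2.1])

theorem IsTriangle.sin_one_pos {θ : Params} (h : IsTriangle θ) : 0 < Real.sin (θ 1) :=
  Real.sin_pos_of_pos_of_lt_pi h.2.1 (by linarith [h.2.2, h.1])

/-- The unit vector along the edge `i` is determined up to sign by the square of it, which is the
rotational part of the reflection in this edge. -/
def edgeSquare (θ : Params) : Fin 3 → ℂ :=
  ![exp (-(2 * θ 1 * I)), exp (2 * θ 0 * I), 1]

theorem vertex_two_sub_one (θ : Params) :
    vertex θ 2 - vertex θ 1 = -(Real.sin (θ 0) : ℂ) * exp (-(θ 1 * I)) := by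
  rw [vertex_two, vertex_one]
  apply Complex.ext
  · simp [Complex.exp_re, -ofReal_sin, Real.sin_add, cos_ofReal_re]
    ring
  · simp [Complex.exp_im, -ofReal_sin]
    ring

theorem edgeReflection_zero {θ : Params} (h : IsTriangle θ) (z : ℂ) :
    edgeReflection θ 0 z = vertex θ 1 + exp (-(2 * θ 1 * I)) * conj (z - vertex θ 1) := by
  have hs : (Real.sin (θ 0) : ℂ) ≠ 0 := by exact_mod_cast h.sin_zero_pos.ne'
  have hd := vertex_two_sub_one θ
  have hne : vertex θ 1 ≠ vertex θ 2 := by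
    intro he
    rw [he, sub_self] at hd
    have := mul_ne_zero (neg_ne_zero.2 hs) (exp_ne_zero (-(θ 1 * I)))
    exact this hd.symm
  change EuclideanGeometry.reflection (affineSpan ℝ {vertex θ 1, vertex θ 2}) z = _
  rw [reflection_affineSpan_pair hne, hd]
  congr 2
  rw [map_mul, map_neg, conj_ofReal, ← exp_conj]
  simp only [map_neg, map_mul, conj_ofReal, conj_I]
  rw [mul_div_mul_left _ _ (neg_ne_zero.2 hs), ← exp_sub]
  congr 1
  ring

theorem edgeReflection_one {θ : Params} (h : IsTriangle θ) (z : ℂ) :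
    edgeReflection θ 1 z = exp (2 * θ 0 * I) * conj z := by
  have hs : (Real.sin (θ 1) : ℂ) ≠ 0 := by exact_mod_cast h.sin_one_pos.ne'
  have hne : vertex θ 2 ≠ vertex θ 0 := by
    rw [vertex_two, vertex_zero]
    exact mul_ne_zero hs (exp_ne_zero _)
  have hc : conj (vertex θ 2) = (Real.sin (θ 1) : ℂ) * exp (-(θ 0 * I)) := by
    rw [vertex_two, map_mul, conj_ofReal, ← exp_conj]
    simp
  have hq : vertex θ 2 / conj (vertex θ 2) = exp (2 * θ 0 * I) := by
    rw [hc, vertex_two, mul_div_mul_left _ _ hs, ← exp_sub]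
    congr 1
    ring
  have hc0 : conj (vertex θ 2) ≠ 0 := (map_ne_zero _).2 (by rwa [vertex_zero] at hne)
  change EuclideanGeometry.reflection (affineSpan ℝ {vertex θ 2, vertex θ 0}) z = _
  rw [reflection_affineSpan_pair hne, vertex_zero, zero_sub, map_neg, neg_div_neg_eq, map_sub,
    mul_sub, div_mul_cancel₀ _ hc0, hq]
  ring

theorem edgeReflection_two {θ : Params} (h : IsTriangle θ) (z : ℂ) :
    edgeReflection θ 2 z = conj z := by
  have hs : (Real.sin (θ 0 + θ 1) : ℂ) ≠ 0 := by exact_mod_cast h.sin_add_pos.ne'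
  change EuclideanGeometry.reflection (affineSpan ℝ {vertex θ 0, vertex θ 1}) z = _
  rw [reflection_affineSpan_pair (by rw [vertex_one, vertex_zero]; exact hs.symm), vertex_one,
    vertex_zero]
  simp only [sub_zero, zero_add, conj_ofReal]
  rw [div_self hs, one_mul]

theorem edgeReflection_apply_vertex (θ : Params) {i c : Fin 3} (hc : c ≠ i) :
    edgeReflection θ i (vertex θ c) = vertex θ c := by
  rw [edgeReflection, EuclideanGeometry.reflection_eq_self_iff]
  have : c = i + 1 ∨ c = i + 2 := by revert i c; decide
  rcases this with rfl | rfl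
  · exact left_mem_affineSpan_pair ℝ _ _
  · exact right_mem_affineSpan_pair ℝ _ _

theorem edgeReflection_apply_edgeSet (θ : Params) {i : Fin 3} {x : ℂ} (hx : x ∈ edgeSet θ i) :
    edgeReflection θ i x = x := by
  rw [edgeReflection, EuclideanGeometry.reflection_eq_self_iff]
  rw [edgeSet, ← convexHull_pair] at hx
  exact convexHull_subset_affineSpan _ hx

theorem edgeReflection_mul_self (θ : Params) (i : Fin 3) :
    edgeReflection θ i * edgeReflection θ i = 1 := by
  ext z
  rw [AffineIsometryEquiv.coe_mul, Function.comp_apply]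
  unfold edgeReflection
  rw [EuclideanGeometry.reflection_reflection]
  rfl

/-! ### The copies of the triangle -/

theorem copyMap_zero (θ : Params) (w : ℤ → Fin 3) : copyMap θ w 0 = 1 := rfl

theorem copyMap_succ (θ : Params) (w : ℤ → Fin 3) (j : ℤ) :
    copyMap θ w (j + 1) = copyMap θ w j * edgeReflection θ (w j) := by
  rcases j with n | n
  · rfl
  · rcases n with _ | n
    · change unfoldNat θ (fun m => w m) 0
        = unfoldNat θ (fun m => w (-(m : ℤ) - 1)) 0 * edgeReflection θ (w (-((0 : ℕ) : ℤ) - 1))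
          * edgeReflection θ (w (-1))
      simp only [unfoldNat, one_mul, Nat.cast_zero, neg_zero, zero_sub]
      rw [edgeReflection_mul_self]
    · have h1 : Int.negSucc (n + 1) + 1 = Int.negSucc n := rfl
      rw [h1]
      change unfoldNat θ (fun m => w (-(m : ℤ) - 1)) (n + 1)
        = unfoldNat θ (fun m => w (-(m : ℤ) - 1)) (n + 1)
          * edgeReflection θ (w (-((n + 1 : ℕ) : ℤ) - 1)) * edgeReflection θ (w (Int.negSucc (n + 1)))
      have h2 : -((n + 1 : ℕ) : ℤ) - 1 = Int.negSucc (n + 1) := by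
        rw [Int.negSucc_eq]; push_cast; ring
      rw [h2, mul_assoc, edgeReflection_mul_self, mul_one]

theorem copyMap_eq_succ (θ : Params) (w : ℤ → Fin 3) (j : ℤ) :
    copyMap θ w j = copyMap θ w (j + 1) * edgeReflection θ (w j) := by
  rw [copyMap_succ, mul_assoc, edgeReflection_mul_self, mul_one]

/-- Every step multiplies by a reflection on the right, so the first `m` steps split off on the left
as one fixed motion. -/
theorem copyMap_add_period (θ : Params) {w : ℤ → Fin 3} {m : ℤ} (hw : ∀ j, w (j + m) = w j)
    (j : ℤ) : copyMap θ w (j + m) = copyMap θ w m * copyMap θ w j := by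
  induction j with
  | zero => simp [copyMap_zero]
  | succ i ih =>
    rw [show (i : ℤ) + 1 + m = (i + m) + 1 by ring, copyMap_succ, ih, copyMap_succ, hw, mul_assoc]
  | pred i ih =>
    have h1 := copyMap_eq_succ θ w (-(i : ℤ) - 1 + m)
    rw [show -(i : ℤ) - 1 + m + 1 = -i + m by ring, ih, hw] at h1
    have h2 := copyMap_eq_succ θ w (-(i : ℤ) - 1)
    rw [show -(i : ℤ) - 1 + 1 = -i by ring] at h2
    rw [h1, h2, mul_assoc]

/-- A vertex of the common edge of two neighbouring copies belongs to both. -/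
theorem copyMap_succ_vertex (θ : Params) (w : ℤ → Fin 3) (j : ℤ) {c : Fin 3} (hc : c ≠ w j) :
    copyMap θ w (j + 1) (vertex θ c) = copyMap θ w j (vertex θ c) := by
  rw [copyMap_succ]
  change copyMap θ w j (edgeReflection θ (w j) (vertex θ c)) = _
  rw [edgeReflection_apply_vertex θ hc]

/-- The complex conjugation to the power `j`. -/
def conjPow (j : ℤ) (z : ℂ) : ℂ := if Even j then z else conj z

theorem conjPow_succ (j : ℤ) (z : ℂ) : conjPow (j + 1) z = conjPow j (conj z) := by
  unfold conjPow
  by_cases h : Even j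
  · rw [if_pos h, if_neg (by rw [Int.not_even_iff_odd]; exact h.add_one)]
  · rw [if_neg h, if_pos (by rw [Int.not_even_iff_odd] at h; exact h.add_one)]
    simp

theorem edgeReflection_form {θ : Params} (h : IsTriangle θ) (i : Fin 3) (z : ℂ) :
    edgeReflection θ i z = edgeSquare θ i * conj z
      + (edgeReflection θ i 0) := by
  fin_cases i
  · change edgeReflection θ 0 z = exp (-(2 * θ 1 * I)) * conj z + edgeReflection θ 0 0
    rw [edgeReflection_zero h, edgeReflection_zero h]
    simp
    ring
  · change edgeReflection θ 1 z = exp (2 * θ 0 * I) * conj z + edgeReflection θ 1 0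
    rw [edgeReflection_one h, edgeReflection_one h]
    simp
  · change edgeReflection θ 2 z = 1 * conj z + edgeReflection θ 2 0
    rw [edgeReflection_two h, edgeReflection_two h]
    simp

/-- A formula for `edgeReflection θ i 0` that makes sense for all parameters. -/
def edgeShift (θ : Params) : Fin 3 → ℂ :=
  ![vertex θ 1 - exp (-(2 * θ 1 * I)) * vertex θ 1, 0, 0]

theorem edgeReflection_apply_zero {θ : Params} (h : IsTriangle θ) (i : Fin 3) :
    edgeReflection θ i 0 = edgeShift θ i := by
  fin_cases i
  · change edgeReflection θ 0 0 = vertex θ 1 - exp (-(2 * θ 1 * I)) * vertex θ 1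
    rw [edgeReflection_zero h, vertex_one, zero_sub, map_neg, conj_ofReal]
    ring
  · change edgeReflection θ 1 0 = 0
    rw [edgeReflection_one h]; simp
  · change edgeReflection θ 2 0 = 0
    rw [edgeReflection_two h]; simp

theorem norm_edgeSquare (θ : Params) (i : Fin 3) : ‖edgeSquare θ i‖ = 1 := by
  fin_cases i
  · change ‖exp (-(2 * θ 1 * I))‖ = 1
    rw [show (-(2 * θ 1 * I) : ℂ) = ((-(2 * θ 1) : ℝ) : ℂ) * I by push_cast; ring,
      norm_exp_ofReal_mul_I]
  · change ‖exp (2 * θ 0 * I)‖ = 1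
    rw [show (2 * θ 0 * I : ℂ) = ((2 * θ 0 : ℝ) : ℂ) * I by push_cast; ring,
      norm_exp_ofReal_mul_I]
  · change ‖(1 : ℂ)‖ = 1
    simp

theorem differentiable_edgeSquare (i : Fin 3) : Differentiable ℝ (fun θ => edgeSquare θ i) := by
  have h0 : Differentiable ℝ (fun θ : Params => ((θ 0 : ℝ) : ℂ)) :=
    Complex.ofRealCLM.differentiable.comp (by fun_prop)
  have h1 : Differentiable ℝ (fun θ : Params => ((θ 1 : ℝ) : ℂ)) :=
    Complex.ofRealCLM.differentiable.comp (by fun_prop)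
  fin_cases i
  · change Differentiable ℝ (fun θ : Params => exp (-(2 * θ 1 * I)))
    fun_prop
  · change Differentiable ℝ (fun θ : Params => exp (2 * θ 0 * I))
    fun_prop
  · exact differentiable_const _

theorem differentiable_edgeShift (i : Fin 3) : Differentiable ℝ (fun θ => edgeShift θ i) := by
  have h1 : Differentiable ℝ (fun θ : Params => ((θ 1 : ℝ) : ℂ)) :=
    Complex.ofRealCLM.differentiable.comp (by fun_prop)
  have h2 : Differentiable ℝ (fun θ : Params => vertex θ 1) := by
    change Differentiable ℝ (fun θ : Params => ((Real.sin (θ 0 + θ 1) : ℝ) : ℂ))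
    have h3 : Differentiable ℝ (fun θ : Params => Real.sin (θ 0 + θ 1)) :=
      Real.differentiable_sin.comp (by fun_prop)
    exact Complex.ofRealCLM.differentiable.comp h3
  fin_cases i
  · change Differentiable ℝ (fun θ : Params => vertex θ 1 - exp (-(2 * θ 1 * I)) * vertex θ 1)
    fun_prop
  · exact differentiable_const _
  · exact differentiable_const _

/-- The copies depend differentiably on the triangle. -/
theorem exists_copyMap_form (w : ℤ → Fin 3) (j : ℤ) :
    ∃ U C : Params → ℂ, Differentiable ℝ U ∧ Differentiable ℝ C ∧ (∀ θ, ‖U θ‖ = 1) ∧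
      ∀ θ, IsTriangle θ → ∀ z, copyMap θ w j z = U θ * conjPow j z + C θ := by
  have hconj : ∀ f : Params → ℂ, Differentiable ℝ f → Differentiable ℝ (fun θ => conj (f θ)) :=
    fun f hf => Complex.conjCLE.differentiable.comp hf
  -- One argument serves both directions of the induction, since a reflection is its own inverse and
  -- `j'` may be either neighbour of `j`.
  have hstep : ∀ j j' : ℤ, (∀ z, conjPow j' z = conjPow j (conj z)) → ∀ i,
      (∀ θ, copyMap θ w j' = copyMap θ w j * edgeReflection θ i) →
      (∃ U C : Params → ℂ, Differentiable ℝ U ∧ Differentiable ℝ C ∧ (∀ θ, ‖U θ‖ = 1) ∧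
        ∀ θ, IsTriangle θ → ∀ z, copyMap θ w j z = U θ * conjPow j z + C θ) →
      ∃ U C : Params → ℂ, Differentiable ℝ U ∧ Differentiable ℝ C ∧ (∀ θ, ‖U θ‖ = 1) ∧
        ∀ θ, IsTriangle θ → ∀ z, copyMap θ w j' z = U θ * conjPow j' z + C θ := by
    rintro j j' hjj' i hm ⟨U, C, hU, hC, hn, h⟩
    refine ⟨fun θ => U θ * conjPow j (edgeSquare θ i),
      fun θ => U θ * conjPow j (edgeShift θ i) + C θ, ?_, ?_, ?_, ?_⟩
    · refine hU.mul ?_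
      unfold conjPow
      split_ifs
      · exact differentiable_edgeSquare i
      · exact hconj _ (differentiable_edgeSquare i)
    · refine (hU.mul ?_).add hC
      unfold conjPow
      split_ifs
      · exact differentiable_edgeShift i
      · exact hconj _ (differentiable_edgeShift i)
    · intro θ
      rw [norm_mul, hn, one_mul]
      unfold conjPow
      split_ifs
      · exact norm_edgeSquare θ i
      · rw [RCLike.norm_conj]; exact norm_edgeSquare θ i
    · intro θ hθ z
      rw [hm]
      change copyMap θ w j (edgeReflection θ i z) = _
      rw [h θ hθ, edgeReflection_form hθ, edgeReflection_apply_zero hθ, hjj']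
      unfold conjPow
      split_ifs <;> simp <;> ring
  induction j with
  | zero =>
    refine ⟨fun _ => 1, fun _ => 0, differentiable_const _, differentiable_const _, by simp, ?_⟩
    intro θ _ z
    simp [copyMap_zero, conjPow]
  | succ i ih =>
    exact hstep i (i + 1) (conjPow_succ _) (w i) (fun θ => copyMap_succ θ w i) ih
  | pred i ih =>
    refine hstep (-i) (-i - 1) (fun z => ?_) (w (-i - 1)) (fun θ => ?_) ih
    · have := conjPow_succ (-(i : ℤ) - 1) (conj z)
      rw [show -(i : ℤ) - 1 + 1 = -i by ring] at this
      rw [this, conj_conj]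
    · have := copyMap_eq_succ θ w (-(i : ℤ) - 1)
      rwa [show -(i : ℤ) - 1 + 1 = -i by ring] at this

/-! ### The line of a trajectory and the vertices at its sides -/

/-- The orientation of the copy `j`. -/
def orient (j : ℤ) : ℝ := if Even j then 1 else -1

theorem orient_of_even {j : ℤ} (h : Even j) : orient j = 1 := if_pos h

theorem orient_of_not_even {j : ℤ} (h : ¬Even j) : orient j = -1 := if_neg h

theorem orient_succ (j : ℤ) : orient (j + 1) = -orient j := by
  by_cases h : Even j
  · rw [orient_of_even h, orient_of_not_even (by rw [Int.not_even_iff_odd]; exact h.add_one)]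
  · rw [orient_of_not_even h,
      orient_of_even (by rw [Int.not_even_iff_odd] at h; exact h.add_one), neg_neg]

theorem orient_mul_self (j : ℤ) : orient j * orient j = 1 := by
  unfold orient; split_ifs <;> norm_num

/-- Odd copies are mirror images, which reverses signed areas. -/
theorem cross_copyMap {θ : Params} (hθ : IsTriangle θ) (w : ℤ → Fin 3) (j : ℤ) (a b c d : ℂ) :
    cross (copyMap θ w j a - copyMap θ w j b) (copyMap θ w j c - copyMap θ w j d)
      = orient j * cross (a - b) (c - d) := by
  obtain ⟨U, C, -, -, hn, h⟩ := exists_copyMap_form w j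
  rw [h θ hθ, h θ hθ, h θ hθ, h θ hθ, add_sub_add_right_eq_sub, add_sub_add_right_eq_sub,
    ← mul_sub, ← mul_sub, cross_mul_left_cancel, hn]
  by_cases hj : Even j
  · simp only [conjPow, if_pos hj, orient]; ring
  · simp only [conjPow, if_neg hj, orient, ← map_sub, cross_conj]; ring

theorem cross_vertex_pos {θ : Params} (hθ : IsTriangle θ) (i : Fin 3) :
    0 < cross (vertex θ (i + 2) - vertex θ (i + 1)) (vertex θ i - vertex θ (i + 1)) := by
  have h : 0 < cross (vertex θ 1) (vertex θ 2) := by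
    rw [vertex_one, vertex_two, ← mul_one ((Real.sin (θ 0 + θ 1) : ℝ) : ℂ),
      cross_ofReal_mul_left, cross_ofReal_mul_right]
    have : cross 1 (exp (θ 0 * I)) = Real.sin (θ 0) := by
      simp [cross, Complex.exp_im]
    rw [this]
    have := hθ.sin_add_pos
    have := hθ.sin_zero_pos
    have := hθ.sin_one_pos
    positivity
  fin_cases i
  · change 0 < cross (vertex θ 2 - vertex θ 1) (vertex θ 0 - vertex θ 1)
    rw [vertex_zero, zero_sub, cross_sub_left, cross_neg_right, cross_neg_right, cross_self,
      cross_swap]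
    linarith
  · change 0 < cross (vertex θ 0 - vertex θ 2) (vertex θ 1 - vertex θ 2)
    rw [vertex_zero, zero_sub, cross_sub_right, cross_neg_left, cross_neg_left, cross_self,
      cross_swap]
    linarith
  · change 0 < cross (vertex θ 1 - vertex θ 0) (vertex θ 2 - vertex θ 0)
    rw [vertex_zero, sub_zero, sub_zero]
    exact h

theorem cross_openEdge_self {θ : Params} (i : Fin 3) {x : ℂ} (hx : x ∈ openEdge θ i) :
    cross (vertex θ (i + 2) - vertex θ (i + 1)) (x - vertex θ (i + 1)) = 0 := by
  obtain ⟨a, b, -, -, hab, rfl⟩ := hx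
  have : a • vertex θ (i + 1) + b • vertex θ (i + 2) - vertex θ (i + 1)
      = b • (vertex θ (i + 2) - vertex θ (i + 1)) := by
    rw [← eq_sub_iff_add_eq] at hab
    rw [hab]; module
  rw [this, cross_smul_right, cross_self, mul_zero]

theorem cross_openEdge_pos {θ : Params} (hθ : IsTriangle θ) {i i' : Fin 3} (hi : i' ≠ i) {x : ℂ}
    (hx : x ∈ openEdge θ i') :
    0 < cross (vertex θ (i + 2) - vertex θ (i + 1)) (x - vertex θ (i + 1)) := by
  obtain ⟨a, b, ha, hb, hab, rfl⟩ := hx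
  have hpos := cross_vertex_pos hθ i
  have hcase : i' = i + 1 ∨ i' = i + 2 :=
    (by decide : ∀ i i' : Fin 3, i' ≠ i → i' = i + 1 ∨ i' = i + 2) i i' hi
  rcases hcase with rfl | rfl
  · have e1 : i + 1 + 1 = i + 2 := (by decide : ∀ i : Fin 3, i + 1 + 1 = i + 2) i
    have e2 : i + 1 + 2 = i := (by decide : ∀ i : Fin 3, i + 1 + 2 = i) i
    rw [e1, e2]
    have : a • vertex θ (i + 2) + b • vertex θ i - vertex θ (i + 1)
        = a • (vertex θ (i + 2) - vertex θ (i + 1)) + b • (vertex θ i - vertex θ (i + 1)) := by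
      rw [← eq_sub_iff_add_eq] at hab
      rw [hab]; module
    rw [this, cross_add_right, cross_smul_right, cross_smul_right, cross_self]
    simpa using mul_pos hb hpos
  · have e1 : i + 2 + 1 = i := (by decide : ∀ i : Fin 3, i + 2 + 1 = i) i
    have e2 : i + 2 + 2 = i + 1 := (by decide : ∀ i : Fin 3, i + 2 + 2 = i + 1) i
    rw [e1, e2]
    have : a • vertex θ i + b • vertex θ (i + 1) - vertex θ (i + 1)
        = a • (vertex θ i - vertex θ (i + 1)) := by
      rw [← eq_sub_iff_add_eq'] at hab
      rw [hab]; module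
    rw [this, cross_smul_right]
    exact mul_pos ha hpos

/-- A ray that leaves a triangle through the interior of an edge has the ends of this edge
on its two sides. -/
theorem cross_exit {θ : Params} (hθ : IsTriangle θ) {i i' : Fin 3} (hi : i' ≠ i) {x y : ℂ}
    (hx : x ∈ openEdge θ i') (hy : y ∈ openEdge θ i) :
    0 < cross (y - x) (vertex θ (i + 2) - y) ∧ cross (y - x) (vertex θ (i + 1) - y) < 0 := by
  have h1 := cross_openEdge_pos hθ hi hx
  have h2 := cross_openEdge_self i hy
  -- The path moves from a point on the inner side of the edge to a point of the edge, so it crosses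
  -- the edge vector in a known sense. The two ends of the edge are positive and negative multiples
  -- of this vector away from `y`.
  have h3 : 0 < cross (y - x) (vertex θ (i + 2) - vertex θ (i + 1)) := by
    rw [cross_swap, show y - x = (y - vertex θ (i + 1)) - (x - vertex θ (i + 1)) by ring,
      cross_sub_right, h2]
    linarith
  obtain ⟨a, b, ha, hb, hab, rfl⟩ := hy
  set y := a • vertex θ (i + 1) + b • vertex θ (i + 2) with hy
  have e1 : vertex θ (i + 2) - y = a • (vertex θ (i + 2) - vertex θ (i + 1)) := by
    rw [← eq_sub_iff_add_eq'] at hab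
    rw [hy, hab]; module
  have e2 : vertex θ (i + 1) - y = (-b) • (vertex θ (i + 2) - vertex θ (i + 1)) := by
    rw [← eq_sub_iff_add_eq] at hab
    rw [hy, hab]; module
  rw [e1, e2, cross_smul_right, cross_smul_right]
  exact ⟨mul_pos ha h3, by nlinarith⟩

theorem openEdge_subset_edgeSet (θ : Params) (i : Fin 3) : openEdge θ i ⊆ edgeSet θ i :=
  openSegment_subset_segment ℝ _ _

/-! ### The unfolded trajectory is a straight line -/

namespace PeriodicTrajectory

variable {θ : Params} (f : PeriodicTrajectory θ)

/-- The unfolded position of the strike `j`. -/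
def unfoldedPt (j : ℤ) : ℂ := copyMap θ f.edge j (f.pt j)

theorem copyMap_succ_pt (j : ℤ) : copyMap θ f.edge (j + 1) (f.pt j) = f.unfoldedPt j := by
  rw [copyMap_succ]
  change copyMap θ f.edge j (edgeReflection θ (f.edge j) (f.pt j)) = _
  rw [edgeReflection_apply_edgeSet θ (openEdge_subset_edgeSet θ _ (f.pt_mem j))]
  rfl

theorem copyMap_pt_pred (j : ℤ) : copyMap θ f.edge j (f.pt (j - 1)) = f.unfoldedPt (j - 1) := by
  have := f.copyMap_succ_pt (j - 1)
  rwa [sub_add_cancel] at this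

theorem pt_ne (hθ : IsTriangle θ) (j : ℤ) : f.pt (j + 1) ≠ f.pt j := by
  intro h
  have h1 := cross_openEdge_pos hθ (f.edge_ne j) (f.pt_mem (j + 1))
  rw [h, cross_openEdge_self _ (f.pt_mem j)] at h1
  exact lt_irrefl _ h1

theorem unfoldedPt_sub_ne (hθ : IsTriangle θ) (j : ℤ) :
    f.unfoldedPt (j + 1) - f.unfoldedPt j ≠ 0 := by
  rw [← f.copyMap_succ_pt j, unfoldedPt, sub_ne_zero]
  exact fun h => f.pt_ne hθ j ((copyMap θ f.edge (j + 1)).injective h)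

theorem sameRay_unfoldedPt (j : ℤ) :
    SameRay ℝ (f.unfoldedPt (j + 1) - f.unfoldedPt j) (f.unfoldedPt j - f.unfoldedPt (j - 1)) := by
  have h := (f.reflect j).map (copyMap θ f.edge (j + 1)).linearIsometryEquiv.toLinearEquiv.toLinearMap
  have e1 : (copyMap θ f.edge (j + 1)).linearIsometryEquiv (f.pt (j + 1) - f.pt j)
      = f.unfoldedPt (j + 1) - f.unfoldedPt j := by
    have := (copyMap θ f.edge (j + 1)).map_vsub (f.pt (j + 1)) (f.pt j)
    rw [vsub_eq_sub, vsub_eq_sub, f.copyMap_succ_pt] at this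
    exact this
  have e2 : (copyMap θ f.edge (j + 1)).linearIsometryEquiv
      ((edgeReflection θ (f.edge j)).linearIsometryEquiv (f.pt j - f.pt (j - 1)))
      = f.unfoldedPt j - f.unfoldedPt (j - 1) := by
    have h1 := (edgeReflection θ (f.edge j)).map_vsub (f.pt j) (f.pt (j - 1))
    rw [vsub_eq_sub, vsub_eq_sub] at h1
    have h2 := (copyMap θ f.edge (j + 1)).map_vsub (edgeReflection θ (f.edge j) (f.pt j))
      (edgeReflection θ (f.edge j) (f.pt (j - 1)))
    rw [vsub_eq_sub, vsub_eq_sub] at h2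
    rw [h1, h2]
    have h3 : ∀ x, copyMap θ f.edge (j + 1) (edgeReflection θ (f.edge j) x)
        = copyMap θ f.edge j x := by
      intro x
      rw [copyMap_eq_succ θ f.edge j]
      rfl
    rw [h3, h3, f.copyMap_pt_pred]
    rfl
  change SameRay ℝ ((copyMap θ f.edge (j + 1)).linearIsometryEquiv (f.pt (j + 1) - f.pt j))
    ((copyMap θ f.edge (j + 1)).linearIsometryEquiv
      ((edgeReflection θ (f.edge j)).linearIsometryEquiv (f.pt j - f.pt (j - 1)))) at h
  rwa [e1, e2] at h

/-- All segments of the unfolded trajectory have the same direction. -/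
theorem exists_pos_smul (hθ : IsTriangle θ) (j : ℤ) :
    ∃ r : ℝ, 0 < r ∧ f.unfoldedPt (j + 1) - f.unfoldedPt j
      = r • (f.unfoldedPt 1 - f.unfoldedPt 0) := by
  -- The law of reflection only compares neighbouring segments. The common direction then spreads
  -- from the segment 0 both ways.
  have hstep : ∀ i : ℤ, ∃ r : ℝ, 0 < r ∧ f.unfoldedPt (i + 1) - f.unfoldedPt i
      = r • (f.unfoldedPt i - f.unfoldedPt (i - 1)) := by
    intro i
    have h0 := f.unfoldedPt_sub_ne hθ (i - 1)
    rw [sub_add_cancel] at h0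
    obtain ⟨r₁, r₂, h₁, h₂, h⟩ := (f.sameRay_unfoldedPt i).exists_pos (f.unfoldedPt_sub_ne hθ i) h0
    refine ⟨r₁⁻¹ * r₂, by positivity, ?_⟩
    rw [mul_smul, ← h, smul_smul, inv_mul_cancel₀ h₁.ne', one_smul]
  induction j with
  | zero => exact ⟨1, one_pos, by simp⟩
  | succ i ih =>
    obtain ⟨r, hr, h⟩ := ih
    obtain ⟨s, hs, h'⟩ := hstep (i + 1)
    refine ⟨s * r, by positivity, ?_⟩
    rw [h', add_sub_cancel_right, h, smul_smul]
  | pred i ih =>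
    obtain ⟨r, hr, h⟩ := ih
    obtain ⟨s, hs, h'⟩ := hstep (-i)
    refine ⟨s⁻¹ * r, by positivity, ?_⟩
    rw [sub_add_cancel, mul_smul, ← h, h', smul_smul, inv_mul_cancel₀ hs.ne', one_smul]

theorem exists_smul_unfoldedPt_sub (hθ : IsTriangle θ) (j : ℤ) :
    ∃ r : ℝ, f.unfoldedPt j - f.unfoldedPt 0 = r • (f.unfoldedPt 1 - f.unfoldedPt 0) := by
  induction j with
  | zero => exact ⟨0, by simp⟩
  | succ i ih =>
    obtain ⟨r, h⟩ := ih
    obtain ⟨s, hs, h'⟩ := f.exists_pos_smul hθ i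
    exact ⟨s + r, by rw [add_smul, ← h, ← h']; abel⟩
  | pred i ih =>
    obtain ⟨r, h⟩ := ih
    obtain ⟨s, hs, h'⟩ := f.exists_pos_smul hθ (-i - 1)
    rw [sub_add_cancel] at h'
    exact ⟨r - s, by rw [sub_smul, ← h, ← h']; abel⟩

theorem exists_displacement_eq (hθ : IsTriangle θ) :
    ∃ r : ℝ, 0 < r ∧ f.displacement = r • (f.unfoldedPt 1 - f.unfoldedPt 0) := by
  have h : ∀ n : ℕ, ∃ r : ℝ, 0 < r ∧ f.unfoldedPt ((n + 1 : ℕ) : ℤ) - f.unfoldedPt 0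
      = r • (f.unfoldedPt 1 - f.unfoldedPt 0) := by
    intro n
    induction n with
    | zero => exact ⟨1, one_pos, by simp⟩
    | succ n ih =>
      obtain ⟨r, hr, h⟩ := ih
      obtain ⟨s, hs, h'⟩ := f.exists_pos_smul hθ ((n + 1 : ℕ) : ℤ)
      refine ⟨s + r, by positivity, ?_⟩
      rw [add_smul, ← h, ← h', Nat.cast_succ (n + 1)]
      abel
  obtain ⟨n, hn⟩ : ∃ n, f.len = n + 1 := ⟨f.len - 1, by have := f.len_pos; omega⟩
  obtain ⟨r, hr, h'⟩ := h n
  refine ⟨r, hr, ?_⟩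
  rw [← h', ← hn]
  rfl

/-- Within the copy `j` the trajectory runs from the edge `j - 1` to the edge `j`, and `cross_exit`
tells on which sides the ends of the latter lie. The factor `orient j` corrects for mirror-image
copies. -/
theorem cross_displacement_sides (hθ : IsTriangle θ) (j : ℤ) :
    0 < orient j * cross f.displacement
        (copyMap θ f.edge j (vertex θ (f.edge j + 2)) - copyMap θ f.edge 0 (f.pt 0)) ∧
    orient j * cross f.displacement
        (copyMap θ f.edge j (vertex θ (f.edge j + 1)) - copyMap θ f.edge 0 (f.pt 0)) < 0 := by
  obtain ⟨R, hR, hD⟩ := f.exists_displacement_eq hθ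
  obtain ⟨r, hr⟩ := f.exists_smul_unfoldedPt_sub hθ j
  obtain ⟨s, hs, hv⟩ := f.exists_pos_smul hθ (j - 1)
  rw [sub_add_cancel] at hv
  have hne : f.edge (j - 1) ≠ f.edge j := by
    have := f.edge_ne (j - 1)
    rw [sub_add_cancel] at this
    exact this.symm
  have hex := cross_exit hθ hne (f.pt_mem (j - 1)) (f.pt_mem j)
  -- Heights do not change when the reference point slides along the line from strike 0 to strike
  -- `j`, and the displacement is a positive multiple of each segment.
  have key : ∀ z : ℂ, cross f.displacement (copyMap θ f.edge j z - copyMap θ f.edge 0 (f.pt 0))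
      = R / s * (orient j * cross (f.pt j - f.pt (j - 1)) (z - f.pt j)) := by
    intro z
    have h1 := cross_copyMap hθ f.edge j (f.pt j) (f.pt (j - 1)) z (f.pt j)
    rw [f.copyMap_pt_pred] at h1
    change cross (f.unfoldedPt j - _) (_ - f.unfoldedPt j) = _ at h1
    rw [← h1, hv, hD, cross_smul_left, cross_smul_left]
    have h2 : copyMap θ f.edge j z - copyMap θ f.edge 0 (f.pt 0)
        = (copyMap θ f.edge j z - f.unfoldedPt j) + (f.unfoldedPt j - f.unfoldedPt 0) := by
      change _ - f.unfoldedPt 0 = _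
      abel
    rw [h2, cross_add_right, hr, cross_smul_right, cross_self]
    field_simp
    ring
  have hpos : 0 < R / s := by positivity
  constructor
  · rw [key, mul_left_comm, ← mul_assoc (orient j), orient_mul_self, one_mul]
    exact mul_pos hpos hex.1
  · rw [key, mul_left_comm, ← mul_assoc (orient j), orient_mul_self, one_mul]
    exact mul_neg_of_pos_of_neg hpos hex.2

/-- The side on which a vertex of a crossed edge lies depends on the combinatorics only. -/
theorem onLeft_iff (hθ : IsTriangle θ) (j : ℤ) :
    (f.OnLeft j (f.edge j + 2) ↔ Even j) ∧ (f.OnLeft j (f.edge j + 1) ↔ ¬Even j) ∧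
    (f.OnRight j (f.edge j + 2) ↔ ¬Even j) ∧ (f.OnRight j (f.edge j + 1) ↔ Even j) := by
  have h := f.cross_displacement_sides hθ j
  unfold OnLeft OnRight
  by_cases hj : Even j
  · rw [orient_of_even hj, one_mul, one_mul] at h
    simp [hj, h.1, h.2, h.1.le, h.2.le]
  · rw [orient_of_not_even hj, neg_one_mul, neg_one_mul] at h
    have h1 := neg_pos.1 h.1
    have h2 := neg_lt_zero.1 h.2
    simp [hj, h1, h2, h1.le, h2.le]

/-- The motion over one period preserves orientation because `len` is even. It carries the direction
of the line to a positive multiple of itself, so its unit rotation factor is 1. -/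
theorem displacement_eq_of_pt (hθ : IsTriangle θ) (z : ℂ) :
    copyMap θ f.edge f.len z = z + f.displacement := by
  obtain ⟨U, C, -, -, hn, h⟩ := exists_copyMap_form f.edge f.len
  have hU := h θ hθ
  have heven : Even (f.len : ℤ) := by exact_mod_cast f.len_even
  simp only [conjPow, if_pos heven] at hU
  have hq : ∀ j : ℤ, f.unfoldedPt (j + f.len) = U θ * f.unfoldedPt j + C θ := by
    intro j
    rw [unfoldedPt, copyMap_add_period θ f.edge_periodic, f.pt_periodic, ← hU]
    rfl
  obtain ⟨r, hr, h1⟩ := f.exists_pos_smul hθ (f.len : ℤ)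
  have e0 := hq 0
  have e1 := hq 1
  rw [zero_add] at e0
  rw [add_comm] at e1
  have hv := f.unfoldedPt_sub_ne hθ 0
  rw [zero_add] at hv
  have hUr : U θ = r := by
    rw [e0, e1, add_sub_add_right_eq_sub, ← mul_sub, real_smul] at h1
    exact mul_right_cancel₀ hv h1
  have hU1 : U θ = 1 := by
    have := hn θ
    rw [hUr, norm_real, Real.norm_of_nonneg hr.le] at this
    rw [hUr, this, ofReal_one]
  have hpt : f.pt (f.len : ℤ) = f.pt 0 := by
    have := f.pt_periodic 0
    rwa [zero_add] at this
  rw [displacement, hpt, hU, hU, hU1, copyMap_zero]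
  simp

theorem displacement_eq_apply_zero (hθ : IsTriangle θ) :
    f.displacement = copyMap θ f.edge f.len 0 := by
  rw [f.displacement_eq_of_pt hθ, zero_add]

end PeriodicTrajectory

/-! ### Right triangles and the rhombic unfolding -/

/-- The indefinite sum of a two-sided sequence, normalized to vanish at `0`. -/
def intSum {A : Type*} [AddCommGroup A] (step : ℤ → A) : ℤ → A
  | Int.ofNat n => ∑ i ∈ Finset.range n, step i
  | Int.negSucc n => -∑ i ∈ Finset.range (n + 1), step (-(i : ℤ) - 1)

theorem intSum_succ {A : Type*} [AddCommGroup A] (step : ℤ → A) (j : ℤ) :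
    intSum step (j + 1) = intSum step j + step j := by
  rcases j with n | n
  · change ∑ i ∈ Finset.range (n + 1), step i = ∑ i ∈ Finset.range n, step i + step n
    rw [Finset.sum_range_succ]
  · rcases n with _ | n
    · change ∑ i ∈ Finset.range 0, step i
        = -∑ i ∈ Finset.range (0 + 1), step (-(i : ℤ) - 1) + step (-1)
      simp
    · have h1 : Int.negSucc (n + 1) + 1 = Int.negSucc n := rfl
      have h2 : Int.negSucc (n + 1) = -((n + 1 : ℕ) : ℤ) - 1 := by
        rw [Int.negSucc_eq]; push_cast; ring
      rw [h1]
      change -∑ i ∈ Finset.range (n + 1), step (-(i : ℤ) - 1)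
        = -∑ i ∈ Finset.range (n + 1 + 1), step (-(i : ℤ) - 1) + step (Int.negSucc (n + 1))
      rw [Finset.sum_range_succ _ (n + 1), h2]
      abel

/-- The signed number of hypotenuses crossed up to the copy `j`. -/
def turnCount (w : ℤ → Fin 3) : ℤ → ℤ :=
  intSum fun j => if w j = 2 then (if Even j then -1 else 1) else 0

/-- The number of edges `0` crossed up to the copy `j`. -/
def flipCount (w : ℤ → Fin 3) : ℤ → ℤ :=
  intSum fun j => if w j = 0 then 1 else 0

/-- Four copies of a right triangle around the right angle form a rhombus. This is the
direction of the rhombus that contains the copy `j`. -/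
def rhombusDir (w : ℤ → Fin 3) (a : ℝ) (j : ℤ) : ℂ :=
  (-1) ^ flipCount w j * exp (2 * a * I * turnCount w j)

/-- The vertex `0` of the copy `j`, as a function of the angle of the right triangle. -/
def rhombusVertex (w : ℤ → Fin 3) (a : ℝ) : ℤ → ℂ :=
  intSum fun j => if w j = 0 then rhombusDir w a j * (1 + exp (2 * a * I)) else 0

section

variable {w : ℤ → Fin 3} {j : ℤ}

theorem turnCount_succ_of_ne (h : w j ≠ 2) : turnCount w (j + 1) = turnCount w j := by
  rw [turnCount, intSum_succ, if_neg h, add_zero]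

theorem turnCount_succ_of_even (h : w j = 2) (hj : Even j) :
    turnCount w (j + 1) = turnCount w j - 1 := by
  rw [turnCount, intSum_succ, if_pos h, if_pos hj]; rfl

theorem turnCount_succ_of_odd (h : w j = 2) (hj : ¬Even j) :
    turnCount w (j + 1) = turnCount w j + 1 := by
  rw [turnCount, intSum_succ, if_pos h, if_neg hj]

theorem flipCount_succ_of_ne (h : w j ≠ 0) : flipCount w (j + 1) = flipCount w j := by
  rw [flipCount, intSum_succ, if_neg h, add_zero]

theorem flipCount_succ (h : w j = 0) : flipCount w (j + 1) = flipCount w j + 1 := by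
  rw [flipCount, intSum_succ, if_pos h]

theorem rhombusDir_succ_of_zero (h : w j = 0) (a : ℝ) :
    rhombusDir w a (j + 1) = -rhombusDir w a j := by
  rw [rhombusDir, rhombusDir, flipCount_succ h, turnCount_succ_of_ne (by rw [h]; decide),
    zpow_add_one₀ (by norm_num)]
  ring

theorem rhombusDir_succ_of_one (h : w j = 1) (a : ℝ) :
    rhombusDir w a (j + 1) = rhombusDir w a j := by
  rw [rhombusDir, rhombusDir, flipCount_succ_of_ne (by rw [h]; decide),
    turnCount_succ_of_ne (by rw [h]; decide)]

theorem rhombusDir_succ_of_even (h : w j = 2) (hj : Even j) (a : ℝ) :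
    rhombusDir w a (j + 1) * exp (2 * a * I) = rhombusDir w a j := by
  rw [rhombusDir, rhombusDir, flipCount_succ_of_ne (by rw [h]; decide),
    turnCount_succ_of_even h hj, mul_assoc, ← exp_add]
  congr 2
  push_cast
  ring

theorem rhombusDir_succ_of_odd (h : w j = 2) (hj : ¬Even j) (a : ℝ) :
    rhombusDir w a (j + 1) = rhombusDir w a j * exp (2 * a * I) := by
  rw [rhombusDir, rhombusDir, flipCount_succ_of_ne (by rw [h]; decide),
    turnCount_succ_of_odd h hj, mul_assoc _ (exp _), ← exp_add]
  congr 2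
  push_cast
  ring

theorem rhombusVertex_succ_of_zero (h : w j = 0) (a : ℝ) :
    rhombusVertex w a (j + 1)
      = rhombusVertex w a j + rhombusDir w a j * (1 + exp (2 * a * I)) := by
  rw [rhombusVertex, intSum_succ, if_pos h]

theorem rhombusVertex_succ_of_ne (h : w j ≠ 0) (a : ℝ) :
    rhombusVertex w a (j + 1) = rhombusVertex w a j := by
  rw [rhombusVertex, intSum_succ, if_neg h, add_zero]

theorem rhombusDir_ne_zero (w : ℤ → Fin 3) (a : ℝ) (j : ℤ) : rhombusDir w a j ≠ 0 :=
  mul_ne_zero (zpow_ne_zero _ (by norm_num)) (exp_ne_zero _)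

/-- The direction of a rhombus rotates with the angle of the triangle. -/
theorem rhombusDir_eq (w : ℤ → Fin 3) (a b : ℝ) (j : ℤ) :
    rhombusDir w b j = rhombusDir w a j * exp (2 * (b - a) * I * turnCount w j) := by
  rw [rhombusDir, rhombusDir, mul_assoc _ (exp _), ← exp_add]
  congr 2
  ring

end

/-- The right triangle with angle `a` at the vertex `0`. -/
def rightTriangle (a : ℝ) : Params := !₂[a, Real.pi / 2 - a]

theorem rightTriangle_zero (a : ℝ) : rightTriangle a 0 = a := rfl

theorem rightTriangle_one (a : ℝ) : rightTriangle a 1 = Real.pi / 2 - a := rfl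

theorem isTriangle_rightTriangle {a : ℝ} (h₀ : 0 < a) (h₁ : a < Real.pi / 2) :
    IsTriangle (rightTriangle a) := by
  refine ⟨h₀, ?_, ?_⟩
  · rw [rightTriangle_one]; linarith
  · rw [rightTriangle_zero, rightTriangle_one]; linarith [Real.pi_pos]

theorem vertex_one_rightTriangle (a : ℝ) : vertex (rightTriangle a) 1 = 1 := by
  rw [vertex_one, rightTriangle_zero, rightTriangle_one, add_sub_cancel, Real.sin_pi_div_two,
    ofReal_one]

theorem vertex_two_rightTriangle (a : ℝ) :
    vertex (rightTriangle a) 2 = (1 + exp (2 * a * I)) / 2 := by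
  rw [vertex_two, rightTriangle_zero, rightTriangle_one, Real.sin_pi_div_two_sub, ofReal_cos,
    Complex.cos]
  rw [div_mul_eq_mul_div, add_mul, ← exp_add, ← exp_add, add_comm]
  congr 2
  · rw [neg_mul, neg_add_cancel, exp_zero]
  · congr 1; ring

theorem edgeReflection_zero_rightTriangle {a : ℝ} (h₀ : 0 < a) (h₁ : a < Real.pi / 2) (z : ℂ) :
    edgeReflection (rightTriangle a) 0 z
      = 1 + exp (2 * a * I) - exp (2 * a * I) * conj z := by
  rw [edgeReflection_zero (isTriangle_rightTriangle h₀ h₁), vertex_one_rightTriangle,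
    rightTriangle_one]
  have : exp (-(2 * ((Real.pi / 2 - a : ℝ) : ℂ) * I)) = -exp (2 * a * I) := by
    rw [show -(2 * ((Real.pi / 2 - a : ℝ) : ℂ) * I) = 2 * a * I - Real.pi * I by push_cast; ring,
      exp_sub, exp_pi_mul_I]
    ring
  rw [this, map_sub, map_one]
  ring

theorem exp_mul_conj_exp (a : ℝ) : exp (2 * a * I) * conj (exp (2 * a * I)) = 1 := by
  rw [mul_conj, normSq_eq_norm_sq, show (2 * a * I : ℂ) = ((2 * a : ℝ) : ℂ) * I by push_cast; ring,
    norm_exp_ofReal_mul_I]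
  simp

/-- The copies of a right triangle in rhombic coordinates. -/
theorem copyMap_rightTriangle {a : ℝ} (h₀ : 0 < a) (h₁ : a < Real.pi / 2) (w : ℤ → Fin 3)
    (j : ℤ) (z : ℂ) :
    copyMap (rightTriangle a) w j z = rhombusVertex w a j
      + rhombusDir w a j * (if Even j then z else exp (2 * a * I) * conj z) := by
  have hω := exp_mul_conj_exp a
  set ω := exp (2 * a * I) with hωdef
  have htri := isTriangle_rightTriangle h₀ h₁
  let R : ℤ → ℂ → ℂ := fun j z => rhombusVertex w a j
      + rhombusDir w a j * (if Even j then z else ω * conj z)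
  -- The claimed formula obeys the recursion of `copyMap`. The induction runs in both directions
  -- because the reflections are involutions.
  have hstep : ∀ j z, R (j + 1) z = R j (edgeReflection (rightTriangle a) (w j) z) := by
    intro j z
    have hw : w j = 0 ∨ w j = 1 ∨ w j = 2 := (by decide : ∀ i : Fin 3, i = 0 ∨ i = 1 ∨ i = 2) (w j)
    by_cases hj : Even j
    · have hj' : ¬Even (j + 1) := by rw [Int.not_even_iff_odd]; exact hj.add_one
      simp only [R, if_pos hj, if_neg hj']
      rcases hw with h | h | h
      · rw [rhombusVertex_succ_of_zero h, rhombusDir_succ_of_zero h, h,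
          edgeReflection_zero_rightTriangle h₀ h₁]
        ring
      · rw [rhombusVertex_succ_of_ne (by rw [h]; decide), rhombusDir_succ_of_one h, h,
          edgeReflection_one htri, rightTriangle_zero]
      · rw [rhombusVertex_succ_of_ne (by rw [h]; decide), h, edgeReflection_two htri,
          ← rhombusDir_succ_of_even h hj]
        ring
    · have hj' : Even (j + 1) := by rw [Int.not_even_iff_odd] at hj; exact hj.add_one
      simp only [R, if_neg hj, if_pos hj']
      rcases hw with h | h | h
      · rw [rhombusVertex_succ_of_zero h, rhombusDir_succ_of_zero h, h,
          edgeReflection_zero_rightTriangle h₀ h₁]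
        simp only [map_sub, map_add, map_one, map_mul, conj_conj]
        linear_combination (-rhombusDir w a j * (1 - z)) * hω
      · rw [rhombusVertex_succ_of_ne (by rw [h]; decide), rhombusDir_succ_of_one h, h,
          edgeReflection_one htri, rightTriangle_zero]
        simp only [map_mul, conj_conj]
        linear_combination (-rhombusDir w a j * z) * hω
      · rw [rhombusVertex_succ_of_ne (by rw [h]; decide), h, edgeReflection_two htri,
          rhombusDir_succ_of_odd h hj, conj_conj]
        ring
  change copyMap (rightTriangle a) w j z = R j z
  induction j generalizing z with
  | zero =>
    simp [R, copyMap_zero, rhombusVertex, rhombusDir, flipCount, turnCount, intSum]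
  | succ i ih =>
    rw [copyMap_succ, hstep, ← ih]
    rfl
  | pred i ih =>
    have h := hstep (-(i : ℤ) - 1) (edgeReflection (rightTriangle a) (w (-(i : ℤ) - 1)) z)
    have hr : ∀ x, edgeReflection (rightTriangle a) (w (-(i : ℤ) - 1))
        (edgeReflection (rightTriangle a) (w (-(i : ℤ) - 1)) x) = x := fun x =>
      EuclideanGeometry.reflection_reflection _ _
    rw [hr, sub_add_cancel, ← ih] at h
    rw [← h, copyMap_eq_succ, sub_add_cancel]
    rfl

theorem copyMap_rightTriangle_zero {a : ℝ} (h₀ : 0 < a) (h₁ : a < Real.pi / 2) (w : ℤ → Fin 3)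
    (j : ℤ) : copyMap (rightTriangle a) w j 0 = rhombusVertex w a j := by
  rw [copyMap_rightTriangle h₀ h₁]
  simp

/-! ### Lines through a strip of rhombi -/

/-- The unfolding of a right triangle along a line, seen as a sequence of rhombi. The copy `j` has
its vertex `0` at `c j`, and its rhombus has the sides `F j` and `G j`. The line with direction
`D` passes (weakly) between the ends of the crossed edges, and does not meet the vertices `1`. -/
structure RhombusStrip where
  w : ℤ → Fin 3
  c : ℤ → ℂ
  F : ℤ → ℂ
  G : ℤ → ℂ
  base : ℂ
  D : ℂ
  D_ne : D ≠ 0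
  edge_ne : ∀ j, w (j + 1) ≠ w j
  area : ∀ j, 0 < orient j * cross (F j) (G j)
  succ_zero : ∀ j, w j = 0 → c (j + 1) = c j + F j + G j ∧ F (j + 1) = -G j ∧ G (j + 1) = -F j
  succ_one : ∀ j, w j = 1 → c (j + 1) = c j ∧ F (j + 1) = G j ∧ G (j + 1) = F j
  succ_two : ∀ j, w j = 2 → c (j + 1) = c j ∧ F (j + 1) = F j
  gate_two : ∀ j, w j = 2 → orient j * cross D (c j - base) ≤ 0 ∧
    0 < orient j * cross D (c j + F j - base)
  gate_zero : ∀ j, w j = 0 → 0 ≤ orient j * cross D (c j + (1 / 2 : ℝ) • (F j + G j) - base) ∧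
    orient j * cross D (c j + F j - base) < 0
  far_ne : ∀ j, cross D (c j + F j - base) ≠ 0

namespace RhombusStrip

variable (S : RhombusStrip) {j : ℤ} {s : ℝ}

/-- The point of the line at time `s`. -/
def line (s : ℝ) : ℂ := S.base + s • S.D

theorem line_sub (s t : ℝ) : S.line s - S.line t = (s - t) • S.D := by
  rw [line, line, sub_smul]; abel

theorem w_cases (j : ℤ) : S.w j = 0 ∨ S.w j = 1 ∨ S.w j = 2 :=
  (by decide : ∀ i : Fin 3, i = 0 ∨ i = 1 ∨ i = 2) (S.w j)

theorem cross_ne (j : ℤ) : cross (S.F j) (S.G j) ≠ 0 := by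
  intro h
  have := S.area j
  rw [h, mul_zero] at this
  exact lt_irrefl _ this

theorem eq_zero_of_combination {x y : ℝ} (h : x • S.F j + y • S.G j = 0) : x = 0 ∧ y = 0 := by
  have h1 : cross (S.F j) (x • S.F j + y • S.G j) = 0 := by rw [h]; simp [cross]
  have h2 : cross (x • S.F j + y • S.G j) (S.G j) = 0 := by rw [h]; simp [cross]
  rw [cross_add_right, cross_smul_right, cross_smul_right, cross_self, mul_zero, zero_add] at h1
  rw [cross_add_left, cross_smul_left, cross_smul_left, cross_self, mul_zero, add_zero] at h2
  exact ⟨(mul_eq_zero.1 h2).resolve_right (S.cross_ne j),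
    (mul_eq_zero.1 h1).resolve_right (S.cross_ne j)⟩

theorem coords_unique {x y x' y' : ℝ}
    (h : S.c j + x • S.F j + y • S.G j = S.c j + x' • S.F j + y' • S.G j) : x = x' ∧ y = y' := by
  have : (x - x') • S.F j + (y - y') • S.G j = 0 := by
    rw [sub_smul, sub_smul]
    linear_combination h
  have := S.eq_zero_of_combination this
  exact ⟨sub_eq_zero.1 this.1, sub_eq_zero.1 this.2⟩

theorem add_ne (j : ℤ) : S.c j + S.F j + S.G j ≠ S.c j := by
  intro h
  have h1 : (1 : ℝ) • S.F j + (1 : ℝ) • S.G j = 0 := by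
    rw [one_smul, one_smul]; linear_combination h
  exact one_ne_zero (S.eq_zero_of_combination h1).1

theorem c_succ_of_ne_zero (h : S.w j ≠ 0) : S.c (j + 1) = S.c j := by
  rcases S.w_cases j with h0 | h1 | h2
  · exact absurd h0 h
  · exact (S.succ_one j h1).1
  · exact (S.succ_two j h2).1

theorem c_succ_ne (h : S.w j = 0) : S.c (j + 1) ≠ S.c j := by
  rw [(S.succ_zero j h).1]
  exact S.add_ne j

/-- The line does not turn around the right angle through three edges. -/
theorem not_zero_one_zero (h0 : S.w j = 0) (h1 : S.w (j + 1) = 1) (h2 : S.w (j + 2) = 0) :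
    False := by
  have g0 := S.gate_zero j h0
  have g2 := S.gate_zero (j + 2) h2
  have e0 := S.succ_zero j h0
  have e1 := S.succ_one (j + 1) h1
  rw [show j + 1 + 1 = j + 2 by ring] at e1
  have ho : orient (j + 2) = orient j := by
    rw [show j + 2 = j + 1 + 1 by ring, orient_succ, orient_succ, neg_neg]
  have hF : S.c (j + 2) + S.F (j + 2) - S.base = S.c j + S.G j - S.base := by
    rw [e1.1, e1.2.1, e0.1, e0.2.2]; ring
  rw [ho, hF] at g2
  -- The right-angle vertex is the midpoint of `c + F` and `c + G`. The gates `j` and `j + 2` put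
  -- these two points strictly on one side of the line, yet the gate `j` puts the midpoint weakly on
  -- the other.
  have hsum : cross S.D (S.c j + S.F j - S.base) + cross S.D (S.c j + S.G j - S.base)
      = 2 * cross S.D (S.c j + (1 / 2 : ℝ) • (S.F j + S.G j) - S.base) := by
    rw [← cross_add_right, ← cross_smul_right]
    congr 1
    module
  have : orient j * (cross S.D (S.c j + S.F j - S.base) + cross S.D (S.c j + S.G j - S.base))
      = 2 * (orient j * cross S.D (S.c j + (1 / 2 : ℝ) • (S.F j + S.G j) - S.base)) := by
    rw [hsum]; ring
  linarith [g0.1, g0.2, g2.2]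

/-- Hypotenuses are crossed frequently. -/
theorem exists_two (j : ℤ) : ∃ i ∈ Finset.range 4, S.w (j + (i : ℕ)) = 2 := by
  by_contra hcon
  have h0 : S.w j ≠ 2 := fun h => hcon ⟨0, by simp, by simpa using h⟩
  have h1 : S.w (j + 1) ≠ 2 := fun h => hcon ⟨1, by simp, by simpa using h⟩
  have h2 : S.w (j + 2) ≠ 2 := fun h => hcon ⟨2, by simp, by simpa using h⟩
  have h3 : S.w (j + 3) ≠ 2 := fun h => hcon ⟨3, by simp, by simpa using h⟩
  have n0 := S.edge_ne j
  have n1 := S.edge_ne (j + 1)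
  have n2 := S.edge_ne (j + 2)
  rw [show j + 1 + 1 = j + 2 by ring] at n1
  rw [show j + 2 + 1 = j + 3 by ring] at n2
  -- Four successive legs alternate between 0 and 1, so the excluded pattern 0, 1, 0 occurs among
  -- them.
  have key : ∀ a b c d : Fin 3, a ≠ 2 → b ≠ 2 → c ≠ 2 → d ≠ 2 → b ≠ a → c ≠ b → d ≠ c →
      (a = 0 ∧ b = 1 ∧ c = 0) ∨ (b = 0 ∧ c = 1 ∧ d = 0) := by decide
  rcases key _ _ _ _ h0 h1 h2 h3 n0 n1 n2 with ⟨a, b, c⟩ | ⟨a, b, c⟩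
  · exact S.not_zero_one_zero a b c
  · exact S.not_zero_one_zero a (by rwa [show j + 1 + 1 = j + 2 by ring])
      (by rwa [show j + 1 + 2 = j + 3 by ring])

/-- The first hypotenuse crossed from the copy `j` on. -/
theorem exists_next (j : ℤ) : ∃ b, j ≤ b ∧ S.w b = 2 ∧ ∀ i, j ≤ i → i < b → S.w i ≠ 2 := by
  obtain ⟨i, -, hi⟩ := S.exists_two j
  obtain ⟨b, ⟨hb1, hb2⟩, hb⟩ := Int.exists_least_of_bdd (P := fun b => j ≤ b ∧ S.w b = 2)
    ⟨j, fun z hz => hz.1⟩ ⟨j + i, by omega, hi⟩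
  refine ⟨b, hb1, hb2, fun i h1 h2 h3 => ?_⟩
  have := hb i ⟨h1, h3⟩
  omega

/-- The last hypotenuse crossed before the copy `j`. -/
theorem exists_prev (j : ℤ) : ∃ b, b < j ∧ S.w b = 2 ∧ ∀ i, b < i → i < j → S.w i ≠ 2 := by
  obtain ⟨i, hi', hi⟩ := S.exists_two (j - 4)
  rw [Finset.mem_range] at hi'
  obtain ⟨b, ⟨hb1, hb2⟩, hb⟩ := Int.exists_greatest_of_bdd (P := fun b => b < j ∧ S.w b = 2)
    ⟨j, fun z hz => hz.1.le⟩ ⟨j - 4 + i, by omega, hi⟩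
  refine ⟨b, hb1, hb2, fun i h1 h2 h3 => ?_⟩
  have := hb i ⟨h2, h3⟩
  omega

/-- The line crosses every hypotenuse of the sequence. -/
theorem exists_crossing (h : S.w j = 2) :
    ∃ τ l : ℝ, 0 ≤ l ∧ l < 1 ∧ S.line τ = S.c j + l • S.F j := by
  obtain ⟨h1, h2⟩ := S.gate_two j h
  rw [show S.c j + S.F j - S.base = (S.c j - S.base) + S.F j by ring, cross_add_right] at h2
  set A := cross S.D (S.c j - S.base) with hA
  set B := cross S.D (S.F j) with hB
  have hoB : 0 < orient j * B := by linarith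
  have hB0 : B ≠ 0 := by rintro h0; rw [h0, mul_zero] at hoB; exact lt_irrefl _ hoB
  -- The height along the hypotenuse is A + lB, which vanishes at l = -A / B. The weak inequality at
  -- the vertex 0 allows l = 0, and the strict one at the vertex 1 excludes l = 1.
  have hl : -A / B = -(orient j * A) / (orient j * B) := by
    rw [← mul_neg, mul_div_mul_left]
    intro h0; rw [h0, zero_mul] at hoB; exact lt_irrefl _ hoB
  have hz : cross S.D (S.c j + (-A / B) • S.F j - S.base) = 0 := by
    rw [show S.c j + (-A / B) • S.F j - S.base = (S.c j - S.base) + (-A / B) • S.F j by abel,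
      cross_add_right, cross_smul_right, ← hA, ← hB]
    field_simp
    ring
  obtain ⟨τ, hτ⟩ := exists_smul_of_cross_eq_zero S.D_ne hz
  refine ⟨τ, -A / B, ?_, ?_, ?_⟩
  · rw [hl]; exact div_nonneg (by linarith) hoB.le
  · rw [hl, div_lt_one hoB]; linarith
  · rw [line, ← hτ]; abel

/-- The time at which the line crosses the hypotenuse between the copies `j` and `j + 1`. -/
def crossTime (j : ℤ) : ℝ :=
  -- The value has a meaning only if the edge `j` is a hypotenuse, since otherwise the line need not
  -- meet this segment.
  Classical.epsilon fun τ => ∃ l : ℝ, 0 ≤ l ∧ l < 1 ∧ S.line τ = S.c j + l • S.F j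

theorem crossTime_spec (h : S.w j = 2) :
    ∃ l : ℝ, 0 ≤ l ∧ l < 1 ∧ S.line (S.crossTime j) = S.c j + l • S.F j :=
  Classical.epsilon_spec (S.exists_crossing h)

theorem cross_D_F (h : S.w j = 2) : 0 < orient j * cross S.D (S.F j) := by
  obtain ⟨h1, h2⟩ := S.gate_two j h
  rw [show S.c j + S.F j - S.base = (S.c j - S.base) + S.F j by ring, cross_add_right] at h2
  linarith

/-- The point `z` belongs to the rhombus around the copy `j`. -/
def InRhombus (j : ℤ) (z : ℂ) : Prop :=
  ∃ x y : ℝ, 0 ≤ x ∧ x ≤ 1 ∧ 0 ≤ y ∧ y ≤ 1 ∧ z = S.c j + x • S.F j + y • S.G j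

/-- The rhombus is symmetric in both legs, so crossing a leg only changes coordinates: the edge 0
sends (x, y) to (1 - y, 1 - x), and the edge 1 to (y, x). -/
theorem inRhombus_succ_iff (h : S.w j ≠ 2) (z : ℂ) : S.InRhombus (j + 1) z ↔ S.InRhombus j z := by
  rcases S.w_cases j with h0 | h1 | h2
  · obtain ⟨e1, e2, e3⟩ := S.succ_zero j h0
    constructor
    · rintro ⟨x, y, hx, hx', hy, hy', rfl⟩
      refine ⟨1 - y, 1 - x, by linarith, by linarith, by linarith, by linarith, ?_⟩
      rw [e1, e2, e3]; module
    · rintro ⟨x, y, hx, hx', hy, hy', rfl⟩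
      refine ⟨1 - y, 1 - x, by linarith, by linarith, by linarith, by linarith, ?_⟩
      rw [e1, e2, e3]; module
  · obtain ⟨e1, e2, e3⟩ := S.succ_one j h1
    constructor
    · rintro ⟨x, y, hx, hx', hy, hy', rfl⟩
      exact ⟨y, x, hy, hy', hx, hx', by rw [e1, e2, e3]; abel⟩
    · rintro ⟨x, y, hx, hx', hy, hy', rfl⟩
      exact ⟨y, x, hy, hy', hx, hx', by rw [e1, e2, e3]; abel⟩
  · exact absurd h2 h

theorem inRhombus_crossTime (h : S.w j = 2) : S.InRhombus j (S.line (S.crossTime j)) := by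
  obtain ⟨l, h0, h1, h2⟩ := S.crossTime_spec h
  exact ⟨l, 0, h0, h1.le, le_rfl, zero_le_one, by rw [h2, zero_smul, add_zero]⟩

theorem inRhombus_succ_crossTime (h : S.w j = 2) :
    S.InRhombus (j + 1) (S.line (S.crossTime j)) := by
  obtain ⟨l, h0, h1, h2⟩ := S.crossTime_spec h
  obtain ⟨e1, e2⟩ := S.succ_two j h
  exact ⟨l, 0, h0, h1.le, le_rfl, zero_le_one, by rw [h2, e1, e2, zero_smul, add_zero]⟩

/-- The line is not parallel to a hypotenuse that it crosses, so it meets the line through it only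
once. -/
theorem eq_crossTime (h : S.w j = 2) {l : ℝ} (hs : S.line s = S.c j + l • S.F j) :
    s = S.crossTime j := by
  obtain ⟨l', -, -, h'⟩ := S.crossTime_spec h
  have hd := S.line_sub s (S.crossTime j)
  rw [hs, h', add_sub_add_left_eq_sub, ← sub_smul] at hd
  have hc := congrArg (fun v => cross v (S.F j)) hd
  simp only [cross_smul_left, cross_self, mul_zero] at hc
  have hDF := S.cross_D_F h
  rcases mul_eq_zero.1 hc.symm with h0 | h0
  · linarith
  · rw [h0, mul_zero] at hDF
    exact absurd hDF (lt_irrefl _)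

/-- The rhombus `j` lies entirely on the side of the line through the hypotenuse from which the
trajectory comes. -/
theorem le_crossTime (h : S.w j = 2) (hs : S.InRhombus j (S.line s)) : s ≤ S.crossTime j := by
  obtain ⟨l, h0, h1, h2⟩ := S.crossTime_spec h
  obtain ⟨x, y, hx, hx', hy, hy', hz⟩ := hs
  have hd := S.line_sub s (S.crossTime j)
  rw [h2, hz] at hd
  have hd' : (x - l) • S.F j + y • S.G j = (s - S.crossTime j) • S.D := by
    rw [← hd]; module
  have hc := congrArg (fun v => orient j * cross (S.F j) v) hd'
  simp only [cross_add_right, cross_smul_right, cross_self] at hc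
  have hDF := S.cross_D_F h
  rw [cross_swap S.D] at hDF
  have hA := S.area j
  by_contra hlt
  push Not at hlt
  nlinarith [mul_nonneg hy hA.le, mul_pos (sub_pos.2 hlt) hDF]

/-- The next rhombus lies on the far side, because the orientation changes while the side `F` stays
the same. -/
theorem crossTime_le (h : S.w j = 2) (hs : S.InRhombus (j + 1) (S.line s)) :
    S.crossTime j ≤ s := by
  obtain ⟨l, h0, h1, h2⟩ := S.crossTime_spec h
  obtain ⟨x, y, hx, hx', hy, hy', hz⟩ := hs
  obtain ⟨e1, e2⟩ := S.succ_two j h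
  have hd := S.line_sub s (S.crossTime j)
  rw [h2, hz, e1, e2] at hd
  have hd' : (x - l) • S.F j + y • S.G (j + 1) = (s - S.crossTime j) • S.D := by
    rw [← hd]; module
  have hc := congrArg (fun v => orient j * cross (S.F j) v) hd'
  simp only [cross_add_right, cross_smul_right, cross_self] at hc
  have hDF := S.cross_D_F h
  rw [cross_swap S.D] at hDF
  have hA := S.area (j + 1)
  rw [orient_succ, e2] at hA
  by_contra hlt
  push Not at hlt
  nlinarith [mul_nonneg hy hA.le, mul_pos (sub_pos.2 hlt) hDF]

/-- At each intermediate hypotenuse the time can only be raised to its crossing time, at which the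
line is also in the next rhombus. Legs do not change the rhombus. -/
theorem le_crossTime_of_le {b : ℤ} (hb : S.w b = 2) (hjb : j ≤ b)
    (hs : S.InRhombus j (S.line s)) : s ≤ S.crossTime b := by
  obtain ⟨n, rfl⟩ : ∃ n : ℕ, b = j + n := ⟨(b - j).toNat, by omega⟩
  clear hjb
  induction n generalizing j s with
  | zero =>
    rw [Nat.cast_zero, add_zero] at hb ⊢
    exact S.le_crossTime hb hs
  | succ n ih =>
    have e : j + ((n + 1 : ℕ) : ℤ) = (j + 1) + n := by push_cast; ring
    rw [e] at hb ⊢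
    by_cases h : S.w j = 2
    · exact (S.le_crossTime h hs).trans (ih (S.inRhombus_succ_crossTime h) hb)
    · exact ih ((S.inRhombus_succ_iff h _).2 hs) hb

theorem crossTime_le_of_lt {b : ℤ} (hb : S.w b = 2) (hjb : b < j)
    (hs : S.InRhombus j (S.line s)) : S.crossTime b ≤ s := by
  obtain ⟨n, rfl⟩ : ∃ n : ℕ, j = b + 1 + n := ⟨(j - b - 1).toNat, by omega⟩
  clear hjb
  induction n generalizing s with
  | zero =>
    rw [Nat.cast_zero, add_zero] at hs
    exact S.crossTime_le hb hs
  | succ n ih =>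
    have e : b + 1 + ((n + 1 : ℕ) : ℤ) = (b + 1 + n) + 1 := by push_cast; ring
    rw [e] at hs
    by_cases h : S.w (b + 1 + n) = 2
    · exact (ih (S.inRhombus_crossTime h)).trans (S.crossTime_le h hs)
    · exact ih ((S.inRhombus_succ_iff h _).1 hs)

theorem crossTime_mono {b b' : ℤ} (hb : S.w b = 2) (hb' : S.w b' = 2) (h : b ≤ b') :
    S.crossTime b ≤ S.crossTime b' :=
  S.le_crossTime_of_le hb' h (S.inRhombus_crossTime hb)

theorem inRhombus_iff_of_forall_ne {b : ℤ} (hjb : j ≤ b) (h : ∀ i, j ≤ i → i < b → S.w i ≠ 2)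
    (z : ℂ) : S.InRhombus b z ↔ S.InRhombus j z := by
  obtain ⟨n, rfl⟩ : ∃ n : ℕ, b = j + n := ⟨(b - j).toNat, by omega⟩
  clear hjb
  induction n with
  | zero => rw [Nat.cast_zero, add_zero]
  | succ n ih =>
    have e : j + ((n + 1 : ℕ) : ℤ) = (j + n) + 1 := by push_cast; ring
    rw [e, S.inRhombus_succ_iff (h _ (by omega) (by omega)),
      ih fun i h1 h2 => h i h1 (by omega)]

/-- The line passes at time `s` through the vertex `0` of the copy `j`, or through the opposite
vertex of its rhombus. -/
def Corner (j : ℤ) (s : ℝ) : Prop :=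
  S.line s = S.c j ∨ S.line s = S.c j + S.F j + S.G j

/-- Crossing the edge 0 exchanges the two opposite corners of the rhombus and crossing the edge 1
fixes both. This is why `Corner` treats them alike. -/
theorem corner_succ_iff_of_ne (h : S.w j ≠ 2) : S.Corner (j + 1) s ↔ S.Corner j s := by
  unfold Corner
  rcases S.w_cases j with h0 | h1 | h2
  · obtain ⟨e1, e2, e3⟩ := S.succ_zero j h0
    rw [e1, e2, e3, show S.c j + S.F j + S.G j + -S.G j + -S.F j = S.c j by ring]
    exact or_comm
  · obtain ⟨e1, e2, e3⟩ := S.succ_one j h1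
    rw [e1, e2, e3, add_right_comm]
  · exact absurd h2 h

/-- The opposite corner has coordinates (1, 1), whereas points of the hypotenuse have second
coordinate 0. -/
theorem eq_c_of_corner (h : S.w j = 2) (hs : S.crossTime j = s) (hc : S.Corner j s) :
    S.line s = S.c j := by
  refine hc.resolve_right fun hc => ?_
  obtain ⟨l, h0, h1, h2⟩ := S.crossTime_spec h
  rw [hs, hc] at h2
  have : S.c j + (1 : ℝ) • S.F j + (1 : ℝ) • S.G j = S.c j + l • S.F j + (0 : ℝ) • S.G j := by
    rw [one_smul, one_smul, zero_smul, add_zero, h2]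
  exact one_ne_zero (S.coords_unique this).2

theorem eq_c_of_corner_succ (h : S.w j = 2) (hs : S.crossTime j = s) (hc : S.Corner (j + 1) s) :
    S.line s = S.c j := by
  obtain ⟨e1, e2⟩ := S.succ_two j h
  rw [← e1]
  refine hc.resolve_right fun hc => ?_
  obtain ⟨l, h0, h1, h2⟩ := S.crossTime_spec h
  rw [hs, hc, ← e1, ← e2] at h2
  have : S.c (j + 1) + (1 : ℝ) • S.F (j + 1) + (1 : ℝ) • S.G (j + 1)
      = S.c (j + 1) + l • S.F (j + 1) + (0 : ℝ) • S.G (j + 1) := by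
    rw [one_smul, one_smul, zero_smul, add_zero, h2]
  exact one_ne_zero (S.coords_unique this).2

theorem corner_succ_iff (h : S.w j = 2 → S.crossTime j = s) : S.Corner (j + 1) s ↔ S.Corner j s := by
  by_cases hw : S.w j = 2
  · constructor
    · exact fun hc => Or.inl (S.eq_c_of_corner_succ hw (h hw) hc)
    · intro hc
      left
      rw [(S.succ_two j hw).1]
      exact S.eq_c_of_corner hw (h hw) hc
  · exact S.corner_succ_iff_of_ne hw

theorem corner_iff_of_forall {b : ℤ} (hjb : j ≤ b)
    (h : ∀ i, j ≤ i → i < b → S.w i = 2 → S.crossTime i = s) :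
    S.Corner b s ↔ S.Corner j s := by
  obtain ⟨n, rfl⟩ : ∃ n : ℕ, b = j + n := ⟨(b - j).toNat, by omega⟩
  clear hjb
  induction n with
  | zero => rw [Nat.cast_zero, add_zero]
  | succ n ih =>
    have e : j + ((n + 1 : ℕ) : ℤ) = (j + n) + 1 := by push_cast; ring
    rw [e, S.corner_succ_iff (h _ (by omega) (by omega)),
      ih fun i h1 h2 => h i h1 (by omega)]

/-- A vertex of a rhombus is struck only when the line enters or leaves the rhombus. -/
theorem crossTime_eq_or {b b' : ℤ} (hb : S.w b = 2) (hbj : b < j)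
    (hb0 : ∀ i, b < i → i < j → S.w i ≠ 2) (hb' : S.w b' = 2) (hjb' : j ≤ b')
    (hb0' : ∀ i, j ≤ i → i < b' → S.w i ≠ 2) (hs : S.line s = S.c j) :
    S.crossTime b = s ∨ S.crossTime b' = s := by
  by_contra hcon
  push Not at hcon
  have hin : S.InRhombus j (S.line s) :=
    ⟨0, 0, le_rfl, zero_le_one, le_rfl, zero_le_one, by rw [hs]; simp⟩
  have h1 := lt_of_le_of_ne (S.crossTime_le_of_lt hb hbj hin) hcon.1
  have h2 := lt_of_le_of_ne (S.le_crossTime_of_le hb' hjb' hin) hcon.2.symm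
  have hm1 : S.InRhombus j (S.line (S.crossTime b)) :=
    (S.inRhombus_iff_of_forall_ne (by omega) (fun i h h' => hb0 i (by omega) h') _).2
      (S.inRhombus_succ_crossTime hb)
  have hm2 : S.InRhombus j (S.line (S.crossTime b')) :=
    (S.inRhombus_iff_of_forall_ne hjb' hb0' _).1 (S.inRhombus_crossTime hb')
  obtain ⟨x, y, hx, -, hy, -, hz⟩ := hm1
  obtain ⟨x', y', hx', -, hy', -, hz'⟩ := hm2
  have e1 := S.line_sub (S.crossTime b) s
  have e2 := S.line_sub (S.crossTime b') s
  rw [hs, hz] at e1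
  rw [hs, hz'] at e2
  -- The vertex would lie strictly between the points of entrance and exit. Seen from it, both lie
  -- in the cone spanned by `F` and `G`, which is pointed, so a positive combination of them
  -- vanishes only if all coordinates do.
  have hlin : ((S.crossTime b' - s) * x + (s - S.crossTime b) * x') • S.F j
      + ((S.crossTime b' - s) * y + (s - S.crossTime b) * y') • S.G j = 0 := by
    have e1' : x • S.F j + y • S.G j = (S.crossTime b - s) • S.D := by rw [← e1]; abel
    have e2' : x' • S.F j + y' • S.G j = (S.crossTime b' - s) • S.D := by rw [← e2]; abel
    calc _ = (S.crossTime b' - s) • (x • S.F j + y • S.G j)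
          + (s - S.crossTime b) • (x' • S.F j + y' • S.G j) := by module
      _ = 0 := by rw [e1', e2']; module
  obtain ⟨k1, k2⟩ := S.eq_zero_of_combination hlin
  have p1 : 0 < S.crossTime b' - s := by linarith
  have p2 : 0 < s - S.crossTime b := by linarith
  have hx0 : x = 0 := by nlinarith [mul_nonneg p1.le hx, mul_nonneg p2.le hx']
  have hy0 : y = 0 := by nlinarith [mul_nonneg p1.le hy, mul_nonneg p2.le hy']
  rw [hx0, hy0, zero_smul, zero_smul, add_zero, add_zero, sub_self] at e1
  have := smul_eq_zero.1 e1.symm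
  rcases this with h | h
  · linarith
  · exact S.D_ne h

/-- Between the moments at which it enters and leaves a rhombus, the line meets no hypotenuse. -/
theorem line_ne_of_generic (hgen : ∀ b, S.w b = 2 → S.crossTime b ≠ s)
    (hin : S.InRhombus j (S.line s)) (l : ℝ) : S.line s ≠ S.c j + l • S.F j := by
  intro hs
  obtain ⟨b, hbj, hb, hb0⟩ := S.exists_prev j
  obtain ⟨n, hjn, hn, hn0⟩ := S.exists_next j
  have h1 := lt_of_le_of_ne (S.crossTime_le_of_lt hb hbj hin) (hgen b hb)
  have h2 := lt_of_le_of_ne (S.le_crossTime_of_le hn hjn hin) (hgen n hn).symm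
  have hm1 : S.InRhombus j (S.line (S.crossTime b)) :=
    (S.inRhombus_iff_of_forall_ne (by omega) (fun i h h' => hb0 i (by omega) h') _).2
      (S.inRhombus_succ_crossTime hb)
  have hm2 : S.InRhombus j (S.line (S.crossTime n)) :=
    (S.inRhombus_iff_of_forall_ne hjn hn0 _).1 (S.inRhombus_crossTime hn)
  obtain ⟨x, y, -, -, hy, -, hz⟩ := hm1
  obtain ⟨x', y', -, -, hy', -, hz'⟩ := hm2
  have e1 := S.line_sub (S.crossTime b) s
  have e2 := S.line_sub (S.crossTime n) s
  rw [hs, hz] at e1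
  rw [hs, hz'] at e2
  have e1' : (x - l) • S.F j + y • S.G j = (S.crossTime b - s) • S.D := by rw [← e1]; module
  have e2' : (x' - l) • S.F j + y' • S.G j = (S.crossTime n - s) • S.D := by rw [← e2]; module
  have c1 := congrArg (fun v => orient j * cross (S.F j) v) e1'
  have c2 := congrArg (fun v => orient j * cross (S.F j) v) e2'
  simp only [cross_add_right, cross_smul_right, cross_self] at c1 c2
  have hA := S.area j
  have k1 : 0 ≤ y * (orient j * cross (S.F j) (S.G j)) := mul_nonneg hy hA.le
  have k2 : 0 ≤ y' * (orient j * cross (S.F j) (S.G j)) := mul_nonneg hy' hA.le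
  -- Before and after `s` the line is on the same closed side of the hypotenuse, and at `s` it is on
  -- the hypotenuse itself. So it is parallel to it.
  have hzero : orient j * cross (S.F j) S.D = 0 := by
    have t1 : (S.crossTime b - s) * (orient j * cross (S.F j) S.D) ≥ 0 := by linarith
    have t2 : (S.crossTime n - s) * (orient j * cross (S.F j) S.D) ≥ 0 := by linarith
    rcases lt_trichotomy (orient j * cross (S.F j) S.D) 0 with h | h | h
    · nlinarith
    · exact h
    · nlinarith
  have hFD : cross S.D (S.F j) = 0 := by
    have := congrArg (fun r => orient j * r) hzero
    simp only [← mul_assoc, orient_mul_self, one_mul, mul_zero] at this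
    rw [cross_swap, this, neg_zero]
  -- A line along the hypotenuse would contain its end at the vertex 1.
  apply S.far_ne j
  have : S.c j + S.F j - S.base = s • S.D + (1 - l) • S.F j := by
    have : S.base + s • S.D = S.c j + l • S.F j := hs
    rw [sub_smul, one_smul]
    linear_combination -this
  rw [this, cross_add_right, cross_smul_right, cross_smul_right, cross_self, hFD]
  ring

/-- A struck vertex `0` is the end of a hypotenuse that is crossed at this very moment, shortly
before or after the copy to which the vertex belongs. -/
theorem exists_crossTime_eq (hs : S.line s = S.c j) :
    ∃ b, S.w b = 2 ∧ S.crossTime b = s ∧ S.line s = S.c b ∧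
      (b = j ∨ (b = j + 1 ∧ S.w j = 1) ∨ b = j - 1 ∨ (b = j - 2 ∧ S.w (j - 1) = 1)) := by
  obtain ⟨b, hbj, hb, hb0⟩ := S.exists_prev j
  obtain ⟨n, hjn, hn, hn0⟩ := S.exists_next j
  rcases S.crossTime_eq_or hb hbj hb0 hn hjn hn0 hs with hτ | hτ
  · have hc : S.Corner (b + 1) s := (S.corner_iff_of_forall (by omega)
      fun i h h' h2 => absurd h2 (hb0 i (by omega) h')).1 (Or.inl hs)
    have hcb := S.eq_c_of_corner_succ hb hτ hc
    refine ⟨b, hb, hτ, hcb, Or.inr (Or.inr ?_)⟩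
    have n1 := S.edge_ne (j - 2)
    have n2 := S.edge_ne (j - 3)
    have n3 := S.edge_ne (j - 4)
    rw [show j - 2 + 1 = j - 1 by ring] at n1
    rw [show j - 3 + 1 = j - 2 by ring] at n2
    rw [show j - 4 + 1 = j - 3 by ring] at n3
    have z1 := @c_succ_of_ne_zero S (j - 1)
    have z2 := @c_succ_of_ne_zero S (j - 2)
    have z3 := @c_succ_of_ne_zero S (j - 3)
    have z4 := @c_succ_of_ne_zero S (j - 4)
    have y1 := @c_succ_ne S (j - 1)
    have y2 := @c_succ_ne S (j - 2)
    rw [show j - 1 + 1 = j by ring] at z1 y1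
    rw [show j - 2 + 1 = j - 1 by ring] at z2 y2
    rw [show j - 3 + 1 = j - 2 by ring] at z3
    rw [show j - 4 + 1 = j - 3 by ring] at z4
    have hb1 : ∀ i, i < j → S.w i = 2 → i ≤ b := fun i h h2 => by
      by_contra hh
      exact hb0 i (by omega) h h2
    have key : ∀ i, i ≤ b → S.w i = 2 → (∀ k, i < k → k < j → S.w k ≠ 2) → b = i := by
      intro i hi hw hk
      by_contra hne
      exact hk b (by omega) hbj hb
    -- Without the pattern 0, 1, 0, the edge 0 occurs at most once between successive hypotenuses.
    -- If it did occur here, the vertex 0 would move to the opposite corner, contradicting `hcb`.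
    -- Hence there is no leg in between, or a single edge 1.
    rcases S.w_cases (j - 1) with h1 | h1 | h1
    · exfalso
      have a1 := y1 h1
      rcases S.w_cases (j - 2) with h2 | h2 | h2
      · exact n1 (by rw [h1, h2])
      · rcases S.w_cases (j - 3) with h3 | h3 | h3
        · exact S.not_zero_one_zero h3 (by rwa [show j - 3 + 1 = j - 2 by ring])
            (by rwa [show j - 3 + 2 = j - 1 by ring])
        · exact n2 (by rw [h2, h3])
        · have : b = j - 3 := key _ (hb1 _ (by omega) h3) h3 fun k k1 k2 => by
            obtain rfl | rfl : k = j - 2 ∨ k = j - 1 := by omega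
            · rw [h2]; decide
            · rw [h1]; decide
          rw [this, hs] at hcb
          rw [z2 (by rw [h2]; decide), z3 (by rw [h3]; decide)] at a1
          exact a1 hcb
      · have : b = j - 2 := key _ (hb1 _ (by omega) h2) h2 fun k k1 k2 => by
          obtain rfl : k = j - 1 := by omega
          rw [h1]; decide
        rw [this, hs] at hcb
        rw [z2 (by rw [h2]; decide)] at a1
        exact a1 hcb
    · refine Or.inr ⟨?_, h1⟩
      have a1 := z1 (by rw [h1]; decide)
      rcases S.w_cases (j - 2) with h2 | h2 | h2
      · exfalso
        have a2 := y2 h2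
        rcases S.w_cases (j - 3) with h3 | h3 | h3
        · exact n2 (by rw [h2, h3])
        · rcases S.w_cases (j - 4) with h4 | h4 | h4
          · exact S.not_zero_one_zero h4 (by rwa [show j - 4 + 1 = j - 3 by ring])
              (by rwa [show j - 4 + 2 = j - 2 by ring])
          · exact n3 (by rw [h3, h4])
          · have : b = j - 4 := key _ (hb1 _ (by omega) h4) h4 fun k k1 k2 => by
              obtain rfl | rfl | rfl : k = j - 3 ∨ k = j - 2 ∨ k = j - 1 := by omega
              · rw [h3]; decide
              · rw [h2]; decide
              · rw [h1]; decide
            rw [this, hs, a1] at hcb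
            rw [z3 (by rw [h3]; decide), z4 (by rw [h4]; decide)] at a2
            exact a2 hcb
        · have : b = j - 3 := key _ (hb1 _ (by omega) h3) h3 fun k k1 k2 => by
            obtain rfl | rfl : k = j - 2 ∨ k = j - 1 := by omega
            · rw [h2]; decide
            · rw [h1]; decide
          rw [this, hs, a1] at hcb
          rw [z3 (by rw [h3]; decide)] at a2
          exact a2 hcb
      · exact absurd (by rw [h1, h2]) n1
      · exact key _ (hb1 _ (by omega) h2) h2 fun k k1 k2 => by
          obtain rfl : k = j - 1 := by omega
          rw [h1]; decide
    · exact Or.inl (key _ (hb1 _ (by omega) h1) h1 fun k k1 k2 => by omega)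
  · have hc : S.Corner n s := (S.corner_iff_of_forall hjn
      fun i h h' h2 => absurd h2 (hn0 i h h')).2 (Or.inl hs)
    have hcn := S.eq_c_of_corner hn hτ hc
    refine ⟨n, hn, hτ, hcn, ?_⟩
    have n1 := S.edge_ne j
    have n2 := S.edge_ne (j + 1)
    have n3 := S.edge_ne (j + 2)
    rw [show j + 1 + 1 = j + 2 by ring] at n2
    rw [show j + 2 + 1 = j + 3 by ring] at n3
    have z1 := @c_succ_of_ne_zero S j
    have z2 := @c_succ_of_ne_zero S (j + 1)
    have z3 := @c_succ_of_ne_zero S (j + 2)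
    have y1 := @c_succ_ne S j
    have y2 := @c_succ_ne S (j + 1)
    rw [show j + 1 + 1 = j + 2 by ring] at z2 y2
    rw [show j + 2 + 1 = j + 3 by ring] at z3
    have key : ∀ i, j ≤ i → S.w i = 2 → (∀ k, j ≤ k → k < i → S.w k ≠ 2) → n = i := by
      intro i hi hw hk
      rcases lt_trichotomy n i with h | h | h
      · exact absurd hn (hk n hjn h)
      · exact h
      · exact absurd hw (hn0 i hi h)
    -- The same list of leg patterns, read forwards from the copy `j`.
    rcases S.w_cases j with h1 | h1 | h1
    · exfalso
      have a1 := y1 h1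
      rcases S.w_cases (j + 1) with h2 | h2 | h2
      · exact n1 (by rw [h1, h2])
      · rcases S.w_cases (j + 2) with h3 | h3 | h3
        · exact S.not_zero_one_zero h1 h2 h3
        · exact n2 (by rw [h2, h3])
        · have : n = j + 2 := key _ (by omega) h3 fun k k1 k2 => by
            obtain rfl | rfl : k = j ∨ k = j + 1 := by omega
            · rw [h1]; decide
            · rw [h2]; decide
          rw [this, hs, z2 (by rw [h2]; decide)] at hcn
          exact a1 hcn.symm
      · have : n = j + 1 := key _ (by omega) h2 fun k k1 k2 => by
          obtain rfl : k = j := by omega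
          rw [h1]; decide
        rw [this, hs] at hcn
        exact a1 hcn.symm
    · refine Or.inr (Or.inl ⟨?_, h1⟩)
      have a1 := z1 (by rw [h1]; decide)
      rcases S.w_cases (j + 1) with h2 | h2 | h2
      · exfalso
        have a2 := y2 h2
        rcases S.w_cases (j + 2) with h3 | h3 | h3
        · exact n2 (by rw [h2, h3])
        · rcases S.w_cases (j + 3) with h4 | h4 | h4
          · exact S.not_zero_one_zero h2 (by rwa [show j + 1 + 1 = j + 2 by ring])
              (by rwa [show j + 1 + 2 = j + 3 by ring])
          · exact n3 (by rw [h3, h4])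
          · have : n = j + 3 := key _ (by omega) h4 fun k k1 k2 => by
              obtain rfl | rfl | rfl : k = j ∨ k = j + 1 ∨ k = j + 2 := by omega
              · rw [h1]; decide
              · rw [h2]; decide
              · rw [h3]; decide
            rw [this, hs, z3 (by rw [h3]; decide), ← a1] at hcn
            exact a2 hcn.symm
        · have : n = j + 2 := key _ (by omega) h3 fun k k1 k2 => by
            obtain rfl | rfl : k = j ∨ k = j + 1 := by omega
            · rw [h1]; decide
            · rw [h2]; decide
          rw [this, hs, ← a1] at hcn
          exact a2 hcn.symm
      · exact absurd (by rw [h1, h2]) n1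
      · exact key _ (by omega) h2 fun k k1 k2 => by
          obtain rfl : k = j := by omega
          rw [h1]; decide
    · exact Or.inl (key _ le_rfl h1 fun k k1 k2 => by omega)

end RhombusStrip

/-! ### The side vectors of the rhombi -/

/-- The side of the rhombus around the copy `j` that is the hypotenuse of the copy `j`. -/
def rhombusSide (w : ℤ → Fin 3) (a : ℝ) (j : ℤ) : ℂ :=
  if Even j then rhombusDir w a j else rhombusDir w a j * exp (2 * a * I)

/-- The other side of the rhombus around the copy `j` at its vertex `0`. -/
def rhombusCoside (w : ℤ → Fin 3) (a : ℝ) (j : ℤ) : ℂ :=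
  if Even j then rhombusDir w a j * exp (2 * a * I) else rhombusDir w a j

section

variable {w : ℤ → Fin 3} {a : ℝ} {j : ℤ}

theorem rhombusSide_add_coside :
    rhombusSide w a j + rhombusCoside w a j = rhombusDir w a j * (1 + exp (2 * a * I)) := by
  unfold rhombusSide rhombusCoside
  split_ifs <;> ring

theorem rhombusDir_of_even (h : Even j) : rhombusDir w a j = rhombusSide w a j := by
  rw [rhombusSide, if_pos h]

theorem rhombusDir_of_not_even (h : ¬Even j) : rhombusDir w a j = rhombusCoside w a j := by
  rw [rhombusCoside, if_neg h]

/-- The points 1 and `exp (2 * a * I)` are the mirror images of each other in the leg through the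
vertex 0, so they span the rhombus of the copy 0. Odd copies exchange them, hence the definition of
the sides by parity. -/
theorem copyMap_rightTriangle_coords (h₀ : 0 < a) (h₁ : a < Real.pi / 2) (x y : ℝ) :
    copyMap (rightTriangle a) w j (x + y * exp (2 * a * I))
      = rhombusVertex w a j + x • rhombusSide w a j + y • rhombusCoside w a j := by
  rw [copyMap_rightTriangle h₀ h₁, rhombusSide, rhombusCoside]
  simp only [real_smul]
  split_ifs
  · ring
  · rw [map_add, map_mul, conj_ofReal, conj_ofReal]
    linear_combination (rhombusDir w a j * y) * exp_mul_conj_exp a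

theorem copyMap_vertex_one (h₀ : 0 < a) (h₁ : a < Real.pi / 2) :
    copyMap (rightTriangle a) w j (vertex (rightTriangle a) 1)
      = rhombusVertex w a j + rhombusSide w a j := by
  have := copyMap_rightTriangle_coords (w := w) (j := j) h₀ h₁ 1 0
  rw [vertex_one_rightTriangle]
  simpa using this

theorem copyMap_vertex_two (h₀ : 0 < a) (h₁ : a < Real.pi / 2) :
    copyMap (rightTriangle a) w j (vertex (rightTriangle a) 2)
      = rhombusVertex w a j + (1 / 2 : ℝ) • (rhombusSide w a j + rhombusCoside w a j) := by
  have := copyMap_rightTriangle_coords (w := w) (j := j) h₀ h₁ (1 / 2) (1 / 2)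
  rw [vertex_two_rightTriangle, smul_add, ← add_assoc, ← this]
  congr 1
  push_cast
  ring

theorem norm_rhombusDir : ‖rhombusDir w a j‖ = 1 := by
  rw [rhombusDir, norm_mul, norm_zpow, norm_neg, norm_one, one_zpow, one_mul,
    show (2 * a * I * turnCount w j : ℂ) = ((2 * a * turnCount w j : ℝ) : ℂ) * I by push_cast; ring,
    norm_exp_ofReal_mul_I]

theorem cross_one_exp (a : ℝ) : cross 1 (exp (2 * a * I)) = Real.sin (2 * a) := by
  rw [show (2 * a * I : ℂ) = ((2 * a : ℝ) : ℂ) * I by push_cast; ring]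
  simp only [cross, one_re, one_im, zero_mul, sub_zero, one_mul, exp_ofReal_mul_I_im]

theorem orient_mul_cross_side :
    orient j * cross (rhombusSide w a j) (rhombusCoside w a j) = Real.sin (2 * a) := by
  have h : cross (rhombusDir w a j) (rhombusDir w a j * exp (2 * a * I)) = Real.sin (2 * a) := by
    have := cross_mul_left_cancel (rhombusDir w a j) 1 (exp (2 * a * I))
    rw [mul_one, norm_rhombusDir, one_pow, one_mul, cross_one_exp] at this
    exact this
  by_cases hj : Even j
  · rw [orient_of_even hj, rhombusSide, rhombusCoside, if_pos hj, if_pos hj, h, one_mul]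
  · rw [orient_of_not_even hj, rhombusSide, rhombusCoside, if_neg hj, if_neg hj, cross_swap, h]
    ring

theorem orient_mul_cross_side_pos (h₀ : 0 < a) (h₁ : a < Real.pi / 2) :
    0 < orient j * cross (rhombusSide w a j) (rhombusCoside w a j) := by
  rw [orient_mul_cross_side]
  exact Real.sin_pos_of_pos_of_lt_pi (by linarith) (by linarith)

theorem even_succ_iff (j : ℤ) : Even (j + 1) ↔ ¬Even j := by
  rw [Int.even_add_one]

theorem rhombusSide_succ_of_zero (h : w j = 0) :
    rhombusSide w a (j + 1) = -rhombusCoside w a j ∧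
    rhombusCoside w a (j + 1) = -rhombusSide w a j := by
  unfold rhombusSide rhombusCoside
  rw [rhombusDir_succ_of_zero h]
  by_cases hj : Even j
  · have hj' := (even_succ_iff j).not.2 (not_not.2 hj)
    simp [hj, hj']
  · have hj' := (even_succ_iff j).2 hj
    simp [hj, hj']

theorem rhombusSide_succ_of_one (h : w j = 1) :
    rhombusSide w a (j + 1) = rhombusCoside w a j ∧
    rhombusCoside w a (j + 1) = rhombusSide w a j := by
  unfold rhombusSide rhombusCoside
  rw [rhombusDir_succ_of_one h]
  by_cases hj : Even j
  · have hj' := (even_succ_iff j).not.2 (not_not.2 hj)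
    simp [hj, hj']
  · have hj' := (even_succ_iff j).2 hj
    simp [hj, hj']

theorem rhombusSide_succ_of_two (h : w j = 2) : rhombusSide w a (j + 1) = rhombusSide w a j := by
  unfold rhombusSide
  by_cases hj : Even j
  · have hj' := (even_succ_iff j).not.2 (not_not.2 hj)
    rw [if_pos hj, if_neg hj', rhombusDir_succ_of_even h hj]
  · have hj' := (even_succ_iff j).2 hj
    rw [if_neg hj, if_pos hj', rhombusDir_succ_of_odd h hj]

end

/-! ### The strip of a saddle connection -/

namespace SaddleConnection

variable {P : Params} {a : ℝ} {f : PeriodicTrajectory P}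

/-- A saddle connection that does not strike the vertex `1` of a right triangle gives a strip of
rhombi. -/
def strip (g : SaddleConnection f (rightTriangle a)) (hP : IsTriangle P) (h₀ : 0 < a)
    (h₁ : a < Real.pi / 2) (hother : ∀ s, ¬g.StrikesAt 1 s) : RhombusStrip where
  w := f.edge
  c := rhombusVertex f.edge a
  F := rhombusSide f.edge a
  G := rhombusCoside f.edge a
  base := g.base
  D := g.disp
  D_ne := g.disp_ne
  edge_ne := f.edge_ne
  area _ := orient_mul_cross_side_pos h₀ h₁
  succ_zero j h := by
    refine ⟨?_, rhombusSide_succ_of_zero h⟩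
    rw [rhombusVertex_succ_of_zero h, add_assoc, rhombusSide_add_coside]
  succ_one j h := ⟨rhombusVertex_succ_of_ne (by rw [h]; decide) a, rhombusSide_succ_of_one h⟩
  succ_two j h := ⟨rhombusVertex_succ_of_ne (by rw [h]; decide) a, rhombusSide_succ_of_two h⟩
  far_ne j h := by
    obtain ⟨s, hs⟩ := exists_smul_of_cross_eq_zero g.disp_ne h
    refine hother s ⟨j, ?_⟩
    rw [copyMap_vertex_one h₀ h₁, path, ← hs]
    abel
  gate_two j h := by
    have hne : cross g.disp (rhombusVertex f.edge a j + rhombusSide f.edge a j - g.base) ≠ 0 := by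
      intro h
      obtain ⟨s, hs⟩ := exists_smul_of_cross_eq_zero g.disp_ne h
      refine hother s ⟨j, ?_⟩
      rw [copyMap_vertex_one h₀ h₁, path, ← hs]
      abel
    have hside := f.onLeft_iff hP j
    rw [h] at hside
    change (f.OnLeft j 1 ↔ _) ∧ (f.OnLeft j 0 ↔ _) ∧ (f.OnRight j 1 ↔ _) ∧ (f.OnRight j 0 ↔ _)
      at hside
    have hl1 := g.left j 1
    have hl0 := g.left j 0
    have hr1 := g.right j 1
    have hr0 := g.right j 0
    rw [copyMap_vertex_one h₀ h₁] at hl1 hr1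
    rw [vertex_zero, copyMap_rightTriangle_zero h₀ h₁] at hl0 hr0
    by_cases hj : Even j
    · rw [orient_of_even hj, one_mul, one_mul]
      -- The inequality at the vertex 0 stays weak because g may strike it. At the vertex 1 it is
      -- strict because g does not.
      exact ⟨hr0 (hside.2.2.2.2 hj), lt_of_le_of_ne (hl1 (hside.1.2 hj)) hne.symm⟩
    · rw [orient_of_not_even hj, neg_one_mul, neg_one_mul, neg_nonpos, neg_pos]
      exact ⟨hl0 (hside.2.1.2 hj), lt_of_le_of_ne (hr1 (hside.2.2.1.2 hj)) hne⟩
  gate_zero j h := by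
    have hne : cross g.disp (rhombusVertex f.edge a j + rhombusSide f.edge a j - g.base) ≠ 0 := by
      intro h
      obtain ⟨s, hs⟩ := exists_smul_of_cross_eq_zero g.disp_ne h
      refine hother s ⟨j, ?_⟩
      rw [copyMap_vertex_one h₀ h₁, path, ← hs]
      abel
    have hside := f.onLeft_iff hP j
    rw [h] at hside
    change (f.OnLeft j 2 ↔ _) ∧ (f.OnLeft j 1 ↔ _) ∧ (f.OnRight j 2 ↔ _) ∧ (f.OnRight j 1 ↔ _)
      at hside
    have hl1 := g.left j 1
    have hl2 := g.left j 2
    have hr1 := g.right j 1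
    have hr2 := g.right j 2
    rw [copyMap_vertex_one h₀ h₁] at hl1 hr1
    rw [copyMap_vertex_two h₀ h₁] at hl2 hr2
    by_cases hj : Even j
    · rw [orient_of_even hj, one_mul, one_mul]
      exact ⟨hl2 (hside.1.2 hj), lt_of_le_of_ne (hr1 (hside.2.2.2.2 hj)) hne⟩
    · rw [orient_of_not_even hj, neg_one_mul, neg_one_mul, neg_nonneg, neg_lt_zero]
      exact ⟨hr2 (hside.2.2.1.2 hj), lt_of_le_of_ne (hl1 (hside.2.1.2 hj)) hne.symm⟩

end SaddleConnection

/-! ### Points of the unfolding surface -/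

section Surface

variable {a : ℝ}

/-- The reflections in the legs of a right triangle generate a group of four elements. -/
def IsLegSymmetry (a : ℝ) (h : ℂ ≃ᵃⁱ[ℝ] ℂ) : Prop :=
  h = 1 ∨ h = edgeReflection (rightTriangle a) 1 ∨ h = edgeReflection (rightTriangle a) 0 ∨
    h = edgeReflection (rightTriangle a) 0 * edgeReflection (rightTriangle a) 1

theorem edgeReflection_mul_comm (h₀ : 0 < a) (h₁ : a < Real.pi / 2) :
    edgeReflection (rightTriangle a) 1 * edgeReflection (rightTriangle a) 0
      = edgeReflection (rightTriangle a) 0 * edgeReflection (rightTriangle a) 1 := by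
  ext z
  change edgeReflection (rightTriangle a) 1 (edgeReflection (rightTriangle a) 0 z)
    = edgeReflection (rightTriangle a) 0 (edgeReflection (rightTriangle a) 1 z)
  rw [edgeReflection_zero_rightTriangle h₀ h₁, edgeReflection_zero_rightTriangle h₀ h₁,
    edgeReflection_one (isTriangle_rightTriangle h₀ h₁),
    edgeReflection_one (isTriangle_rightTriangle h₀ h₁), rightTriangle_zero]
  simp only [map_sub, map_add, map_one, map_mul, conj_conj]
  linear_combination exp_mul_conj_exp a

theorem IsLegSymmetry.mul_edgeReflection (h₀ : 0 < a) (h₁ : a < Real.pi / 2) {h : ℂ ≃ᵃⁱ[ℝ] ℂ}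
    (hh : IsLegSymmetry a h) {i : Fin 3} (hi : i ≠ 2) :
    IsLegSymmetry a (h * edgeReflection (rightTriangle a) i) := by
  have hs := edgeReflection_mul_self (rightTriangle a)
  have hc := edgeReflection_mul_comm h₀ h₁
  have hi' : i = 0 ∨ i = 1 := by revert i; decide
  unfold IsLegSymmetry
  rcases hi' with rfl | rfl
  · rcases hh with rfl | rfl | rfl | rfl
    · simp
    · simp [hc]
    · simp [hs]
    · rw [mul_assoc, hc, ← mul_assoc, hs]; simp
  · rcases hh with rfl | rfl | rfl | rfl
    · simp
    · simp [hs]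
    · simp
    · rw [mul_assoc, hs]; simp

theorem linearIsometryEquiv_mul (e e' : ℂ ≃ᵃⁱ[ℝ] ℂ) :
    (e * e').linearIsometryEquiv = e.linearIsometryEquiv * e'.linearIsometryEquiv := by
  ext x
  rfl

/-- A point of the unfolding surface off the hypotenuses determines the copy of the triangle up to
reflections in the legs that fix the point. -/
theorem exists_isLegSymmetry_of_mk_eq (h₀ : 0 < a) (h₁ : a < Real.pi / 2)
    {A A' : ℂ ≃ₗᵢ[ℝ] ℂ} {x x' : table (rightTriangle a)}
    (hx : (x : ℂ) ∉ edgeSet (rightTriangle a) 2)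
    (h : Quot.mk (Glue (rightTriangle a)) (A, x) = Quot.mk (Glue (rightTriangle a)) (A', x')) :
    x' = x ∧ ∃ k, IsLegSymmetry a k ∧ k x = x ∧ A' = A * k.linearIsometryEquiv := by
  -- This property is invariant under gluing: off the hypotenuse only the legs are glued, and their
  -- reflections fix the point. So it descends to the quotient, which shows that it holds on the
  -- whole class of `(A, x)`.
  let R : (ℂ ≃ₗᵢ[ℝ] ℂ) × table (rightTriangle a) → Prop := fun q =>
    q.2 = x ∧ ∃ k, IsLegSymmetry a k ∧ k x = x ∧ q.1 = A * k.linearIsometryEquiv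
  have hR : ∀ q q', Glue (rightTriangle a) q q' → R q = R q' := by
    rintro _ _ ⟨B, i, y, hy⟩
    have hlin : (edgeReflection (rightTriangle a) i).linearIsometryEquiv
        * (edgeReflection (rightTriangle a) i).linearIsometryEquiv = 1 := by
      rw [← linearIsometryEquiv_mul, edgeReflection_mul_self]; rfl
    apply propext
    constructor
    · rintro ⟨rfl, k, hk, hkx, hB⟩
      have hi : i ≠ 2 := by rintro rfl; exact hx hy
      refine ⟨rfl, k * edgeReflection (rightTriangle a) i, hk.mul_edgeReflection h₀ h₁ hi, ?_, ?_⟩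
      · change k (edgeReflection (rightTriangle a) i _) = _
        rw [edgeReflection_apply_edgeSet _ hy, hkx]
      · change B = _ at hB
        rw [linearIsometryEquiv_mul, hB, mul_assoc]
    · rintro ⟨hyx, k, hk, hkx, hB⟩
      change y = x at hyx
      subst hyx
      have hi : i ≠ 2 := by rintro rfl; exact hx hy
      refine ⟨rfl, k * edgeReflection (rightTriangle a) i, hk.mul_edgeReflection h₀ h₁ hi, ?_, ?_⟩
      · change k (edgeReflection (rightTriangle a) i _) = _
        rw [edgeReflection_apply_edgeSet _ hy, hkx]
      · change B * _ = _ at hB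
        change B = _
        rw [linearIsometryEquiv_mul, ← mul_assoc, ← hB, mul_assoc, hlin, mul_one]
  have h2 := congrArg (Quot.lift R hR) h
  have h3 : R (A, x) := ⟨rfl, 1, Or.inl rfl, rfl, by ext; rfl⟩
  have h4 : R (A', x') := by
    change R (A, x) = R (A', x') at h2
    rwa [← h2]
  exact h4

end Surface

/-- The parallelogram is convex and contains the three vertices, with the right angle at its centre.
-/
theorem table_rightTriangle_subset (a : ℝ) {z : ℂ} (hz : z ∈ table (rightTriangle a)) :
    ∃ x y : ℝ, 0 ≤ x ∧ x ≤ 1 ∧ 0 ≤ y ∧ y ≤ 1 ∧ z = x + y * exp (2 * a * I) := by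
  let Q : Set ℂ := {z | ∃ x y : ℝ, 0 ≤ x ∧ x ≤ 1 ∧ 0 ≤ y ∧ y ≤ 1 ∧ z = x + y * exp (2 * a * I)}
  have hQ : Convex ℝ Q := by
    rintro _ ⟨x, y, hx, hx', hy, hy', rfl⟩ _ ⟨u, v, hu, hu', hv, hv', rfl⟩ r s hr hs hrs
    refine ⟨r * x + s * u, r * y + s * v, by positivity, by nlinarith, by positivity,
      by nlinarith, ?_⟩
    simp only [real_smul]
    push_cast
    ring
  refine convexHull_min ?_ hQ hz
  rintro _ ⟨i, rfl⟩
  have hi : i = 0 ∨ i = 1 ∨ i = 2 := by revert i; decide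
  rcases hi with rfl | rfl | rfl
  · exact ⟨0, 0, le_rfl, zero_le_one, le_rfl, zero_le_one, by simp [vertex_zero]⟩
  · exact ⟨1, 0, zero_le_one, le_rfl, le_rfl, zero_le_one, by simp [vertex_one_rightTriangle]⟩
  · refine ⟨1 / 2, 1 / 2, by norm_num, by norm_num, by norm_num, by norm_num, ?_⟩
    rw [vertex_two_rightTriangle]
    push_cast
    ring

/-- The rhombus of the copy `j'` is the translate by `t` of the rhombus of the copy `j`. -/
def IsTranslate (w : ℤ → Fin 3) (a : ℝ) (t : ℂ) (j j' : ℤ) : Prop :=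
  (rhombusDir w a j' = rhombusDir w a j ∧ rhombusVertex w a j' = rhombusVertex w a j + t) ∨
  (rhombusDir w a j' = -rhombusDir w a j ∧ rhombusVertex w a j' = rhombusVertex w a j
    + rhombusDir w a j * (1 + exp (2 * a * I)) + t)

/-- All four leg symmetries preserve the rhombus. The identity and the reflection in the edge 1 fix
the vertex 0, and the other two carry it to the opposite corner, which is the half-turned
alternative. -/
theorem isTranslate_of_copyMap {a : ℝ} (h₀ : 0 < a) (h₁ : a < Real.pi / 2) {w : ℤ → Fin 3} {t : ℂ}
    {j j' : ℤ} {k : ℂ ≃ᵃⁱ[ℝ] ℂ} (hk : IsLegSymmetry a k)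
    (h : ∀ y, copyMap (rightTriangle a) w j' y = copyMap (rightTriangle a) w j (k y) + t) :
    IsTranslate w a t j j' := by
  have hω := exp_mul_conj_exp a
  have htri := isTriangle_rightTriangle h₀ h₁
  have co : ∀ j z, ∀ x y : ℝ, z = x + y * exp (2 * a * I) → copyMap (rightTriangle a) w j z
      = rhombusVertex w a j + x • rhombusSide w a j + y • rhombusCoside w a j := by
    rintro j _ x y rfl
    exact copyMap_rightTriangle_coords h₀ h₁ x y
  have e0 := h 0
  have e1 := h 1
  have e2 := h (exp (2 * a * I))
  rw [co j' 0 0 0 (by simp)] at e0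
  rw [co j' 1 1 0 (by simp)] at e1
  rw [co j' _ 0 1 (by simp)] at e2
  have A := orient_mul_cross_side_pos (w := w) (j := j) h₀ h₁
  have A' := orient_mul_cross_side_pos (w := w) (j := j') h₀ h₁
  -- The signed area spanned by the sides has the sign of the orientation, so comparing the areas
  -- compares the parities of the two copies.
  have hpos : ∀ r : ℝ, 0 < orient j * r → 0 < orient j' * r → (Even j ↔ Even j') := by
    intro r hr hr'
    by_cases hj : Even j <;> by_cases hj' : Even j'
    · simp [hj, hj']
    · rw [orient_of_even hj] at hr; rw [orient_of_not_even hj'] at hr'; linarith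
    · rw [orient_of_not_even hj] at hr; rw [orient_of_even hj'] at hr'; linarith
    · simp [hj, hj']
  have hneg : ∀ r : ℝ, 0 < orient j * r → 0 < orient j' * -r → (Even j ↔ ¬Even j') := by
    intro r hr hr'
    by_cases hj : Even j <;> by_cases hj' : Even j'
    · rw [orient_of_even hj] at hr; rw [orient_of_even hj'] at hr'; linarith
    · simp [hj, hj']
    · simp [hj, hj']
    · rw [orient_of_not_even hj] at hr; rw [orient_of_not_even hj'] at hr'; linarith
  unfold IsTranslate
  rw [← rhombusSide_add_coside]
  rcases hk with rfl | rfl | rfl | rfl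
  · left
    change _ = copyMap (rightTriangle a) w j 0 + t at e0
    change _ = copyMap (rightTriangle a) w j 1 + t at e1
    change _ = copyMap (rightTriangle a) w j (exp (2 * a * I)) + t at e2
    rw [co j 0 0 0 (by simp)] at e0
    rw [co j 1 1 0 (by simp)] at e1
    rw [co j _ 0 1 (by simp)] at e2
    simp only [zero_smul, one_smul, add_zero] at e0 e1 e2
    have hF : rhombusSide w a j' = rhombusSide w a j := by linear_combination e1 - e0
    have hG : rhombusCoside w a j' = rhombusCoside w a j := by linear_combination e2 - e0
    rw [hF, hG] at A'
    have := hpos _ A A'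
    refine ⟨?_, e0⟩
    by_cases hj : Even j
    · rw [rhombusDir_of_even hj, rhombusDir_of_even (this.1 hj), hF]
    · rw [rhombusDir_of_not_even hj, rhombusDir_of_not_even (fun h' => hj (this.2 h')), hG]
  · left
    rw [edgeReflection_one htri, rightTriangle_zero] at e0 e1 e2
    rw [co j _ 0 0 (by simp)] at e0
    rw [co j _ 0 1 (by simp)] at e1
    rw [hω, co j _ 1 0 (by simp)] at e2
    simp only [zero_smul, one_smul, add_zero] at e0 e1 e2
    have hF : rhombusSide w a j' = rhombusCoside w a j := by linear_combination e1 - e0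
    have hG : rhombusCoside w a j' = rhombusSide w a j := by linear_combination e2 - e0
    rw [hF, hG, cross_swap] at A'
    have := hneg _ A A'
    refine ⟨?_, e0⟩
    by_cases hj : Even j
    · rw [rhombusDir_of_even hj, rhombusDir_of_not_even (this.1 hj), hG]
    · rw [rhombusDir_of_not_even hj, rhombusDir_of_even (by by_contra h'; exact hj (this.2 h')), hF]
  · right
    rw [edgeReflection_zero_rightTriangle h₀ h₁] at e0 e1 e2
    rw [co j _ 1 1 (by simp)] at e0
    rw [co j _ 1 0 (by simp)] at e1
    rw [hω, co j _ 0 1 (by simp)] at e2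
    simp only [zero_smul, one_smul, add_zero] at e0 e1 e2
    have hF : rhombusSide w a j' = -rhombusCoside w a j := by linear_combination e1 - e0
    have hG : rhombusCoside w a j' = -rhombusSide w a j := by linear_combination e2 - e0
    rw [hF, hG, cross_neg_left, cross_neg_right, neg_neg, cross_swap] at A'
    have := hneg _ A A'
    refine ⟨?_, by rw [e0]; ring⟩
    by_cases hj : Even j
    · rw [rhombusDir_of_even hj, rhombusDir_of_not_even (this.1 hj), hG]
    · rw [rhombusDir_of_not_even hj, rhombusDir_of_even (by by_contra h'; exact hj (this.2 h')), hF]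
  · right
    change _ = copyMap (rightTriangle a) w j
      (edgeReflection (rightTriangle a) 0 (edgeReflection (rightTriangle a) 1 0)) + t at e0
    change _ = copyMap (rightTriangle a) w j
      (edgeReflection (rightTriangle a) 0 (edgeReflection (rightTriangle a) 1 1)) + t at e1
    change _ = copyMap (rightTriangle a) w j (edgeReflection (rightTriangle a) 0
      (edgeReflection (rightTriangle a) 1 (exp (2 * a * I)))) + t at e2
    rw [edgeReflection_one htri, rightTriangle_zero, edgeReflection_zero_rightTriangle h₀ h₁]
      at e0 e1 e2
    rw [co j _ 1 1 (by simp)] at e0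
    rw [map_one, mul_one, hω, co j _ 0 1 (by simp)] at e1
    rw [hω, map_one, mul_one, co j _ 1 0 (by simp)] at e2
    simp only [zero_smul, one_smul, add_zero] at e0 e1 e2
    have hF : rhombusSide w a j' = -rhombusSide w a j := by linear_combination e1 - e0
    have hG : rhombusCoside w a j' = -rhombusCoside w a j := by linear_combination e2 - e0
    rw [hF, hG, cross_neg_left, cross_neg_right, neg_neg] at A'
    have := hpos _ A A'
    refine ⟨?_, by rw [e0]; ring⟩
    by_cases hj : Even j
    · rw [rhombusDir_of_even hj, rhombusDir_of_even (this.1 hj), hF]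
    · rw [rhombusDir_of_not_even hj, rhombusDir_of_not_even (fun h' => hj (this.2 h')), hG]

namespace SaddleConnection

variable {P : Params} {a : ℝ} {f : PeriodicTrajectory P}

/-- After a period the saddle connection runs through a translate of the same rhombus. -/
theorem exists_isTranslate (g : SaddleConnection f (rightTriangle a)) (hP : IsTriangle P)
    (h₀ : 0 < a) (h₁ : a < Real.pi / 2) (hother : ∀ s, ¬g.StrikesAt 1 s) {p : ℝ}
    (hp : g.HasPeriod p) {s : ℝ}
    (hgen : ∀ b, f.edge b = 2 → (g.strip hP h₀ h₁ hother).crossTime b ≠ s) :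
    ∃ j j', (g.strip hP h₀ h₁ hother).InRhombus j (g.path s) ∧
      (g.strip hP h₀ h₁ hother).InRhombus j' (g.path (s + p)) ∧
      IsTranslate f.edge a (p • g.disp) j j' := by
  obtain ⟨u, ⟨j, x, hx, hu⟩, ⟨j', x', hx', hu'⟩⟩ := hp s
  have hin : ∀ (j : ℤ) (x : table (rightTriangle a)) (z : ℂ),
      copyMap (rightTriangle a) f.edge j x = z → (g.strip hP h₀ h₁ hother).InRhombus j z := by
    rintro j x _ rfl
    obtain ⟨r, s, hr, hr', hs, hs', h⟩ := table_rightTriangle_subset a x.2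
    exact ⟨r, s, hr, hr', hs, hs', by rw [h]; exact copyMap_rightTriangle_coords h₀ h₁ r s⟩
  have h1 := hin j x _ hx
  have h2 := hin j' x' _ hx'
  -- At a time when no hypotenuse is crossed, the point of the surface determines its copy up to a
  -- leg symmetry fixing the point.
  have hedge : (x : ℂ) ∉ edgeSet (rightTriangle a) 2 := by
    rintro ⟨r, l, hr, hl, hrl, hxl⟩
    refine (g.strip hP h₀ h₁ hother).line_ne_of_generic hgen h1 l ?_
    change g.path s = rhombusVertex f.edge a j + l • rhombusSide f.edge a j
    rw [← hx, ← hxl]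
    change copyMap (rightTriangle a) f.edge j (r • vertex (rightTriangle a) 0
      + l • vertex (rightTriangle a) 1) = _
    rw [vertex_zero, vertex_one_rightTriangle, smul_zero, zero_add]
    have := copyMap_rightTriangle_coords (w := f.edge) (j := j) h₀ h₁ l 0
    simpa using this
  rw [hu] at hu'
  obtain ⟨rfl, k, hk, hkx, hA⟩ := exists_isLegSymmetry_of_mk_eq h₀ h₁ hedge hu'
  refine ⟨j, j', h1, h2, isTranslate_of_copyMap h₀ h₁ hk fun y => ?_⟩
  have m1 := (copyMap (rightTriangle a) f.edge j').map_vsub y x'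
  have m2 := (copyMap (rightTriangle a) f.edge j).map_vsub (k y) (k x')
  have m3 := k.map_vsub y x'
  rw [hA] at m1
  change (copyMap (rightTriangle a) f.edge j).linearIsometryEquiv (k.linearIsometryEquiv (y -ᵥ x'))
    = _ at m1
  rw [m3, m2, hkx] at m1
  simp only [vsub_eq_sub] at m1
  rw [hx, hx'] at m1
  have hpath : g.path (s + p) = g.path s + p • g.disp := by
    rw [path, path, add_smul]; abel
  rw [hpath] at m1
  linear_combination -m1

theorem copyMap_add_len (g : SaddleConnection f (rightTriangle a)) (j : ℤ) (z : ℂ) :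
    copyMap (rightTriangle a) f.edge (j + f.len) z
      = copyMap (rightTriangle a) f.edge j z + g.disp := by
  rw [copyMap_add_period _ f.edge_periodic, ← g.closes]
  rfl

/-- Crossing times are periodic with the trajectory. -/
theorem crossTime_add_len (g : SaddleConnection f (rightTriangle a)) (hP : IsTriangle P)
    (h₀ : 0 < a) (h₁ : a < Real.pi / 2) (hother : ∀ s, ¬g.StrikesAt 1 s) {b : ℤ}
    (hb : f.edge b = 2) : (g.strip hP h₀ h₁ hother).crossTime (b + f.len)
      = (g.strip hP h₀ h₁ hother).crossTime b + 1 := by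
  set S := g.strip hP h₀ h₁ hother with hS
  have hb' : S.w (b + f.len) = 2 := (f.edge_periodic b).trans hb
  obtain ⟨l, -, -, hl⟩ := S.crossTime_spec (j := b) hb
  refine (S.eq_crossTime (l := l) hb' ?_).symm
  have e1 := copyMap_rightTriangle_coords (w := f.edge) (j := b) h₀ h₁ l 0
  have e2 := copyMap_rightTriangle_coords (w := f.edge) (j := b + f.len) h₀ h₁ l 0
  rw [zero_smul, add_zero] at e1 e2
  change S.line _ = rhombusVertex f.edge a (b + f.len) + l • rhombusSide f.edge a (b + f.len)
  rw [← e2, g.copyMap_add_len, e1]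
  change S.line _ = S.c b + l • S.F b + S.D
  rw [← hl, RhombusStrip.line, RhombusStrip.line, add_smul, one_smul]
  abel

end SaddleConnection

/-! ### Translates of rhombi -/

section

variable {w : ℤ → Fin 3} {a : ℝ} {t : ℂ} {j j' : ℤ}

/-- Crossing a leg does not leave the rhombus. The edge 0 exchanges the two alternatives. -/
theorem isTranslate_succ_left (h : w j ≠ 2) :
    IsTranslate w a t (j + 1) j' ↔ IsTranslate w a t j j' := by
  have hw : w j = 0 ∨ w j = 1 :=
    (by decide : ∀ i : Fin 3, i ≠ 2 → i = 0 ∨ i = 1) (w j) h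
  unfold IsTranslate
  rcases hw with h0 | h1
  · rw [rhombusVertex_succ_of_zero h0, rhombusDir_succ_of_zero h0, neg_neg, or_comm]
    apply or_congr
    · rw [and_congr_right_iff]
      intro
      rw [show rhombusVertex w a j + rhombusDir w a j * (1 + exp (2 * a * I))
        + -rhombusDir w a j * (1 + exp (2 * a * I)) + t = rhombusVertex w a j + t by ring]
    · exact Iff.rfl
  · rw [rhombusVertex_succ_of_ne (by rw [h1]; decide), rhombusDir_succ_of_one h1]

theorem isTranslate_succ_right (h : w j' ≠ 2) :
    IsTranslate w a t j (j' + 1) ↔ IsTranslate w a t j j' := by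
  have hw : w j' = 0 ∨ w j' = 1 :=
    (by decide : ∀ i : Fin 3, i ≠ 2 → i = 0 ∨ i = 1) (w j') h
  unfold IsTranslate
  rcases hw with h0 | h1
  · rw [rhombusVertex_succ_of_zero h0, rhombusDir_succ_of_zero h0, neg_inj, or_comm, neg_eq_iff_eq_neg]
    apply or_congr
    · rw [and_congr_right_iff]
      intro hd
      rw [hd]
      constructor <;> intro h <;> linear_combination h
    · rw [and_congr_right_iff]
      intro hd
      rw [hd]
      constructor <;> intro h <;> linear_combination h
  · rw [rhombusVertex_succ_of_ne (by rw [h1]; decide), rhombusDir_succ_of_one h1]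

theorem isTranslate_left_iff {b : ℤ} (hjb : j ≤ b) (h : ∀ i, j ≤ i → i < b → w i ≠ 2) :
    IsTranslate w a t b j' ↔ IsTranslate w a t j j' := by
  obtain ⟨n, rfl⟩ : ∃ n : ℕ, b = j + n := ⟨(b - j).toNat, by omega⟩
  clear hjb
  induction n with
  | zero => rw [Nat.cast_zero, add_zero]
  | succ n ih =>
    have e : j + ((n + 1 : ℕ) : ℤ) = (j + n) + 1 := by push_cast; ring
    rw [e, isTranslate_succ_left (h _ (by omega) (by omega)),
      ih fun i h1 h2 => h i h1 (by omega)]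

theorem isTranslate_right_iff {b : ℤ} (hjb : j' ≤ b) (h : ∀ i, j' ≤ i → i < b → w i ≠ 2) :
    IsTranslate w a t j b ↔ IsTranslate w a t j j' := by
  obtain ⟨n, rfl⟩ : ∃ n : ℕ, b = j' + n := ⟨(b - j').toNat, by omega⟩
  clear hjb
  induction n with
  | zero => rw [Nat.cast_zero, add_zero]
  | succ n ih =>
    have e : j' + ((n + 1 : ℕ) : ℤ) = (j' + n) + 1 := by push_cast; ring
    rw [e, isTranslate_succ_right (h _ (by omega) (by omega)),
      ih fun i h1 h2 => h i h1 (by omega)]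

end

/-- For all right triangles, the motion that carries the rhombus of the copy `o` to that of `o'`
carries the rhombus of `j` to that of `j'`; the numbers of turns on the two ways agree. -/
def Follows (w : ℤ → Fin 3) (o o' j j' : ℤ) : Prop :=
  turnCount w j' - turnCount w o' = turnCount w j - turnCount w o ∧ ∀ b : ℝ,
    rhombusDir w b j' * rhombusDir w b o = rhombusDir w b o' * rhombusDir w b j ∧
    (rhombusVertex w b j' - rhombusVertex w b o') * rhombusDir w b o
      = rhombusDir w b o' * (rhombusVertex w b j - rhombusVertex w b o)

/-- The variant of `Follows` in which the rhombus `j'` is reached after a further half-turn. -/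
def FollowsFlipped (w : ℤ → Fin 3) (o o' j j' : ℤ) : Prop :=
  turnCount w j' - turnCount w o' = turnCount w j - turnCount w o ∧ ∀ b : ℝ,
    rhombusDir w b j' * rhombusDir w b o = -(rhombusDir w b o' * rhombusDir w b j) ∧
    (rhombusVertex w b j' - rhombusVertex w b o') * rhombusDir w b o
      = rhombusDir w b o' * (rhombusVertex w b j + rhombusDir w b j * (1 + exp (2 * b * I))
        - rhombusVertex w b o)

section

variable {w : ℤ → Fin 3} {o o' j j' : ℤ}

theorem follows_self (w : ℤ → Fin 3) (o o' : ℤ) : Follows w o o' o o' :=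
  ⟨by ring, fun b => ⟨rfl, by ring⟩⟩

/-- Each crossing of the edge 0 toggles between the two variants and the edge 1 changes nothing, so
legs can be skipped independently on the two routes. -/
theorem follows_succ_left (h : w j ≠ 2) (hf : Follows w o o' j j' ∨ FollowsFlipped w o o' j j') :
    Follows w o o' (j + 1) j' ∨ FollowsFlipped w o o' (j + 1) j' := by
  have hw : w j = 0 ∨ w j = 1 :=
    (by decide : ∀ i : Fin 3, i ≠ 2 → i = 0 ∨ i = 1) (w j) h
  unfold Follows FollowsFlipped at *
  rw [turnCount_succ_of_ne h]
  rcases hw with h0 | h1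
  · simp only [rhombusVertex_succ_of_zero h0, rhombusDir_succ_of_zero h0]
    rcases hf with ⟨h1, h2⟩ | ⟨h1, h2⟩
    · refine Or.inr ⟨h1, fun b => ⟨?_, ?_⟩⟩
      · linear_combination (h2 b).1
      · linear_combination (h2 b).2
    · refine Or.inl ⟨h1, fun b => ⟨?_, ?_⟩⟩
      · linear_combination (h2 b).1
      · linear_combination (h2 b).2
  · simp only [rhombusVertex_succ_of_ne (show w j ≠ 0 by rw [h1]; decide),
      rhombusDir_succ_of_one h1]
    exact hf

theorem follows_succ_right (h : w j' ≠ 2) (hf : Follows w o o' j j' ∨ FollowsFlipped w o o' j j') :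
    Follows w o o' j (j' + 1) ∨ FollowsFlipped w o o' j (j' + 1) := by
  have hw : w j' = 0 ∨ w j' = 1 :=
    (by decide : ∀ i : Fin 3, i ≠ 2 → i = 0 ∨ i = 1) (w j') h
  unfold Follows FollowsFlipped at *
  rw [turnCount_succ_of_ne h]
  rcases hw with h0 | h1
  · simp only [rhombusVertex_succ_of_zero h0, rhombusDir_succ_of_zero h0]
    rcases hf with ⟨h1, h2⟩ | ⟨h1, h2⟩
    · refine Or.inr ⟨h1, fun b => ⟨?_, ?_⟩⟩
      · linear_combination -(h2 b).1
      · linear_combination (h2 b).2 + (1 + exp (2 * b * I)) * (h2 b).1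
    · refine Or.inl ⟨h1, fun b => ⟨?_, ?_⟩⟩
      · linear_combination -(h2 b).1
      · linear_combination (h2 b).2 + (1 + exp (2 * b * I)) * (h2 b).1
  · simp only [rhombusVertex_succ_of_ne (show w j' ≠ 0 by rw [h1]; decide),
      rhombusDir_succ_of_one h1]
    exact hf

/-- Equal parities mean that both routes turn in the same sense, by the same factor for every angle
`b`. -/
theorem follows_succ_succ (h : w j = 2) (h' : w j' = 2) (hp : Even j ↔ Even j')
    (hf : Follows w o o' j j') : Follows w o o' (j + 1) (j' + 1) := by
  obtain ⟨h1, h2⟩ := hf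
  have hz : ∀ i, w i = 2 → w i ≠ 0 := fun i hi => by rw [hi]; decide
  by_cases hj : Even j
  · have hj' := hp.1 hj
    refine ⟨?_, fun b => ⟨?_, ?_⟩⟩
    · rw [turnCount_succ_of_even h hj, turnCount_succ_of_even h' hj']
      linarith
    · refine mul_right_cancel₀ (exp_ne_zero (2 * b * I)) ?_
      rw [mul_right_comm, rhombusDir_succ_of_even h' hj', mul_assoc,
        rhombusDir_succ_of_even h hj, (h2 b).1]
    · rw [rhombusVertex_succ_of_ne (hz _ h), rhombusVertex_succ_of_ne (hz _ h'), (h2 b).2]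
  · have hj' : ¬Even j' := fun h' => hj (hp.2 h')
    refine ⟨?_, fun b => ⟨?_, ?_⟩⟩
    · rw [turnCount_succ_of_odd h hj, turnCount_succ_of_odd h' hj']
      linarith
    · rw [rhombusDir_succ_of_odd h' hj', rhombusDir_succ_of_odd h hj]
      linear_combination exp (2 * b * I) * (h2 b).1
    · rw [rhombusVertex_succ_of_ne (hz _ h), rhombusVertex_succ_of_ne (hz _ h'), (h2 b).2]

end

/-! ### Recurrence of the strikes and of the route between them -/

namespace RhombusStrip

variable (S : RhombusStrip) {a p : ℝ} {s : ℝ} {j j' : ℤ}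

/-- The strip consists of rhombi of copies of the right triangle with angle `a`. -/
structure IsRight (a : ℝ) : Prop where
  pos : 0 < a
  lt : a < Real.pi / 2
  c_eq : S.c = rhombusVertex S.w a
  F_eq : S.F = rhombusSide S.w a
  G_eq : S.G = rhombusCoside S.w a

/-- The line recurs after the time `p`: away from the hypotenuses it runs through a translate
of the same rhombus. -/
def Recurs (a p : ℝ) : Prop :=
  ∀ s, (∀ b, S.w b = 2 → S.crossTime b ≠ s) → ∃ j j', S.InRhombus j (S.line s) ∧
    S.InRhombus j' (S.line (s + p)) ∧ IsTranslate S.w a (p • S.D) j j'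

/-- The sequence of crossings is periodic with period `m`, which takes the time `1`. -/
def Closes (m : ℤ) : Prop :=
  0 < m ∧ ∀ b, S.w b = 2 → S.w (b + m) = 2 ∧ S.w (b - m) = 2 ∧
    S.crossTime (b + m) = S.crossTime b + 1 ∧ S.crossTime (b - m) = S.crossTime b - 1

/-- The line strikes a vertex `0` at time `s`. -/
def Strikes (s : ℝ) : Prop := ∃ b, S.w b = 2 ∧ S.crossTime b = s ∧ S.line s = S.c b

/-- The hypotenuses crossed at time `s`. -/
def gates (s : ℝ) : Set ℤ := {b | S.w b = 2 ∧ S.crossTime b = s}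

variable {S}

theorem line_add (s p : ℝ) : S.line (s + p) = S.line s + p • S.D := by
  rw [line, line, add_smul]; abel

theorem mem_gates_of_between {b b' : ℤ} (hb : b ∈ S.gates s) (hb' : b' ∈ S.gates s)
    {i : ℤ} (hi : S.w i = 2) (h1 : b ≤ i) (h2 : i ≤ b') : i ∈ S.gates s :=
  ⟨hi, le_antisymm ((S.crossTime_mono hi hb'.1 h2).trans_eq hb'.2)
    (hb.2.symm.trans_le (S.crossTime_mono hb.1 hi h1))⟩

/-- All hypotenuses crossed at the moment of a strike end in the struck vertex. -/
theorem Strikes.line_eq (hs : S.Strikes s) {b : ℤ} (hb : b ∈ S.gates s) : S.line s = S.c b := by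
  obtain ⟨b₀, hb₀, hτ, hc⟩ := hs
  have h0 : b₀ ∈ S.gates s := ⟨hb₀, hτ⟩
  apply S.eq_c_of_corner hb.1 hb.2
  rcases le_total b₀ b with h | h
  · exact (S.corner_iff_of_forall h fun i h1 h2 h3 =>
      (mem_gates_of_between h0 hb h3 h1 h2.le).2).2 (Or.inl hc)
  · exact (S.corner_iff_of_forall h fun i h1 h2 h3 =>
      (mem_gates_of_between hb h0 h3 h1 h2.le).2).1 (Or.inl hc)

/-- Crossing times are monotone and change by 1 over `m` copies, so the indices of the hypotenuses
crossed at one moment are bounded. -/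
theorem Strikes.exists_isLeast {m : ℤ} (hm : S.Closes m) (hs : S.Strikes s) :
    ∃ e, IsLeast (S.gates s) e := by
  obtain ⟨b₀, hb₀, hτ, -⟩ := hs
  have hbdd : ∀ z, z ∈ S.gates s → b₀ - m ≤ z := by
    rintro z ⟨hz, hzs⟩
    by_contra hlt
    push Not at hlt
    obtain ⟨-, h2, -, h4⟩ := hm.2 b₀ hb₀
    have := S.crossTime_mono hz h2 hlt.le
    linarith
  obtain ⟨e, he, hl⟩ := Int.exists_least_of_bdd ⟨b₀ - m, hbdd⟩ ⟨b₀, hb₀, hτ⟩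
  exact ⟨e, he, fun b hb => hl b hb⟩

theorem Strikes.exists_isGreatest {m : ℤ} (hm : S.Closes m) (hs : S.Strikes s) :
    ∃ e, IsGreatest (S.gates s) e := by
  obtain ⟨b₀, hb₀, hτ, -⟩ := hs
  have hbdd : ∀ z, z ∈ S.gates s → z ≤ b₀ + m := by
    rintro z ⟨hz, hzs⟩
    by_contra hlt
    push Not at hlt
    obtain ⟨h1, -, h3, -⟩ := hm.2 b₀ hb₀
    have := S.crossTime_mono h1 hz hlt.le
    linarith
  obtain ⟨e, he, hl⟩ := Int.exists_greatest_of_bdd ⟨b₀ + m, hbdd⟩ ⟨b₀, hb₀, hτ⟩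
  exact ⟨e, he, fun b hb => hl b hb⟩

theorem IsRight.coords_unique (hS : S.IsRight a) (j : ℤ) {x y x' y' : ℝ}
    (h : rhombusDir S.w a j * (x + y * exp (2 * a * I))
      = rhombusDir S.w a j * (x' + y' * exp (2 * a * I))) : x = x' ∧ y = y' := by
  have h1 := mul_left_cancel₀ (rhombusDir_ne_zero S.w a j) h
  have hsin : 0 < Real.sin (2 * a) :=
    Real.sin_pos_of_pos_of_lt_pi (by linarith [hS.pos]) (by linarith [hS.lt])
  rw [show (2 * a * I : ℂ) = ((2 * a : ℝ) : ℂ) * I by push_cast; ring] at h1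
  have him := congrArg Complex.im h1
  have hre := congrArg Complex.re h1
  simp only [add_im, ofReal_im, zero_add, re_ofReal_mul, im_ofReal_mul, exp_ofReal_mul_I_im,
    exp_ofReal_mul_I_re, add_re, ofReal_re] at him hre
  have hy := mul_right_cancel₀ hsin.ne' him
  subst hy
  exact ⟨by linarith, rfl⟩

theorem IsRight.flip_ne (hS : S.IsRight a) (j : ℤ) :
    rhombusDir S.w a j * (1 + exp (2 * a * I)) ≠ 0 := by
  intro h
  have h' : rhombusDir S.w a j * (((1 : ℝ) : ℂ) + ((1 : ℝ) : ℂ) * exp (2 * a * I))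
      = rhombusDir S.w a j * (((0 : ℝ) : ℂ) + ((0 : ℝ) : ℂ) * exp (2 * a * I)) := by
    push_cast
    linear_combination h
  exact one_ne_zero (hS.coords_unique j h').1

theorem IsRight.inRhombus_iff (hS : S.IsRight a) (j : ℤ) (z : ℂ) : S.InRhombus j z ↔
    ∃ x y : ℝ, 0 ≤ x ∧ x ≤ 1 ∧ 0 ≤ y ∧ y ≤ 1 ∧
      z = rhombusVertex S.w a j + rhombusDir S.w a j * (x + y * exp (2 * a * I)) := by
  unfold InRhombus
  rw [hS.c_eq, hS.F_eq, hS.G_eq]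
  simp only [rhombusSide, rhombusCoside, real_smul]
  split_ifs
  · constructor
    · rintro ⟨x, y, hx, hx', hy, hy', rfl⟩
      exact ⟨x, y, hx, hx', hy, hy', by ring⟩
    · rintro ⟨x, y, hx, hx', hy, hy', rfl⟩
      exact ⟨x, y, hx, hx', hy, hy', by ring⟩
  · constructor
    · rintro ⟨x, y, hx, hx', hy, hy', rfl⟩
      exact ⟨y, x, hy, hy', hx, hx', by ring⟩
    · rintro ⟨x, y, hx, hx', hy, hy', rfl⟩
      exact ⟨y, x, hy, hy', hx, hx', by ring⟩

theorem IsRight.inRhombus_translate_iff (hS : S.IsRight a) {t : ℂ} (h : IsTranslate S.w a t j j')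
    (z : ℂ) : S.InRhombus j' (z + t) ↔ S.InRhombus j z := by
  rw [hS.inRhombus_iff, hS.inRhombus_iff]
  rcases h with ⟨h1, h2⟩ | ⟨h1, h2⟩
  · rw [h1, h2]
    constructor
    · rintro ⟨x, y, hx, hx', hy, hy', h⟩
      exact ⟨x, y, hx, hx', hy, hy', by linear_combination h⟩
    · rintro ⟨x, y, hx, hx', hy, hy', h⟩
      exact ⟨x, y, hx, hx', hy, hy', by linear_combination h⟩
  · rw [h1, h2]
    constructor
    · rintro ⟨x, y, hx, hx', hy, hy', h⟩
      refine ⟨1 - x, 1 - y, by linarith, by linarith, by linarith, by linarith, ?_⟩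
      push_cast
      linear_combination h
    · rintro ⟨x, y, hx, hx', hy, hy', h⟩
      refine ⟨1 - x, 1 - y, by linarith, by linarith, by linarith, by linarith, ?_⟩
      push_cast
      linear_combination h

/-- In the frame of the rhombus, even copies have their hypotenuse on the x-axis and odd ones on the
y-axis. That neither coordinate reaches 1 is what excludes a half-turn in `IsRight.exit`. -/
theorem IsRight.crossing (hS : S.IsRight a) (h : S.w j = 2) :
    ∃ x y : ℝ, 0 ≤ x ∧ x < 1 ∧ 0 ≤ y ∧ y < 1 ∧ (Even j → y = 0) ∧ (¬Even j → x = 0) ∧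
      S.line (S.crossTime j)
        = rhombusVertex S.w a j + rhombusDir S.w a j * (x + y * exp (2 * a * I)) := by
  obtain ⟨l, h0, h1, h2⟩ := S.crossTime_spec h
  rw [h2, hS.c_eq, hS.F_eq, rhombusSide]
  by_cases hj : Even j
  · refine ⟨l, 0, h0, h1, le_rfl, one_pos, fun _ => rfl, fun h => absurd hj h, ?_⟩
    rw [if_pos hj, real_smul]
    push_cast
    ring
  · refine ⟨0, l, le_rfl, one_pos, h0, h1, fun h => absurd h hj, fun _ => rfl, ?_⟩
    rw [if_neg hj, real_smul]
    push_cast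
    ring

/-- The line leaves translates of a rhombus through the translates of the same point. -/
theorem IsRight.exit (hS : S.IsRight a) (h : IsTranslate S.w a (p • S.D) j j')
    (hj : S.w j = 2) (hj' : S.w j' = 2) :
    S.crossTime j' = S.crossTime j + p ∧ rhombusDir S.w a j' = rhombusDir S.w a j ∧
      rhombusVertex S.w a j' = rhombusVertex S.w a j + p • S.D ∧
      (S.line (S.crossTime j) ≠ S.c j → (Even j ↔ Even j')) := by
  -- Both sides are the last time at which the line is in the translated rhombus.
  have hτ : S.crossTime j' = S.crossTime j + p := by
    apply le_antisymm
    · have h1 := S.inRhombus_crossTime hj'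
      rw [show S.crossTime j' = (S.crossTime j' - p) + p by ring, line_add,
        hS.inRhombus_translate_iff h] at h1
      linarith [S.le_crossTime hj h1]
    · have h1 := S.inRhombus_crossTime hj
      rw [← hS.inRhombus_translate_iff h, ← line_add] at h1
      exact S.le_crossTime hj' h1
  obtain ⟨x, y, hx, hx1, hy, hy1, hev, hodd, hz⟩ := hS.crossing hj
  obtain ⟨x', y', hx', hx1', hy', hy1', hev', hodd', hz'⟩ := hS.crossing hj'
  rw [hτ, line_add, hz] at hz'
  -- A half-turn replaces (x, y) by (1 - x, 1 - y). Since each crossing point has a coordinate 0,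
  -- one of them would have a coordinate 1.
  have hσ : rhombusDir S.w a j' = rhombusDir S.w a j ∧
      rhombusVertex S.w a j' = rhombusVertex S.w a j + p • S.D := by
    refine h.resolve_right fun ⟨h1, h2⟩ => ?_
    rw [h1, h2] at hz'
    have hc : rhombusDir S.w a j * ((x : ℂ) + y * exp (2 * a * I))
        = rhombusDir S.w a j * (((1 - x' : ℝ) : ℂ) + ((1 - y' : ℝ) : ℂ) * exp (2 * a * I)) := by
      push_cast
      linear_combination hz'
    obtain ⟨c1, c2⟩ := hS.coords_unique j hc
    by_cases k : Even j <;> by_cases k' : Even j'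
    · have := hev k; have := hev' k'; linarith
    · have := hev k; have := hodd' k'; linarith
    · have := hodd k; have := hev' k'; linarith
    · have := hodd k; have := hodd' k'; linarith
  refine ⟨hτ, hσ.1, hσ.2, fun hne => ?_⟩
  rw [hσ.1, hσ.2] at hz'
  have hc : rhombusDir S.w a j * ((x : ℂ) + y * exp (2 * a * I))
      = rhombusDir S.w a j * (x' + y' * exp (2 * a * I)) := by linear_combination hz'
  obtain ⟨rfl, rfl⟩ := hS.coords_unique j hc
  by_contra hpar
  apply hne
  -- With different parities the crossing point lies on both axes of the rhombus, so it is the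
  -- vertex 0.
  rw [hz, hS.c_eq]
  have : x = 0 ∧ y = 0 := by
    by_cases k : Even j
    · have k' : ¬Even j' := fun k' => hpar ⟨fun _ => k', fun _ => k⟩
      exact ⟨hodd' k', hev k⟩
    · have k' : Even j' := by
        by_contra k'; exact hpar ⟨fun h => absurd h k, fun h => absurd h k'⟩
      exact ⟨hodd k, hev' k'⟩
  rw [this.1, this.2]
  simp

/-- Strikes recur. -/
theorem Strikes.add (hS : S.IsRight a) {m : ℤ} (hm : S.Closes m) (hp : S.Recurs a p)
    (hs : S.Strikes s) : S.Strikes (s + p) := by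
  obtain ⟨b, hb, hbmin⟩ := hs.exists_isLeast hm
  obtain ⟨b₀, hb₀, hw₀, hno⟩ := S.exists_prev b
  have hlt : S.crossTime b₀ < s := by
    refine lt_of_le_of_ne ((S.crossTime_mono hw₀ hb.1 hb₀.le).trans_eq hb.2) fun h => ?_
    have := hbmin (show b₀ ∈ S.gates s from ⟨hw₀, h⟩)
    omega
  -- Recurrence is only known at generic times. It is applied just before the strike, and the
  -- translate of the rhombus is then followed to its exit.
  obtain ⟨s', h1, h2⟩ := exists_between hlt
  have hgen : ∀ i, S.w i = 2 → S.crossTime i ≠ s' := by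
    intro i hi he
    rcases lt_or_ge b₀ i with h | h
    · have hbi : b ≤ i := by by_contra hh; exact hno i h (by omega) hi
      have := S.crossTime_mono hb.1 hi hbi
      rw [hb.2] at this
      linarith
    · have := S.crossTime_mono hi hw₀ h
      linarith
  obtain ⟨j, j', hj, -, ht⟩ := hp s' hgen
  have hjb : j ≤ b := by
    by_contra hh
    have := S.crossTime_le_of_lt hb.1 (not_le.1 hh) hj
    rw [hb.2] at this
    linarith
  have hjb₀ : b₀ < j := by
    by_contra hh
    have := S.le_crossTime_of_le hw₀ (not_lt.1 hh) hj
    linarith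
  obtain ⟨n, hjn, hn, hn0⟩ := S.exists_next j'
  have ht2 := (isTranslate_left_iff hjb fun i k1 k2 => hno i (by omega) k2).2 ht
  have ht3 := (isTranslate_right_iff hjn hn0).2 ht2
  obtain ⟨e1, -, e3, -⟩ := hS.exit ht3 hb.1 hn
  rw [hb.2] at e1
  refine ⟨n, hn, e1, ?_⟩
  rw [line_add, hs.line_eq hb, hS.c_eq, e3]

/-- The motion from the copy after one strike to the copy after the next one is, near the
triangle, a translation. -/
theorem IsRight.isTranslate_of_strikes (hS : S.IsRight a) (hp : S.Recurs a p) {l l' : ℤ}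
    (hs : S.Strikes s) (hs' : S.Strikes (s + p)) (hl : IsGreatest (S.gates s) l)
    (hl' : IsGreatest (S.gates (s + p)) l') :
    rhombusDir S.w a (l' + 1) = rhombusDir S.w a (l + 1) ∧
      rhombusVertex S.w a (l' + 1) = rhombusVertex S.w a (l + 1) + p • S.D := by
  have hnext : ∀ {s l}, IsGreatest (S.gates s) l → ∃ n, l + 1 ≤ n ∧ S.w n = 2 ∧
      (∀ i, l + 1 ≤ i → i < n → S.w i ≠ 2) ∧ s < S.crossTime n := by
    intro s l hl
    obtain ⟨n, hn, hw, hno⟩ := S.exists_next (l + 1)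
    refine ⟨n, hn, hw, hno, lt_of_le_of_ne ?_ fun h => ?_⟩
    · have := S.crossTime_mono hl.1.1 hw (by omega)
      rwa [hl.1.2] at this
    · have := hl.2 (show n ∈ S.gates s from ⟨hw, h.symm⟩)
      omega
  obtain ⟨n, hn, hw, hno, hτ⟩ := hnext hl
  obtain ⟨n', hn', hw', hno', hτ'⟩ := hnext hl'
  -- A generic time after the strike, before the next hypotenuse is crossed on either of the two
  -- routes.
  obtain ⟨r, hr1, hr2⟩ := exists_between (lt_min hτ (show s < S.crossTime n' - p by linarith))
  have hr3 := hr2.trans_le (min_le_left _ _)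
  have hr4 := hr2.trans_le (min_le_right _ _)
  have hgen : ∀ i, S.w i = 2 → S.crossTime i ≠ r := by
    intro i hi he
    rcases lt_or_ge l i with h | h
    · have hbi : n ≤ i := by by_contra hh; exact hno i (by omega) (by omega) hi
      have := S.crossTime_mono hw hi hbi
      linarith
    · have := S.crossTime_mono hi hl.1.1 h
      rw [hl.1.2] at this
      linarith
  obtain ⟨j, j', hj, hj', ht⟩ := hp r hgen
  have k1 : l < j := by
    by_contra hh
    have := S.le_crossTime_of_le hl.1.1 (not_lt.1 hh) hj
    rw [hl.1.2] at this
    linarith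
  have k2 : j ≤ n := by
    by_contra hh
    have := S.crossTime_le_of_lt hw (not_le.1 hh) hj
    linarith
  have k3 : l' < j' := by
    by_contra hh
    have := S.le_crossTime_of_le hl'.1.1 (not_lt.1 hh) hj'
    rw [hl'.1.2] at this
    linarith
  have k4 : j' ≤ n' := by
    by_contra hh
    have := S.crossTime_le_of_lt hw' (not_le.1 hh) hj'
    linarith
  have ht2 := (isTranslate_left_iff (j := l + 1) (by omega)
    fun i h1 h2 => hno i h1 (by omega)).1 ht
  have ht3 := (isTranslate_right_iff (j' := l' + 1) (by omega)
    fun i h1 h2 => hno' i h1 (by omega)).1 ht2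
  -- Both strikes hit the vertex 0 of the respective copy, whereas a half-turn would put the second
  -- one at the opposite corner.
  refine ht3.resolve_right fun ⟨_, h2⟩ => ?_
  have e1 := hs.line_eq hl.1
  have e2 := hs'.line_eq hl'.1
  rw [← (S.succ_two l hl.1.1).1, hS.c_eq] at e1
  rw [← (S.succ_two l' hl'.1.1).1, hS.c_eq, h2, line_add, e1] at e2
  refine hS.flip_ne (l + 1) ?_
  linear_combination -e2

/-- Between strikes the line follows the same route through the rhombi. -/
theorem IsRight.follows (hS : S.IsRight a) {o o' e e' : ℤ}
    (hd : rhombusDir S.w a o' = rhombusDir S.w a o)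
    (hv : rhombusVertex S.w a o' = rhombusVertex S.w a o + p • S.D)
    (he : S.w e = 2) (he' : S.w e' = 2) (hee : S.crossTime e' = S.crossTime e + p)
    (hoe : o ≤ e) (hoe' : o' ≤ e')
    (h1 : ∀ i, o ≤ i → i < e → S.w i = 2 →
      S.crossTime i ≠ S.crossTime e ∧ S.line (S.crossTime i) ≠ S.c i)
    (h2 : ∀ i, o' ≤ i → i < e' → S.w i = 2 → S.crossTime i ≠ S.crossTime e') :
    Follows S.w o o' e e' := by
  have hne := rhombusDir_ne_zero S.w a o
  -- At the angle `a` the starting frames are translates, so the two variants become the two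
  -- alternatives of `IsTranslate`.
  have htrans : ∀ {j j'}, Follows S.w o o' j j' ∨ FollowsFlipped S.w o o' j j' →
      IsTranslate S.w a (p • S.D) j j' := by
    rintro j j' (h | h)
    · obtain ⟨k1, k2⟩ := h.2 a
      rw [hd] at k1 k2
      left
      constructor
      · apply mul_right_cancel₀ hne
        rw [k1]; ring
      · apply mul_right_cancel₀ hne
        rw [hv] at k2
        linear_combination k2
    · obtain ⟨k1, k2⟩ := h.2 a
      rw [hd] at k1 k2
      right
      constructor
      · apply mul_right_cancel₀ hne
        rw [k1]; ring
      · apply mul_right_cancel₀ hne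
        rw [hv] at k2
        linear_combination k2
  have hunflip : ∀ {j j'}, Follows S.w o o' j j' ∨ FollowsFlipped S.w o o' j j' →
      rhombusDir S.w a j' = rhombusDir S.w a j → Follows S.w o o' j j' := by
    intro j j' h hdir
    refine h.resolve_right fun h => ?_
    obtain ⟨k1, -⟩ := h.2 a
    rw [hd, hdir] at k1
    have : 2 * (rhombusDir S.w a j * rhombusDir S.w a o) = 0 := by linear_combination k1
    have h3 := mul_ne_zero (rhombusDir_ne_zero S.w a j) hne
    exact mul_ne_zero two_ne_zero h3 this
  -- Two pointers run along the routes, separately across legs and jointly across hypotenuses.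
  -- `IsRight.exit` shows that joint crossings are `p` apart in time and, as no vertex is struck,
  -- have equal parity. The induction is on the number of copies left.
  have main : ∀ n : ℕ, ∀ j j', o ≤ j → j ≤ e → o' ≤ j' → j' ≤ e' →
      (e - j) + (e' - j') ≤ n → (Follows S.w o o' j j' ∨ FollowsFlipped S.w o o' j j') →
      Follows S.w o o' e e' := by
    intro n
    induction n with
    | zero =>
      intro j j' _ hj _ hj' hn hf
      obtain rfl : j = e := by omega
      obtain rfl : j' = e' := by omega
      exact hunflip hf (hS.exit (htrans hf) he he').2.1
    | succ n ih =>
      intro j j' hoj hj hoj' hj' hn hf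
      by_cases hw : S.w j = 2
      · by_cases hw' : S.w j' = 2
        · obtain ⟨e1, e2, e3, e4⟩ := hS.exit (htrans hf) hw hw'
          rcases hj.eq_or_lt with rfl | hj
          · rcases hj'.eq_or_lt with rfl | hj'
            · exact hunflip hf e2
            · exact absurd (e1.trans hee.symm) (h2 j' hoj' hj' hw')
          · obtain ⟨k1, k2⟩ := h1 j hoj hj hw
            rcases hj'.eq_or_lt with rfl | hj'
            · exact absurd (by linarith) k1
            · exact ih (j + 1) (j' + 1) (by omega) (by omega) (by omega) (by omega)
                (by push_cast at hn; omega) (Or.inl (follows_succ_succ hw hw' (e4 k2) (hunflip hf e2)))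
        · have : j' ≠ e' := by rintro rfl; exact hw' he'
          exact ih j (j' + 1) hoj hj (by omega) (by omega) (by push_cast at hn; omega)
            (follows_succ_right hw' hf)
      · have : j ≠ e := by rintro rfl; exact hw he
        exact ih (j + 1) j' (by omega) (by omega) hoj' hj' (by push_cast at hn; omega)
          (follows_succ_left hw hf)
  exact main ((e - o) + (e' - o')).toNat o o' le_rfl hoe le_rfl hoe' (by omega)
    (Or.inl (follows_self _ _ _))

end RhombusStrip

/-! ### The sequence of strikes -/

namespace RhombusStrip

variable {S : RhombusStrip} {a p : ℝ} {s : ℝ} {j j' : ℤ}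

theorem IsRight.side_eq (hS : S.IsRight a) {e : ℤ} (h : S.w j = 2) (hp : Even j ↔ Even e) :
    rhombusDir S.w a (j + 1) * (if Even e then exp (2 * a * I) else 1) = S.F j := by
  rw [hS.F_eq, rhombusSide]
  by_cases hj : Even j
  · rw [if_pos (hp.1 hj), if_pos hj, rhombusDir_succ_of_even h hj]
  · rw [if_neg (fun he => hj (hp.2 he)), if_neg hj, rhombusDir_succ_of_odd h hj, mul_one]

theorem orient_congr {e : ℤ} (hp : Even j ↔ Even e) : orient j = orient e := by
  unfold orient
  simp only [hp]

/-- During a strike the line turns around the struck vertex, counter-clockwise if the crossed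
hypotenuses have odd indices and clockwise if they have even indices. -/
theorem IsRight.turn (hS : S.IsRight a) (hs : S.Strikes s) {e l : ℤ}
    (he : IsLeast (S.gates s) e) (hl : IsGreatest (S.gates s) l) :
    (∀ b : ℝ, rhombusVertex S.w b (l + 1) = rhombusVertex S.w b e) ∧
    (∀ i ∈ S.gates s, (Even i ↔ Even e)) ∧
    (Even e → turnCount S.w (l + 1) ≤ turnCount S.w e - 1) ∧
    (¬Even e → turnCount S.w e + 1 ≤ turnCount S.w (l + 1)) := by
  -- Multiplied by `η`, the direction of the rhombus just entered through a hypotenuse of the parity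
  -- of `e` is the side through which it was entered.
  set η : ℂ := if Even e then exp (2 * a * I) else 1 with hη
  have hgate : ∀ i, S.w i = 2 → (Even i ↔ Even e) →
      0 < orient e * cross S.D (rhombusDir S.w a (i + 1) * η) := by
    intro i hi hp
    rw [hη, hS.side_eq hi hp, ← orient_congr hp]
    exact S.cross_D_F hi
  have hz : ∀ i, S.w i = 2 → S.w i ≠ 0 := fun i hi => by rw [hi]; decide
  have hel : e ≤ l := hl.2 he.1
  have hce := hs.line_eq he.1
  -- The struck vertex stays the vertex 0 or, after a crossing of the edge 0, the opposite corner,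
  -- and the sense in which the line crossed the side of entrance is recorded.
  have key : ∀ n : ℕ, e + 1 + n ≤ l + 1 →
      ((Even e → turnCount S.w (e + 1 + n) ≤ turnCount S.w e - 1) ∧
      (¬Even e → turnCount S.w e + 1 ≤ turnCount S.w (e + 1 + n)) ∧
      (∀ i, S.w i = 2 → e ≤ i → i < e + 1 + n → (Even i ↔ Even e))) ∧
      (((∀ b : ℝ, rhombusVertex S.w b (e + 1 + n) = rhombusVertex S.w b e) ∧
        0 < orient e * cross S.D (rhombusDir S.w a (e + 1 + n) * η)) ∨
      ((∀ b : ℝ, rhombusVertex S.w b (e + 1 + n)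
          + rhombusDir S.w b (e + 1 + n) * (1 + exp (2 * b * I)) = rhombusVertex S.w b e) ∧
        0 < orient e * cross S.D (-(rhombusDir S.w a (e + 1 + n) * η)))) := by
    intro n
    induction n with
    | zero =>
      intro _
      rw [Nat.cast_zero, add_zero]
      refine ⟨⟨fun h => ?_, fun h => ?_, fun i _ h1 h2 => ?_⟩, Or.inl ⟨fun b => ?_, ?_⟩⟩
      · rw [turnCount_succ_of_even he.1.1 h]
      · rw [turnCount_succ_of_odd he.1.1 h]
      · obtain rfl : i = e := by omega
        rfl
      · exact rhombusVertex_succ_of_ne (hz _ he.1.1) b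
      · exact hgate e he.1.1 Iff.rfl
    | succ n ih =>
      intro hn
      have e1 : e + 1 + ((n + 1 : ℕ) : ℤ) = (e + 1 + n) + 1 := by push_cast; ring
      obtain ⟨⟨i1, i2, i3⟩, i4⟩ := ih (by omega)
      rw [e1]
      set j := e + 1 + (n : ℤ) with hj
      rcases S.w_cases j with h0 | h1 | h2
      · have hne : S.w j ≠ 2 := by rw [h0]; decide
        rw [turnCount_succ_of_ne hne, rhombusDir_succ_of_zero h0]
        refine ⟨⟨i1, i2, fun i hi k1 k2 => i3 i hi k1 ?_⟩, ?_⟩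
        · have : i ≠ j := by rintro rfl; exact hne hi
          omega
        · rcases i4 with ⟨k1, k2⟩ | ⟨k1, k2⟩
          · refine Or.inr ⟨fun b => ?_, ?_⟩
            · rw [rhombusVertex_succ_of_zero h0, rhombusDir_succ_of_zero h0, ← k1 b]
              ring
            · rw [neg_mul, neg_neg]
              exact k2
          · refine Or.inl ⟨fun b => ?_, ?_⟩
            · rw [rhombusVertex_succ_of_zero h0, ← k1 b]
            · rw [neg_mul]
              exact k2
      · have hne : S.w j ≠ 2 := by rw [h1]; decide
        have hne0 : S.w j ≠ 0 := by rw [h1]; decide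
        simp only [turnCount_succ_of_ne hne, rhombusDir_succ_of_one h1,
          rhombusVertex_succ_of_ne hne0]
        refine ⟨⟨i1, i2, fun i hi k1 k2 => i3 i hi k1 ?_⟩, i4⟩
        have : i ≠ j := by rintro rfl; exact hne hi
        omega
      · have hmem := mem_gates_of_between he.1 hl.1 h2 (by omega) (by omega)
        have hcj := hs.line_eq hmem
        rcases i4 with ⟨k1, k2⟩ | ⟨k1, k2⟩
        -- A hypotenuse of the other parity would be the side of entrance itself, crossed in the
        -- opposite sense.
        · have hpar : Even j ↔ Even e := by
            have hF := S.cross_D_F h2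
            rw [hS.F_eq, rhombusSide] at hF
            by_cases hee : Even e
            · rw [hη, if_pos hee, orient_of_even hee] at k2
              by_contra hp
              have hje : ¬Even j := fun h => hp ⟨fun _ => hee, fun _ => h⟩
              rw [if_neg hje, orient_of_not_even hje] at hF
              linarith
            · rw [hη, if_neg hee, orient_of_not_even hee, mul_one] at k2
              by_contra hp
              have hje : Even j := by
                by_contra h; exact hp ⟨fun k => absurd k h, fun k => absurd k hee⟩
              rw [if_pos hje, orient_of_even hje] at hF
              linarith
          refine ⟨⟨fun h => ?_, fun h => ?_, fun i hi m1 m2 => ?_⟩, Or.inl ⟨fun b => ?_, ?_⟩⟩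
          · rw [turnCount_succ_of_even h2 (hpar.2 h)]
            linarith [i1 h]
          · rw [turnCount_succ_of_odd h2 (fun k => h (hpar.1 k))]
            linarith [i2 h]
          · rcases (show i < j ∨ i = j by omega) with h | rfl
            · exact i3 i hi m1 h
            · exact hpar
          · rw [rhombusVertex_succ_of_ne (hz _ h2), k1 b]
          · exact hgate j h2 hpar
        -- The hypotenuse ends in the vertex 0 of the copy `j`, which would then coincide with the
        -- opposite corner.
        · exfalso
          refine hS.flip_ne j ?_
          have := k1 a
          rw [hS.c_eq] at hce hcj
          linear_combination this - hce + hcj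
  obtain ⟨⟨i1, i2, i3⟩, i4⟩ := key (l - e).toNat (by omega)
  rw [show e + 1 + ((l - e).toNat : ℤ) = l + 1 by omega] at i1 i2 i3 i4
  refine ⟨?_, fun i hi => i3 i hi.1 (he.2 hi) (by have := hl.2 hi; omega), i1, i2⟩
  rcases i4 with ⟨k1, -⟩ | ⟨k1, -⟩
  · exact k1
  · exfalso
    refine hS.flip_ne (l + 1) ?_
    have := k1 a
    have hcl := hs.line_eq hl.1
    rw [← (S.succ_two l hl.1.1).1] at hcl
    rw [hS.c_eq] at hce hcl
    linear_combination this - hce + hcl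

/-- The strikes occur at the times `s₀ + i p`, and the first and last hypotenuses crossed during
the strike `i` are `e i` and `l i`. -/
structure StrikeSequence (S : RhombusStrip) (s₀ p : ℝ) (e l : ℤ → ℤ) : Prop where
  pos : 0 < p
  strikes_iff : ∀ s, S.Strikes s ↔ ∃ i : ℤ, s = s₀ + i * p
  isLeast : ∀ i : ℤ, IsLeast (S.gates (s₀ + i * p)) (e i)
  isGreatest : ∀ i : ℤ, IsGreatest (S.gates (s₀ + i * p)) (l i)

namespace StrikeSequence

variable {s₀ : ℝ} {e l : ℤ → ℤ}

theorem strikes (h : StrikeSequence S s₀ p e l) (i : ℤ) : S.Strikes (s₀ + i * p) :=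
  (h.strikes_iff _).2 ⟨i, rfl⟩

theorem time_succ (i : ℤ) : s₀ + ((i + 1 : ℤ) : ℝ) * p = s₀ + i * p + p := by
  push_cast; ring

theorem crossTime_e (h : StrikeSequence S s₀ p e l) (i : ℤ) :
    S.crossTime (e i) = s₀ + i * p := (h.isLeast i).1.2

theorem crossTime_l (h : StrikeSequence S s₀ p e l) (i : ℤ) :
    S.crossTime (l i) = s₀ + i * p := (h.isGreatest i).1.2

theorem l_lt_e_succ (h : StrikeSequence S s₀ p e l) (i : ℤ) : l i < e (i + 1) := by
  by_contra hcon
  have := S.crossTime_mono (h.isLeast (i + 1)).1.1 (h.isGreatest i).1.1 (not_lt.1 hcon)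
  rw [h.crossTime_e, h.crossTime_l, time_succ] at this
  linarith [h.pos]

/-- Between two strikes the line crosses hypotenuses at intermediate times. -/
theorem between (h : StrikeSequence S s₀ p e l) {i k : ℤ} (hk : S.w k = 2) (h1 : l i + 1 ≤ k)
    (h2 : k < e (i + 1)) : s₀ + i * p < S.crossTime k ∧ S.crossTime k < s₀ + i * p + p := by
  constructor
  · have h3 := S.crossTime_mono (h.isGreatest i).1.1 hk (by omega)
    rw [h.crossTime_l] at h3
    refine lt_of_le_of_ne h3 fun h4 => ?_
    have := (h.isGreatest i).2 (show k ∈ S.gates _ from ⟨hk, h4.symm⟩)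
    omega
  · have h3 := S.crossTime_mono hk (h.isLeast (i + 1)).1.1 h2.le
    rw [h.crossTime_e, time_succ] at h3
    refine lt_of_le_of_ne h3 fun h4 => ?_
    have := (h.isLeast (i + 1)).2 (show k ∈ S.gates _ from ⟨hk, by rw [time_succ]; exact h4⟩)
    omega

theorem not_strike (h : StrikeSequence S s₀ p e l) {i : ℤ} {s : ℝ} (h1 : s₀ + i * p < s)
    (h2 : s < s₀ + i * p + p) : ¬S.Strikes s := by
  intro hs
  obtain ⟨k, rfl⟩ := (h.strikes_iff s).1 hs
  have hp := h.pos
  have h3 : (i : ℝ) < k := by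
    by_contra hh
    push Not at hh
    nlinarith
  have h4 : (k : ℝ) < i + 1 := by
    by_contra hh
    push Not at hh
    nlinarith
  have h3' : i < k := by exact_mod_cast h3
  have h4' : k < i + 1 := by exact_mod_cast h4
  omega

theorem dir_eq (h : StrikeSequence S s₀ p e l) (hS : S.IsRight a) (hp : S.Recurs a p) (i : ℤ) :
    rhombusDir S.w a (l (i + 1) + 1) = rhombusDir S.w a (l i + 1) ∧
      rhombusVertex S.w a (l (i + 1) + 1) = rhombusVertex S.w a (l i + 1) + p • S.D := by
  have h1 := h.strikes (i + 1)
  have h2 := h.isGreatest (i + 1)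
  rw [time_succ] at h1 h2
  exact hS.isTranslate_of_strikes hp (h.strikes i) h1 (h.isGreatest i) h2

theorem follows (h : StrikeSequence S s₀ p e l) (hS : S.IsRight a) (hp : S.Recurs a p) (i : ℤ) :
    Follows S.w (l i + 1) (l (i + 1) + 1) (e (i + 1)) (e (i + 1 + 1)) := by
  obtain ⟨hd, hv⟩ := h.dir_eq hS hp i
  refine hS.follows (p := p) hd hv (h.isLeast _).1.1 (h.isLeast _).1.1 ?_ ?_ ?_ ?_ ?_
  · rw [h.crossTime_e, h.crossTime_e, time_succ (i + 1)]
  · have := h.l_lt_e_succ i; omega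
  · have := h.l_lt_e_succ (i + 1); omega
  · intro k k1 k2 hk
    obtain ⟨m1, m2⟩ := h.between hk k1 k2
    refine ⟨?_, fun hc => h.not_strike m1 m2 ⟨k, hk, rfl, hc⟩⟩
    rw [h.crossTime_e, time_succ]
    exact m2.ne
  · intro k k1 k2 hk
    obtain ⟨m1, m2⟩ := h.between hk k1 k2
    rw [h.crossTime_e, time_succ (i + 1)]
    exact m2.ne

theorem vertex_l_succ (h : StrikeSequence S s₀ p e l) (hS : S.IsRight a) (i : ℤ) (b : ℝ) :
    rhombusVertex S.w b (l i + 1) = rhombusVertex S.w b (e i) :=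
  (hS.turn (h.strikes i) (h.isLeast i) (h.isGreatest i)).1 b

/-- The number of turns between two consecutive strikes is always the same. -/
theorem exists_turnCount_eq (h : StrikeSequence S s₀ p e l) (hS : S.IsRight a)
    (hp : S.Recurs a p) :
    ∃ q : ℤ, ∀ i, turnCount S.w (e (i + 1)) - turnCount S.w (l i + 1) = q := by
  refine ⟨turnCount S.w (e (0 + 1)) - turnCount S.w (l 0 + 1), fun i => ?_⟩
  induction i with
  | zero => rfl
  | succ i ih => rw [← ih]; exact (h.follows hS hp i).1
  | pred i ih =>
    rw [← ih]
    have := (h.follows hS hp (-i - 1)).1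
    rw [sub_add_cancel] at this
    rw [sub_add_cancel]
    exact this.symm

theorem vertex_sub (h : StrikeSequence S s₀ p e l) (hS : S.IsRight a) (i : ℤ) :
    rhombusVertex S.w a (e (i + 1)) - rhombusVertex S.w a (e i) = p • S.D := by
  have h1 := (h.strikes i).line_eq (h.isLeast i).1
  have h2 := (h.strikes (i + 1)).line_eq (h.isLeast (i + 1)).1
  rw [hS.c_eq] at h1 h2
  rw [← h1, ← h2, time_succ, line_add]
  ring

/-- The second difference of the struck vertices on the right triangle with angle `b`. -/
theorem second_difference (h : StrikeSequence S s₀ p e l) (hS : S.IsRight a) (hp : S.Recurs a p)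
    (i : ℤ) (b : ℝ) :
    rhombusVertex S.w b (e (i + 1 + 1)) - 2 * rhombusVertex S.w b (e (i + 1))
        + rhombusVertex S.w b (e i)
      = (exp (2 * (b - a) * I * ((turnCount S.w (l (i + 1) + 1) - turnCount S.w (l i + 1) : ℤ) : ℂ))
          - 1) * (rhombusVertex S.w b (e (i + 1)) - rhombusVertex S.w b (e i)) := by
  have h1 := ((h.follows hS hp i).2 b).2
  rw [h.vertex_l_succ hS, h.vertex_l_succ hS] at h1
  have hd := (h.dir_eq hS hp i).1
  -- The directions after consecutive strikes agree at the angle `a`, and each turn contributes a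
  -- rotation by 2(b - a) at the angle `b`.
  have hν : rhombusDir S.w b (l (i + 1) + 1) = rhombusDir S.w b (l i + 1)
      * exp (2 * (b - a) * I
        * ((turnCount S.w (l (i + 1) + 1) - turnCount S.w (l i + 1) : ℤ) : ℂ)) := by
    rw [rhombusDir_eq S.w a b, rhombusDir_eq S.w a b (l i + 1), hd, mul_assoc _ (exp _), ← exp_add]
    congr 2
    push_cast
    ring
  rw [hν] at h1
  have h2 := rhombusDir_ne_zero S.w b (l i + 1)
  have h3 : rhombusVertex S.w b (e (i + 1 + 1)) - rhombusVertex S.w b (e (i + 1))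
      = exp (2 * (b - a) * I
        * ((turnCount S.w (l (i + 1) + 1) - turnCount S.w (l i + 1) : ℤ) : ℂ))
        * (rhombusVertex S.w b (e (i + 1)) - rhombusVertex S.w b (e i)) := by
    apply mul_right_cancel₀ h2
    rw [h1]
    ring
  linear_combination h3

end StrikeSequence

end RhombusStrip

open Filter Topology

/-! ### Derivatives in the parameter plane -/

theorem norm_cos_sin (φ : ℝ) : ‖(!₂[Real.cos φ, Real.sin φ] : Params)‖ = 1 := by
  rw [EuclideanSpace.norm_eq]
  simp

theorem continuous_cos_sin : Continuous fun φ : ℝ => (!₂[Real.cos φ, Real.sin φ] : Params) := by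
  fun_prop

/-- A function with a positive derivative in some direction is positive in a sector. -/
theorem eventually_pos_of_hasFDerivAt {F : Params → ℝ} {F' : Params →L[ℝ] ℝ} {T : Params} {φ₀ : ℝ}
    (hF : HasFDerivAt F F' T) (h0 : F T = 0) (hpos : 0 < F' !₂[Real.cos φ₀, Real.sin φ₀]) :
    ∀ᶠ x : ℝ × ℝ in 𝓝 φ₀ ×ˢ 𝓝[>] 0, 0 < F (T + x.2 • !₂[Real.cos x.1, Real.sin x.1]) := by
  set c := F' !₂[Real.cos φ₀, Real.sin φ₀] with hc
  have hu : ∀ᶠ x : ℝ × ℝ in 𝓝 φ₀ ×ˢ 𝓝[>] 0, c / 2 < F' !₂[Real.cos x.1, Real.sin x.1] := by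
    have hcont : Continuous fun φ : ℝ => F' !₂[Real.cos φ, Real.sin φ] :=
      F'.continuous.comp continuous_cos_sin
    have := (hcont.tendsto φ₀).eventually (lt_mem_nhds (show c / 2 < c by linarith))
    exact tendsto_fst.eventually this
  have hr : ∀ᶠ x : ℝ × ℝ in 𝓝 φ₀ ×ˢ 𝓝[>] (0 : ℝ), 0 < x.2 :=
    tendsto_snd.eventually (eventually_mem_nhdsWithin (a := (0 : ℝ)) (s := Set.Ioi 0))
  have htend : Tendsto (fun x : ℝ × ℝ => T + x.2 • (!₂[Real.cos x.1, Real.sin x.1] : Params))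
      (𝓝 φ₀ ×ˢ 𝓝[>] 0) (𝓝 T) := by
    have h1 : Continuous fun x : ℝ × ℝ => T + x.2 • (!₂[Real.cos x.1, Real.sin x.1] : Params) := by
      fun_prop
    have h2 := h1.tendsto (φ₀, 0)
    simp only [zero_smul, add_zero] at h2
    refine h2.mono_left ?_
    rw [nhds_prod_eq]
    exact prod_mono le_rfl nhdsWithin_le_nhds
  -- Near `φ₀` the linear part exceeds rc/2, so an error of at most rc/4 leaves the value positive.
  have ho := (hasFDerivAt_iff_isLittleO.1 hF).bound (show 0 < c / 4 by linarith)
  filter_upwards [hu, hr, htend.eventually ho] with x h1 h2 h3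
  rw [h0, sub_zero, add_sub_cancel_left, map_smul, norm_smul, norm_cos_sin, mul_one,
    Real.norm_eq_abs, Real.norm_of_nonneg h2.le, smul_eq_mul] at h3
  have h4 := (abs_le.1 h3).1
  nlinarith [mul_lt_mul_of_pos_left h1 h2]

theorem rightTriangle_eq (a b : ℝ) :
    rightTriangle b = rightTriangle a + (b - a) • (!₂[1, -1] : Params) := by
  ext i
  fin_cases i
  · simp [rightTriangle]
  · simp [rightTriangle]

theorem hasDerivAt_rightTriangle (a : ℝ) :
    HasDerivAt rightTriangle (!₂[1, -1] : Params) a := by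
  have h : rightTriangle = fun b => rightTriangle a + (b - a) • (!₂[1, -1] : Params) :=
    funext fun b => rightTriangle_eq a b
  rw [h]
  have := (((hasDerivAt_id a).sub_const a).smul_const (!₂[1, -1] : Params)).const_add
    (rightTriangle a)
  simpa using this

theorem hasDerivAt_cross {X Y : ℝ → ℂ} {X' Y' : ℂ} {a : ℝ} (hX : HasDerivAt X X' a)
    (hY : HasDerivAt Y Y' a) :
    HasDerivAt (fun b => cross (X b) (Y b)) (cross X' (Y a) + cross (X a) Y') a := by
  have re : ∀ {Z : ℝ → ℂ} {Z' : ℂ}, HasDerivAt Z Z' a → HasDerivAt (fun b => (Z b).re) Z'.re a :=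
    fun h => (Complex.reCLM.hasFDerivAt.comp_hasDerivAt a h)
  have im : ∀ {Z : ℝ → ℂ} {Z' : ℂ}, HasDerivAt Z Z' a → HasDerivAt (fun b => (Z b).im) Z'.im a :=
    fun h => (Complex.imCLM.hasFDerivAt.comp_hasDerivAt a h)
  have := ((re hX).mul (im hY)).sub ((im hX).mul (re hY))
  exact this.congr_deriv (by simp only [cross]; ring)

theorem differentiable_cross {X Y : Params → ℂ} (hX : Differentiable ℝ X)
    (hY : Differentiable ℝ Y) : Differentiable ℝ fun θ => cross (X θ) (Y θ) := by
  have re : ∀ {Z : Params → ℂ}, Differentiable ℝ Z → Differentiable ℝ fun θ => (Z θ).re :=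
    fun h => Complex.reCLM.differentiable.comp h
  have im : ∀ {Z : Params → ℂ}, Differentiable ℝ Z → Differentiable ℝ fun θ => (Z θ).im :=
    fun h => Complex.imCLM.differentiable.comp h
  unfold cross
  exact ((re hX).mul (im hY)).sub ((im hX).mul (re hY))

/-- The derivative in the direction of right triangles of the height of a vector that is obtained
from a multiple of the displacement by a rotation with angular speed `2 N`. -/
theorem exists_hasFDerivAt_cross {X W V : Params → ℂ} (hX : Differentiable ℝ X)
    (hW : Differentiable ℝ W) (hV : Differentiable ℝ V) {a p : ℝ} {N : ℤ} {D : ℂ}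
    (hXa : X (rightTriangle a) = D) (hVa : V (rightTriangle a) = p • D)
    (hWV : ∀ᶠ b in 𝓝 a, W (rightTriangle b)
      = (exp (2 * (b - a) * I * N) - 1) * V (rightTriangle b)) :
    ∃ F' : Params →L[ℝ] ℝ, HasFDerivAt (fun θ => cross (X θ) (W θ)) F' (rightTriangle a) ∧
      F' !₂[1, -1] = 2 * N * p * ‖D‖ ^ 2 := by
  have hF := (differentiable_cross hX hW (rightTriangle a)).hasFDerivAt
  refine ⟨_, hF, ?_⟩
  have h1 := hF.comp_hasDerivAt a (hasDerivAt_rightTriangle a)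
  have hX' := (hX (rightTriangle a)).hasFDerivAt.comp_hasDerivAt a (hasDerivAt_rightTriangle a)
  have hV' := (hV (rightTriangle a)).hasFDerivAt.comp_hasDerivAt a (hasDerivAt_rightTriangle a)
  have hexp : HasDerivAt (fun b : ℝ => exp (2 * (b - a) * I * N) - 1) (2 * I * N) a := by
    have h2 : HasDerivAt (fun b : ℝ => (2 * (b - a) * I * N : ℂ)) (2 * I * N) a := by
      have := ((Complex.ofRealCLM.hasDerivAt (x := a)).sub_const (a : ℂ)).mul_const (2 * I * N : ℂ)
      simp only [ofRealCLM_apply, ofReal_one, one_mul] at this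
      refine this.congr_of_eventuallyEq (Eventually.of_forall fun b => ?_)
      simp only
      ring
    have := h2.cexp.sub_const 1
    simpa using this
  have hY := hexp.mul hV'
  have hYW : (fun b => W (rightTriangle b)) =ᶠ[𝓝 a]
      ((fun b : ℝ => exp (2 * (b - a) * I * N) - 1) * (V ∘ rightTriangle)) := hWV
  have h3 := hasDerivAt_cross hX' (hY.congr_of_eventuallyEq hYW)
  have h4 := h1.unique h3
  -- The rotation factor minus 1 vanishes at `a`, so neither `X` nor `V` contributes through its
  -- derivative. What remains is the cross product of `D` with 2iNp times `D`.
  rw [h4, hWV.self_of_nhds]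
  simp only [Function.comp_apply, hXa, hVa, sub_self, mul_zero, zero_mul, exp_zero, add_zero]
  rw [cross_eq_im, cross_eq_im, mul_zero, zero_im, zero_add,
    show conj D * (2 * I * N * p • D) = ((2 * N * p : ℝ) : ℂ) * I * (conj D * D) by
      rw [real_smul]; push_cast; ring, Complex.conj_mul']
  rw [← ofReal_pow, mul_right_comm, ← ofReal_mul, im_ofReal_mul, I_im, mul_one]

/-! ### Periodic sequences of heights -/

theorem exists_max_of_periodic {h : ℤ → ℝ} {m : ℤ} (hm : 0 < m) (hper : ∀ i, h (i + m) = h i) :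
    ∃ i ∈ Finset.Ico 0 m, ∀ k, h k ≤ h i := by
  obtain ⟨i, hi, hmax⟩ := Finset.exists_max_image (Finset.Ico 0 m) h ⟨0, by simpa using hm⟩
  refine ⟨i, hi, fun k => ?_⟩
  have hp : Function.Periodic h m := hper
  have h1 : h (k % m) = h k := by
    rw [Int.emod_def, mul_comm]
    exact hp.sub_zsmul_eq (k / m)
  rw [← h1]
  exact hmax _ (Finset.mem_Ico.2 ⟨Int.emod_nonneg _ hm.ne', Int.emod_lt_of_pos _ hm⟩)

theorem exists_differentiable_copyMap (w : ℤ → Fin 3) : ∃ C : ℤ → Params → ℂ,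
    (∀ j, Differentiable ℝ (C j)) ∧ ∀ θ, IsTriangle θ → ∀ j, copyMap θ w j 0 = C j θ := by
  choose U C hU hC hn h using exists_copyMap_form w
  refine ⟨C, hC, fun θ hθ j => ?_⟩
  rw [h j θ hθ]
  simp [conjPow]

/-- In this direction the sum of the two angles is constant, so the triangles stay right. -/
theorem cos_sin_seven_pi_div_four :
    (!₂[Real.cos (7 * Real.pi / 4), Real.sin (7 * Real.pi / 4)] : Params)
      = (√2 / 2) • !₂[1, -1] := by
  have e : 7 * Real.pi / 4 = -(Real.pi / 4) + 2 * Real.pi := by ring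
  rw [e, Real.cos_add_two_pi, Real.sin_add_two_pi, Real.cos_neg, Real.sin_neg,
    Real.cos_pi_div_four, Real.sin_pi_div_four]
  ext i
  fin_cases i <;> simp

/-! ### The orbit tile near the right triangle -/

namespace SaddleConnection

variable {P : Params} {a : ℝ} {f : PeriodicTrajectory P}

theorem isRight_strip (g : SaddleConnection f (rightTriangle a)) (hP : IsTriangle P) (h₀ : 0 < a)
    (h₁ : a < Real.pi / 2) (hother : ∀ s, ¬g.StrikesAt 1 s) :
    (g.strip hP h₀ h₁ hother).IsRight a :=
  ⟨h₀, h₁, rfl, rfl, rfl⟩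

theorem recurs_strip (g : SaddleConnection f (rightTriangle a)) (hP : IsTriangle P) (h₀ : 0 < a)
    (h₁ : a < Real.pi / 2) (hother : ∀ s, ¬g.StrikesAt 1 s) {p : ℝ} (hp : g.HasPeriod p) :
    (g.strip hP h₀ h₁ hother).Recurs a p :=
  fun _ hs => g.exists_isTranslate hP h₀ h₁ hother hp hs

theorem HasPeriod.neg {T : Params} {g : SaddleConnection f T} {p : ℝ} (hp : g.HasPeriod p) :
    g.HasPeriod (-p) := by
  intro s
  obtain ⟨u, h1, h2⟩ := hp (s + -p)
  rw [neg_add_cancel_right] at h2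
  exact ⟨u, h2, h1⟩

theorem closes_strip (g : SaddleConnection f (rightTriangle a)) (hP : IsTriangle P) (h₀ : 0 < a)
    (h₁ : a < Real.pi / 2) (hother : ∀ s, ¬g.StrikesAt 1 s) :
    (g.strip hP h₀ h₁ hother).Closes f.len := by
  refine ⟨by exact_mod_cast f.len_pos, fun b hb => ?_⟩
  have h1 : f.edge (b - f.len) = 2 := by
    have := f.edge_periodic (b - f.len)
    rw [sub_add_cancel] at this
    rw [← this]; exact hb
  refine ⟨(f.edge_periodic b).trans hb, h1, g.crossTime_add_len hP h₀ h₁ hother hb, ?_⟩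
  have := g.crossTime_add_len hP h₀ h₁ hother h1
  rw [sub_add_cancel] at this
  rw [this]; ring

theorem strikesAt_zero_iff_eq (g : SaddleConnection f (rightTriangle a)) (h₀ : 0 < a)
    (h₁ : a < Real.pi / 2) (s : ℝ) :
    g.StrikesAt 0 s ↔ ∃ j, g.path s = rhombusVertex f.edge a j := by
  unfold StrikesAt
  simp only [vertex_zero, copyMap_rightTriangle_zero h₀ h₁, eq_comm]

theorem strikesAt_zero_iff (g : SaddleConnection f (rightTriangle a)) (hP : IsTriangle P)
    (h₀ : 0 < a) (h₁ : a < Real.pi / 2) (hother : ∀ s, ¬g.StrikesAt 1 s) (s : ℝ) :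
    g.StrikesAt 0 s ↔ (g.strip hP h₀ h₁ hother).Strikes s := by
  rw [g.strikesAt_zero_iff_eq h₀ h₁]
  constructor
  · rintro ⟨j, hj⟩
    obtain ⟨b, h1, h2, h3, -⟩ := (g.strip hP h₀ h₁ hother).exists_crossTime_eq (j := j) hj
    exact ⟨b, h1, h2, h3⟩
  · rintro ⟨b, -, -, h⟩
    exact ⟨b, h⟩

/-- A struck vertex `0` of the copy `j` is the end of a hypotenuse `b` crossed at that moment, and
is the same vertex as the one of the copy `b` in the unfolding of any triangle. -/
theorem exists_gate (g : SaddleConnection f (rightTriangle a)) (hP : IsTriangle P)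
    (h₀ : 0 < a) (h₁ : a < Real.pi / 2) (hother : ∀ s, ¬g.StrikesAt 1 s) {s : ℝ} {j : ℤ}
    (h : copyMap (rightTriangle a) f.edge j (vertex (rightTriangle a) 0) = g.path s) :
    ∃ b ∈ (g.strip hP h₀ h₁ hother).gates s,
      copyMap P f.edge b (vertex P 0) = copyMap P f.edge j (vertex P 0) := by
  rw [vertex_zero, copyMap_rightTriangle_zero h₀ h₁] at h
  obtain ⟨b, h1, h2, -, h3⟩ :=
    (g.strip hP h₀ h₁ hother).exists_crossTime_eq (j := j) (s := s) h.symm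
  refine ⟨b, ⟨h1, h2⟩, ?_⟩
  rcases h3 with rfl | ⟨rfl, h3⟩ | rfl | ⟨rfl, h3⟩
  · rfl
  · exact copyMap_succ_vertex P f.edge j (by rw [show f.edge j = 1 from h3]; decide)
  · have := copyMap_succ_vertex P f.edge (j - 1) (c := 0)
      (by rw [show f.edge (j - 1) = 2 from h1]; decide)
    rw [sub_add_cancel] at this
    exact this.symm
  · have k1 := copyMap_succ_vertex P f.edge (j - 1) (c := 0)
      (by rw [show f.edge (j - 1) = 1 from h3]; decide)
    have k2 := copyMap_succ_vertex P f.edge (j - 2) (c := 0)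
      (by rw [show f.edge (j - 2) = 2 from h1]; decide)
    rw [sub_add_cancel] at k1
    rw [show j - 2 + 1 = j - 1 by ring] at k2
    rw [k1, k2]

end SaddleConnection

namespace PeriodicTrajectory

variable {θ : Params} (f : PeriodicTrajectory θ)

theorem onLeft_zero_iff (hθ : IsTriangle θ) {j : ℤ} (h : f.edge j = 2) :
    f.OnLeft j 0 ↔ ¬Even j := by
  have := (f.onLeft_iff hθ j).2.1
  rwa [h] at this

theorem onRight_zero_iff (hθ : IsTriangle θ) {j : ℤ} (h : f.edge j = 2) :
    f.OnRight j 0 ↔ Even j := by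
  have := (f.onLeft_iff hθ j).2.2.2
  rwa [h] at this

/-- Left vertices are higher than right vertices with respect to the direction of the
trajectory. -/
theorem cross_lt_cross (hθ : IsTriangle θ) {j j' : ℤ} (hj : f.edge j = 2) (hj' : f.edge j' = 2)
    (he : Even j) (ho : ¬Even j') :
    cross f.displacement (copyMap θ f.edge j 0) < cross f.displacement (copyMap θ f.edge j' 0) := by
  have h1 : cross _ _ < 0 := (f.onRight_zero_iff hθ hj).2 he
  have h2 : 0 < cross _ _ := (f.onLeft_zero_iff hθ hj').2 ho
  rw [vertex_zero, cross_sub_right] at h1 h2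
  linarith

end PeriodicTrajectory

/-- The orbit tile avoids a sector around the direction of right triangles. -/
theorem exists_sector_disjoint {P : Params} (hP : IsTriangle P) {a : ℝ} (h₀ : 0 < a)
    (h₁ : a < Real.pi / 2) {f : PeriodicTrajectory P} (g : SaddleConnection f (rightTriangle a))
    {p : ℝ} (hp0 : 0 < p) (hp : g.HasPeriod p)
    (honce : ∃! s : ℝ, s ∈ Set.Ico 0 p ∧ g.StrikesAt 0 s)
    (hother : ∀ s, ¬g.StrikesAt 1 s)
    (hccw : g.HasCounterclockwiseSemicircle 0) (hcw : g.HasClockwiseSemicircle 0) :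
    rightTriangle a ∉ f.orbitTile ∧ ∀ᶠ x : ℝ × ℝ in 𝓝 (7 * Real.pi / 4) ×ˢ 𝓝[>] 0,
      rightTriangle a + x.2 • (!₂[Real.cos x.1, Real.sin x.1] : Params) ∉ f.orbitTile := by
  set S := g.strip hP h₀ h₁ hother with hSdef
  have hS : S.IsRight a := g.isRight_strip hP h₀ h₁ hother
  have hrec : S.Recurs a p := g.recurs_strip hP h₀ h₁ hother hp
  have hrec' : S.Recurs a (-p) := g.recurs_strip hP h₀ h₁ hother hp.neg
  have hcl : S.Closes f.len := g.closes_strip hP h₀ h₁ hother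
  have hstr : ∀ s, g.StrikesAt 0 s ↔ S.Strikes s := g.strikesAt_zero_iff hP h₀ h₁ hother
  obtain ⟨s₀, ⟨hs₀, hst₀⟩, huniq⟩ := honce
  have hzadd : ∀ (i : ℤ) (s : ℝ), S.Strikes s → S.Strikes (s + i * p) := by
    intro i s hs
    induction i with
    | zero => simpa using hs
    | succ i ih =>
      have := ih.add hS hcl hrec
      convert this using 1
      push_cast; ring
    | pred i ih =>
      have := ih.add hS hcl hrec'
      convert this using 1
      push_cast; ring
  have hiff : ∀ s, S.Strikes s ↔ ∃ i : ℤ, s = s₀ + i * p := by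
    intro s
    constructor
    · intro hs
      -- The strike is shifted into the interval [0, p), where `s₀` is the only one.
      refine ⟨⌊s / p⌋, ?_⟩
      have h1 := hzadd (-⌊s / p⌋) s hs
      have h2 : s + ((-⌊s / p⌋ : ℤ) : ℝ) * p ∈ Set.Ico 0 p := by
        have e1 := Int.floor_le (s / p)
        have e2 := Int.lt_floor_add_one (s / p)
        rw [le_div_iff₀ hp0] at e1
        rw [div_lt_iff₀ hp0] at e2
        push_cast
        constructor <;> linarith
      have h3 := huniq _ ⟨h2, (hstr _).2 h1⟩
      push_cast at h3
      linarith
    · rintro ⟨i, rfl⟩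
      exact hzadd i s₀ ((hstr _).1 hst₀)
  choose e he using fun i : ℤ => ((hiff (s₀ + i * p)).2 ⟨i, rfl⟩).exists_isLeast hcl
  choose l hl using fun i : ℤ => ((hiff (s₀ + i * p)).2 ⟨i, rfl⟩).exists_isGreatest hcl
  have hseq : S.StrikeSequence s₀ p e l := ⟨hp0, hiff, he, hl⟩
  have hwe : ∀ i, f.edge (e i) = 2 := fun i => (he i).1.1
  have hturn := fun i => hS.turn (hseq.strikes i) (he i) (hl i)
  obtain ⟨q, hq⟩ := hseq.exists_turnCount_eq hS hrec
  -- strikes of both kinds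
  have hodd : ∃ i, ¬Even (e i) := by
    obtain ⟨j, s, hj, hleft⟩ := hccw
    obtain ⟨b, hb, hbj⟩ := g.exists_gate hP h₀ h₁ hother hj
    obtain ⟨i, rfl⟩ := (hiff s).1 ((hstr s).1 ⟨j, hj⟩)
    refine ⟨i, fun hev => ?_⟩
    have h1 : f.OnLeft b 0 := by
      unfold PeriodicTrajectory.OnLeft at hleft ⊢
      rwa [hbj]
    exact (f.onLeft_zero_iff hP hb.1).1 h1 (((hturn i).2.1 b hb).2 hev)
  have heven : ∃ i, Even (e i) := by
    obtain ⟨j, s, hj, hright⟩ := hcw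
    obtain ⟨b, hb, hbj⟩ := g.exists_gate hP h₀ h₁ hother hj
    obtain ⟨i, rfl⟩ := (hiff s).1 ((hstr s).1 ⟨j, hj⟩)
    refine ⟨i, ?_⟩
    have h1 : f.OnRight b 0 := by
      unfold PeriodicTrajectory.OnRight at hright ⊢
      rwa [hbj]
    exact ((hturn i).2.1 b hb).1 ((f.onRight_zero_iff hP hb.1).1 h1)
  -- periodicity of the sequence of strikes
  obtain ⟨m, hm⟩ : ∃ m : ℤ, (m : ℝ) * p = 1 := by
    obtain ⟨j, hj⟩ := hst₀
    have h1 : g.StrikesAt 0 (s₀ + 1) := by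
      refine ⟨j + f.len, ?_⟩
      rw [g.copyMap_add_len, hj, SaddleConnection.path, SaddleConnection.path, add_smul, one_smul]
      abel
    obtain ⟨m, hm⟩ := (hiff _).1 ((hstr _).1 h1)
    exact ⟨m, by linarith⟩
  have hm0 : 0 < m := by
    have : (0 : ℝ) < m := by
      by_contra h
      nlinarith
    exact_mod_cast this
  have heper : ∀ i, e (i + m) = e i + f.len := by
    intro i
    have ht : s₀ + ((i + m : ℤ) : ℝ) * p = s₀ + i * p + 1 := by
      push_cast
      rw [add_mul, hm, add_assoc]
    have h1 := he (i + m)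
    rw [ht] at h1
    obtain ⟨a1, -, a3, -⟩ := hcl.2 (e i) (he i).1.1
    obtain ⟨-, b2, -, b4⟩ := hcl.2 (e (i + m)) h1.1.1
    apply le_antisymm
    · exact h1.2 ⟨a1, by rw [a3, (he i).1.2]⟩
    · have := (he i).2 (show e (i + m) - f.len ∈ S.gates (s₀ + i * p) from
        ⟨b2, by rw [b4, h1.1.2]; ring⟩)
      linarith
  obtain ⟨C, hCd, hC⟩ := exists_differentiable_copyMap f.edge
  have htri := isTriangle_rightTriangle h₀ h₁
  have hCr : ∀ᶠ b in 𝓝 a, ∀ j, C j (rightTriangle b) = rhombusVertex f.edge b j := by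
    filter_upwards [lt_mem_nhds h₀, gt_mem_nhds h₁] with b hb0 hb1 j
    rw [← hC _ (isTriangle_rightTriangle hb0 hb1), copyMap_rightTriangle_zero hb0 hb1]
  have hCa := hCr.self_of_nhds
  have hDa : C f.len (rightTriangle a) = g.disp := by
    rw [← hC _ htri, g.closes, zero_add]
  -- the heights of the struck vertices
  have hheight : ∀ θ, θ ∈ f.orbitTile →
      (∀ i k, Even (e i) → ¬Even (e k) →
        cross (C f.len θ) (C (e i) θ) < cross (C f.len θ) (C (e k) θ)) ∧
      ∀ i, cross (C f.len θ) (C (e (i + m)) θ) = cross (C f.len θ) (C (e i) θ) := by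
    -- The side of the vertex 0 of a crossed hypotenuse depends only on the parity of its index, so
    -- it is the same for `f'` and `f`.
    rintro θ ⟨hθ, f', hlen, hedge⟩
    have hdisp : f'.displacement = C f.len θ := by
      rw [f'.displacement_eq_apply_zero hθ, hlen, hedge, hC θ hθ]
    constructor
    · intro i k hi hk
      have := f'.cross_lt_cross hθ (j := e i) (j' := e k) (by rw [hedge]; exact hwe i)
        (by rw [hedge]; exact hwe k) hi hk
      rwa [hdisp, hedge, hC θ hθ, hC θ hθ] at this
    · intro i
      have h1 : C (e (i + m)) θ = C (e i) θ + C f.len θ := by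
        rw [← hC θ hθ, ← hC θ hθ, heper, copyMap_add_period θ f.edge_periodic, ← hdisp, ← hlen,
          ← hedge]
        exact f'.displacement_eq_of_pt hθ _
      rw [h1, cross_add_right, cross_self, add_zero]
  let F : ℤ → Params → ℝ := fun i θ => cross (C f.len θ)
    (C (e (i + 1)) θ - 2 * C (e i) θ + C (e (i - 1)) θ)
  have hFeq : ∀ i θ, F i θ = cross (C f.len θ) (C (e (i + 1)) θ)
      - 2 * cross (C f.len θ) (C (e i) θ) + cross (C f.len θ) (C (e (i - 1)) θ) := by
    intro i θ
    simp only [F]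
    rw [cross_add_right, cross_sub_right, show (2 : ℂ) = ((2 : ℝ) : ℂ) by norm_num,
      cross_ofReal_mul_right]
  have hF0 : ∀ i, F i (rightTriangle a) = 0 := by
    intro i
    have h1 := hseq.second_difference hS hrec (i - 1) a
    rw [sub_add_cancel] at h1
    simp only [F, hCa]
    change cross _ (rhombusVertex S.w a _ - 2 * rhombusVertex S.w a _ + rhombusVertex S.w a _) = 0
    rw [h1]
    simp [cross]
  -- the derivatives of the second differences
  have hFd : ∀ i, ∃ F' : Params →L[ℝ] ℝ, HasFDerivAt (F i) F' (rightTriangle a) ∧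
      F' !₂[1, -1] = 2 * ((q + (turnCount f.edge (l i + 1) - turnCount f.edge (e i)) : ℤ) : ℝ)
        * p * ‖g.disp‖ ^ 2 := by
    intro i
    -- The turns since the previous strike are the `q` turns on the way and those made at strike
    -- `i`.
    have hN : turnCount f.edge (l i + 1) - turnCount f.edge (l (i - 1) + 1)
        = q + (turnCount f.edge (l i + 1) - turnCount f.edge (e i)) := by
      have := hq (i - 1)
      rw [sub_add_cancel] at this
      rw [← this]
      change _ = (turnCount f.edge (e i) - turnCount f.edge (l (i - 1) + 1)) + _
      ring
    rw [← hN]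
    refine exists_hasFDerivAt_cross (hCd _)
      (W := fun θ => C (e (i + 1)) θ - 2 * C (e i) θ + C (e (i - 1)) θ) (((hCd _).sub ((hCd _).const_mul 2)).add (hCd _))
      (V := fun θ => C (e i) θ - C (e (i - 1)) θ) ((hCd _).sub (hCd _)) hDa ?_ ?_
    · have := hseq.vertex_sub hS (i - 1)
      rw [sub_add_cancel] at this
      rw [hCa, hCa]
      exact this
    · filter_upwards [hCr] with b hb
      have h1 := hseq.second_difference hS hrec (i - 1) b
      rw [sub_add_cancel] at h1
      simp only [hb]
      exact h1
  have hcpos : 0 < p * ‖g.disp‖ ^ 2 := by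
    have := norm_pos_iff.2 g.disp_ne
    positivity
  have hsector : ∀ (i : ℤ) (σ : ℝ), 0 < σ * ((q + (turnCount f.edge (l i + 1)
      - turnCount f.edge (e i)) : ℤ) : ℝ) →
      ∀ᶠ x : ℝ × ℝ in 𝓝 (7 * Real.pi / 4) ×ˢ 𝓝[>] 0,
        0 < σ * F i (rightTriangle a + x.2 • (!₂[Real.cos x.1, Real.sin x.1] : Params)) := by
    intro i σ hσ
    obtain ⟨F', h1, h2⟩ := hFd i
    refine eventually_pos_of_hasFDerivAt (F' := σ • F') (h1.const_mul σ) ?_ ?_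
    · rw [hF0, mul_zero]
    · rw [cos_sin_seven_pi_div_four, map_smul]
      change 0 < (√2 / 2) * (σ * F' !₂[1, -1])
      rw [h2]
      have h3 : (0 : ℝ) < √2 / 2 := by positivity
      have h4 := mul_pos hσ hcpos
      refine mul_pos h3 ?_
      linarith
  constructor
  · intro hmem
    obtain ⟨i, hi⟩ := heven
    obtain ⟨k, hk⟩ := hodd
    have h1 := (hheight _ hmem).1 i k hi hk
    have h2 : ∀ i, C (e i) (rightTriangle a) = S.line (s₀ + i * p) := by
      intro i
      rw [hCa, (hseq.strikes i).line_eq (he i).1]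
      rfl
    -- On the right triangle itself all struck vertices lie on g, hence none is higher than another.
    have h3 : ∀ i, cross g.disp (C (e i) (rightTriangle a)) = cross g.disp g.base := by
      intro i
      rw [h2, RhombusStrip.line]
      change cross g.disp (g.base + (s₀ + i * p) • g.disp) = _
      rw [cross_add_right, cross_smul_right, cross_self, mul_zero, add_zero]
    rw [hDa, h3, h3] at h1
    exact lt_irrefl _ h1
  -- The sign of `q` decides which kind of strike has a rotation number of definite sign: the odd,
  -- left strikes if `q` is nonnegative, the even, right ones otherwise.
  · rcases le_or_gt 0 q with hq0 | hq0
    · have hall : ∀ᶠ x : ℝ × ℝ in 𝓝 (7 * Real.pi / 4) ×ˢ 𝓝[>] 0, ∀ i ∈ Finset.Ico 0 m,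
          ¬Even (e i) →
          0 < 1 * F i (rightTriangle a + x.2 • (!₂[Real.cos x.1, Real.sin x.1] : Params)) := by
        rw [Filter.eventually_all_finset]
        intro i _
        by_cases hi : Even (e i)
        · exact Eventually.of_forall fun x h => absurd hi h
        · have h1 : turnCount f.edge (e i) + 1 ≤ turnCount f.edge (l i + 1) := (hturn i).2.2.2 hi
          filter_upwards [hsector i 1 (by rw [one_mul]; exact_mod_cast (by omega))] with x hx _
          exact hx
      filter_upwards [hall] with x hx hmem
      obtain ⟨k1, k2⟩ := hheight _ hmem
      -- A vertex of maximal height is a left one, and the second difference at a maximum cannot be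
      -- positive. By periodicity finitely many indices suffice, so the sector can be chosen for all
      -- at once.
      obtain ⟨i, hi, hmax⟩ := exists_max_of_periodic
        (h := fun i => cross (C f.len _) (C (e i) _)) hm0 k2
      have hio : ¬Even (e i) := by
        intro hev
        obtain ⟨k, hk⟩ := hodd
        exact absurd (k1 i k hev hk) (not_lt.2 (hmax k))
      have h1 := hx i hi hio
      rw [one_mul, hFeq] at h1
      linarith [hmax (i + 1), hmax (i - 1)]
    · have hall : ∀ᶠ x : ℝ × ℝ in 𝓝 (7 * Real.pi / 4) ×ˢ 𝓝[>] 0, ∀ i ∈ Finset.Ico 0 m,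
          Even (e i) →
          0 < -1 * F i (rightTriangle a + x.2 • (!₂[Real.cos x.1, Real.sin x.1] : Params)) := by
        rw [Filter.eventually_all_finset]
        intro i _
        by_cases hi : Even (e i)
        · have h1 : turnCount f.edge (l i + 1) ≤ turnCount f.edge (e i) - 1 := (hturn i).2.2.1 hi
          have h2 : q + (turnCount f.edge (l i + 1) - turnCount f.edge (e i)) < 0 := by omega
          have h3 : ((q + (turnCount f.edge (l i + 1) - turnCount f.edge (e i)) : ℤ) : ℝ) < 0 := by
            exact_mod_cast h2
          filter_upwards [hsector i (-1) (by linarith)] with x hx _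
          exact hx
        · exact Eventually.of_forall fun x h => absurd h hi
      filter_upwards [hall] with x hx hmem
      obtain ⟨k1, k2⟩ := hheight _ hmem
      -- The negated heights have their maximum at a lowest vertex, which is a right one.
      obtain ⟨i, hi, hmax⟩ := exists_max_of_periodic (h := fun i => -cross _ (C (e i) _)) hm0
        fun i => congrArg Neg.neg (k2 i)
      have hie : Even (e i) := by
        by_contra hev
        obtain ⟨k, hk⟩ := heven
        have := hmax k
        linarith [k1 k i hk hev]
      have h1 := hx i hi hie
      rw [hFeq] at h1
      linarith [hmax (i + 1), hmax (i - 1)]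

/-- An eventual statement about polar coordinates near a direction, in terms of rays. -/
theorem exists_disjoint_ray {T : Params} {O : Set Params} {φ₀ : ℝ} (hT : T ∉ O)
    (h : ∀ᶠ x : ℝ × ℝ in 𝓝 φ₀ ×ˢ 𝓝[>] 0,
      T + x.2 • (!₂[Real.cos x.1, Real.sin x.1] : Params) ∉ O) :
    ∃ ε₀ > 0, ∃ δ₀ > 0, ∀ φ, |φ - φ₀| < ε₀ → ∀ δ ∈ Set.Ioo (0 : ℝ) δ₀,
      Disjoint (O ∩ Metric.ball T δ) (ray T φ) := by
  obtain ⟨A, hA, B, hB, hAB⟩ := mem_prod_iff.1 h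
  obtain ⟨ε₀, hε₀, hA'⟩ := Metric.mem_nhds_iff.1 hA
  obtain ⟨δ₀, hδ₀, hB'⟩ := mem_nhdsGT_iff_exists_Ioo_subset.1 hB
  refine ⟨ε₀, hε₀, δ₀, hδ₀, fun φ hφ δ hδ => Set.disjoint_left.2 ?_⟩
  rintro x ⟨hxO, hxb⟩ ⟨r, hr, rfl⟩
  -- The filter in `h` only sees positive radii, so the apex is excluded by `hT`.
  rcases hr.eq_or_lt with rfl | hr
  · rw [zero_smul, add_zero] at hxO
    exact hT hxO
  · rw [Metric.mem_ball, dist_eq_norm, add_sub_cancel_left, norm_smul, norm_cos_sin, mul_one,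
      Real.norm_of_nonneg hr.le] at hxb
    have h1 : φ ∈ A := hA' (by rwa [Metric.mem_ball, Real.dist_eq])
    have h2 : r ∈ B := hB' ⟨hr, hxb.trans hδ.2⟩
    exact hAB (Set.mk_mem_prod h1 h2) hxO

end Billiards

end

theorem mainTheorem6 (P T : Billiards.Params)
    (hP : Billiards.IsTriangle P) (hT : Billiards.IsTriangle T)
    (hright : T 0 + T 1 = Real.pi / 2)
    (k : ℕ) (hk : 1 ≤ k)
    (hlow : Real.pi / (4 * k + 2) ≤ T 0) (hupp : T 0 ≤ Real.pi / (4 * k))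
    (f : Billiards.PeriodicTrajectory P) (g : Billiards.SaddleConnection f T)
    (p : ℝ) (hp : g.IsThePeriod p) (hmore : 1 < 1 / p)
    (honce : ∃! s : ℝ, s ∈ Set.Ico 0 p ∧ g.StrikesAt 0 s)
    (hother : ∀ s : ℝ, ¬ g.StrikesAt 1 s)
    (hccw : g.HasCounterclockwiseSemicircle 0)
    (hcw : g.HasClockwiseSemicircle 0) :
    ∃ ε₀ > 0, ∃ δ₀ > 0, ∀ ε ∈ Set.Ioo (0 : ℝ) ε₀, ∀ δ ∈ Set.Ioo (0 : ℝ) δ₀,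
      Disjoint (f.orbitTile ∩ Metric.ball T δ) (Billiards.ray T (7 * Real.pi / 4 + ε)) ∧
      Disjoint (f.orbitTile ∩ Metric.ball T δ) (Billiards.ray T (7 * Real.pi / 4 - ε)) := by
  have hTr : T = Billiards.rightTriangle (T 0) := by
    ext i
    fin_cases i
    · rfl
    · change T 1 = Real.pi / 2 - T 0
      linarith
  have h₀ : 0 < T 0 := hT.1
  have h₁ : T 0 < Real.pi / 2 := by linarith [hT.2.1]
  generalize T 0 = a at hTr h₀ h₁
  subst hTr
  obtain ⟨hnot, hev⟩ := Billiards.exists_sector_disjoint hP h₀ h₁ g hp.1.1 hp.1.2 honce hother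
    hccw hcw
  obtain ⟨ε₀, hε₀, δ₀, hδ₀, h⟩ := Billiards.exists_disjoint_ray hnot hev
  -- Both rays lie in the same sector around the direction 7π/4.
  refine ⟨ε₀, hε₀, δ₀, hδ₀, fun ε hε δ hδ => ⟨h _ ?_ δ hδ, h _ ?_ δ hδ⟩⟩
  · rw [add_sub_cancel_left, abs_of_pos hε.1]
    exact hε.2
  · rw [sub_sub_cancel_left, abs_neg, abs_of_pos hε.1]
    exact hε.2
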